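/- **Setting.** Let $\Lambda_\oplus$ be the set of terms $M,N ::= x \mid \lambda x.M \mid MN \mid M\oplus N$, up to renaming of bound variables. *Resource terms* and *monomials* are defined by mutual induction: $s ::= x \mid \lambda x.s \mid \langle s\rangle\bar t \mid s\oplus\bullet \mid \bullet\oplus s$, and a monomial $\bar t=[t_1,\dots,t_n]$ is a finite multiset of resource terms. Finite sums of resource terms are the elements of the free commutative monoid on resource terms; all the constructors are extended to sums by linearity. Reduction $\to_\partial$ goes from resource terms to finite sums. It is generated by $$\langle\lambda x.s\rangle\bar t\to_\partial \partial_x s\cdot\bar t,\quad \langle s\oplus\bullet\rangle\bar t\to_\partial \langle s\rangle\bar t\oplus\bullet,\quad \langle\bullet\oplus s\rangle\bar t\to_\partial \bullet\oplus\langle s\rangle\bar t,\quad \lambda x.(s\oplus\bullet)\to_\partial(\lambda x.s)\oplus\bullet,\quad \lambda x.(\bullet\oplus s)\to_\partial\bullet\oplus(\lambda x.s)$$ and closed under all contexts. Here $\partial_x s\cdot[u_1,\dots,u_n]$ is the symmetric multilinear substitution: the sum, over all bijections between the indices $1,\dots,n$ and the free occurrences of $x$ in $s$, of the result of replacing these occurrences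 by the corresponding $u_i$; it is $0$ if $x$ does not have exactly $n$ occurrences. On sums, $s+F\to_\partial S+F$ whenever $s\to_\partial S$. A *normal form* of a sum $E$ is a sum $F$ with $E\to_\partial^*F$ that cannot be reduced. The *multiplicity coefficient* $m$ is given by $m(x)=1$, $m(\lambda x.s)=m(s\oplus\bullet)=m(\bullet\oplus s)=m(s)$ and $m(\langle s\rangle([t_1]^{n_1}\cdots[t_k]^{n_k}))=m(s)\prod_i n_i!\,m(t_i)^{n_i}$ for pairwise distinct $t_i$. *Approximants* are terms with an additional constant $\bot$, ordered by the least partial order $\le$ that is compatible with the constructors and has $\bot\le A$ for all $A$. The *Taylor expansion* of an approximant (in particular of a term) is the possibly infinite linear combination of resource terms, with nonnegative rational coefficients, given by $$\tau(\bot)=0,\quad \tau(x)=x,\quad \tau(\lambda x.A)=\lambda x.\tau(A),\quad \tau(AB)=\Big\langle\tau(A)\Big\rangle\sum_{n\ge0}\frac1{n!}\tau(B)^n,\quad \tau(A\oplus B)=(\tau(A)\oplus\bullet)+(\bullet\oplus\tau(B)),$$ where $S^0=[\,]$ and $S^{n+1}=[S]\cdot S^n$. Write $T(A)$ for the support of $\tau(A)$.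 *Elementary Böhm trees* form the least set $\mathcal N$ of approximants that contains $\bot$, contains $\lambda\vec x.\,y\,N_1\cdots N_k$ whenever $N_1,\dots,N_k\in\mathcal N$, and is closed under $\oplus$. Hereditary head reduction $L:\Lambda_\oplus\to\Lambda_\oplus$ is defined by $L(M\oplus N)=L(M)\oplus L(N)$, $L(\lambda\vec x.\lambda y.(M\oplus N))=\lambda\vec x.(\lambda y.M\oplus\lambda y.N)$, $L(\lambda\vec x.(M\oplus N)PQ_1\cdots Q_k)=\lambda\vec x.(MP\oplus NP)Q_1\cdots Q_k$, $L(\lambda\vec x.\,y\,Q_1\cdots Q_k)=\lambda\vec x.\,y\,L(Q_1)\cdots L(Q_k)$, $L(\lambda\vec x.(\lambda y.M)NQ_1\cdots Q_k)=\lambda\vec x.\,M[N/y]Q_1\cdots Q_k$. Set $\mathrm{eBT}(M\oplus N)=\mathrm{eBT}(M)\oplus\mathrm{eBT}(N)$, $\mathrm{eBT}(\lambda\vec x.\,y\,Q_1\cdots Q_k)=\lambda\vec x.\,y\,\mathrm{eBT}(Q_1)\cdots\mathrm{eBT}(Q_k)$, and $\mathrm{eBT}(M)=\bot$ in all other cases.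 The *Böhm tree* of $M$ is $\mathrm{BT}(M)=\{N\in\mathcal N\mid \exists n,\ N\le\mathrm{eBT}(L^n(M))\}$. Put $T(\mathrm{BT}(M))=\bigcup_{B\in\mathrm{BT}(M)}T(B)$ and $\tau(\mathrm{BT}(M))=\sum_{u\in T(\mathrm{BT}(M))}\frac1{m(u)}u$. **Theorem.** Every finite sum $E$ of resource terms has exactly one normal form, written $\mathrm{NF}(E)$. For every $M\in\Lambda_\oplus$: 1. for all $B\in\mathrm{BT}(M)$ and $u\in T(B)$, the coefficient of $u$ in $\tau(B)$ is $\frac1{m(u)}$ (so that $\tau(\mathrm{BT}(M))$ agrees with the $\tau(B)$ on their supports); 2. the supports of the $\mathrm{NF}(s)$, for $s\in T(M)$, are pairwise disjoint, so that the sum $\mathrm{NF}(\tau(M)):=\sum_{s\in T(M)}\tau(M)_s\,\mathrm{NF}(s)$ is well defined; 3. $\tau(\mathrm{BT}(M))=\mathrm{NF}(\tau(M))$; that is, $\mathrm{NF}(\tau(M))$ has support $T(\mathrm{BT}(M))$, and its coefficient at each $u\in T(\mathrm{BT}(M))$ is $\frac1{m(u)}$. -/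

import Mathlib

namespace NDLambda

/-! ### Nondeterministic lambda terms

Terms up to renaming of bound variables are represented with de Bruijn indices: `var n` refers
to the `n`-th enclosing binder, and indices exceeding the number of enclosing binders are free
variables. -/

/-- The set `Λ_⊕` of nondeterministic lambda terms. -/
inductive Term : Type
  | var (n : ℕ) : Term
  | lam (M : Term) : Term
  | app (M N : Term) : Term
  | plus (M N : Term) : Term

namespace Term

/-- Increment all variables of index at least `c`. -/
def shift : ℕ → Term → Term
  | c, var n => var (if n < c then n else n + 1)
  | c, lam M => lam (shift (c + 1) M)
  | c, app M N => app (shift c M) (shift c N)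
  | c, plus M N => plus (shift c M) (shift c N)

/-- `subst k N M` is the capture avoiding substitution of `N` for the variable `k` in `M`,
the variable `k` being removed from the context. -/
def subst : ℕ → Term → Term → Term
  | k, N, var n => if n = k then N else var (if n < k then n else n - 1)
  | k, N, lam M => lam (subst (k + 1) (shift 0 N) M)
  | k, N, app M P => app (subst k N M) (subst k N P)
  | k, N, plus M P => plus (subst k N M) (subst k N P)

/-- `M` has the form `y Q₁ ⋯ Qₖ` with `y` a variable and `k ≥ 0`. -/
def isNeutral : Term → Bool
  | var _ => true
  | app M _ => isNeutral M
  | _ => false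

/-- `M` has the form `λ x₁ ⋯ xₙ. y Q₁ ⋯ Qₖ` with `y` a variable and `n, k ≥ 0`. -/
def isHeadNormal : Term → Bool
  | lam M => isHeadNormal M
  | M => isNeutral M

/-- The hereditary head reduction function `L`:
* `L (M ⊕ N) = L M ⊕ L N`;
* `L (λ xs. λ y. (M ⊕ N)) = λ xs. (λ y. M ⊕ λ y. N)`;
* `L (λ xs. (M ⊕ N) P Q₁ ⋯ Qₖ) = λ xs. (M P ⊕ N P) Q₁ ⋯ Qₖ`;
* `L (λ xs. y Q₁ ⋯ Qₖ) = λ xs. y (L Q₁) ⋯ (L Qₖ)`;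
* `L (λ xs. (λ y. M) N Q₁ ⋯ Qₖ) = λ xs. M[N/y] Q₁ ⋯ Qₖ`. -/
def headRed : Term → Term
  | var n => var n
  | plus M N => plus (headRed M) (headRed N)
  | lam (plus M N) => plus (lam M) (lam N)
  | lam M => lam (headRed M)
  | app (plus M N) P => plus (app M P) (app N P)
  | app (lam M) N => subst 0 N M
  | app M N => if isNeutral M then app (headRed M) (headRed N) else app (headRed M) N

end Term

/-! ### Approximants and Böhm trees -/

/-- Term approximants: terms with an additional constant `⊥`. -/
inductive Approx : Type
  | bot : Approx
  | var (n : ℕ) : Approx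
  | lam (A : Approx) : Approx
  | app (A B : Approx) : Approx
  | plus (A B : Approx) : Approx

/-- The inclusion of terms into term approximants. -/
def Term.toApprox : Term → Approx
  | .var n => .var n
  | .lam M => .lam M.toApprox
  | .app M N => .app M.toApprox N.toApprox
  | .plus M N => .plus M.toApprox N.toApprox

namespace Approx

/-- The approximation order: the least partial order compatible with the syntactic constructs
such that `⊥` is below every approximant. -/
inductive Le : Approx → Approx → Prop
  | bot (A : Approx) : Le bot A
  | refl (A : Approx) : Le A A
  | trans {A B C : Approx} : Le A B → Le B C → Le A C
  | lam {A A' : Approx} : Le A A' → Le (lam A) (lam A')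
  | app {A A' B B' : Approx} : Le A A' → Le B B' → Le (app A B) (app A' B')
  | plus {A A' B B' : Approx} : Le A A' → Le B B' → Le (plus A B) (plus A' B')

/-- `lams n A` is `λ x₁ ⋯ xₙ. A`. -/
def lams : ℕ → Approx → Approx
  | 0, A => A
  | n + 1, A => lam (lams n A)

/-- `apps A [B₁, …, Bₖ]` is `A B₁ ⋯ Bₖ`. -/
def apps : Approx → List Approx → Approx
  | A, [] => A
  | A, B :: Bs => apps (app A B) Bs

/-- Elementary Böhm trees. -/
inductive IsElementary : Approx → Prop
  | bot : IsElementary bot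
  | head (n x : ℕ) (Ns : List Approx) :
      (∀ N ∈ Ns, IsElementary N) → IsElementary (lams n (apps (var x) Ns))
  | plus {A B : Approx} : IsElementary A → IsElementary B → IsElementary (plus A B)

end Approx

/-- The elementary Böhm tree of a term:
* `eBT (M ⊕ N) = eBT M ⊕ eBT N`;
* `eBT (λ xs. y Q₁ ⋯ Qₖ) = λ xs. y (eBT Q₁) ⋯ (eBT Qₖ)`;
* `eBT M = ⊥` in all other cases. -/
def Term.eBT : Term → Approx
  | .var n => .var n
  | .plus M N => .plus M.eBT N.eBT
  | .lam M => if M.isHeadNormal then .lam M.eBT else .bot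
  | .app M N => if M.isNeutral then .app M.eBT N.eBT else .bot

/-- The Böhm tree of a term, as a set of elementary Böhm trees. -/
def Term.BT (M : Term) : Set Approx :=
  {A | A.IsElementary ∧ ∃ n : ℕ, A.Le (Term.eBT (Term.headRed^[n] M))}

/-! ### Resource terms

Resource terms are built from variables, abstractions, applications of a term to a finite
multiset of terms, and two injections `s ⊕ •` and `• ⊕ s`. They are obtained from preterms, in
which multisets are replaced with lists, by identifying preterms that only differ by the order of
elements in argument lists, at any depth. -/

/-- Preterms: resource terms with lists instead of multisets. -/
inductive PreTerm : Type
  | var (n : ℕ) : PreTerm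
  | lam (a : PreTerm) : PreTerm
  | app (a : PreTerm) (bs : List PreTerm) : PreTerm
  | inl (a : PreTerm) : PreTerm
  | inr (a : PreTerm) : PreTerm

/-- Permuting one argument list, anywhere in a preterm. -/
inductive PreTerm.PermStep : PreTerm → PreTerm → Prop
  | perm (a : PreTerm) {bs cs : List PreTerm} : bs.Perm cs → PermStep (app a bs) (app a cs)
  | lam {a a' : PreTerm} : PermStep a a' → PermStep (lam a) (lam a')
  | appFun {a a' : PreTerm} (bs : List PreTerm) :
      PermStep a a' → PermStep (app a bs) (app a' bs)
  | appArg (a : PreTerm) {b b' : PreTerm} (bs cs : List PreTerm) :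
      PermStep b b' → PermStep (app a (bs ++ b :: cs)) (app a (bs ++ b' :: cs))
  | inl {a a' : PreTerm} : PermStep a a' → PermStep (inl a) (inl a')
  | inr {a a' : PreTerm} : PermStep a a' → PermStep (inr a) (inr a')

/-- Resource terms (the quotient by the equivalence relation generated by `PermStep`). -/
def ResTerm : Type := Quot PreTerm.PermStep

/-- Resource monomials: finite multisets of resource terms. -/
abbrev ResMonomial : Type := Multiset ResTerm

/-- Finite sums of resource terms: the free commutative monoid on resource terms, where the
multiplicity of a term is its coefficient. -/
abbrev ResSum : Type := Multiset ResTerm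

namespace ResTerm

/-- The class of a preterm. -/
def mk (a : PreTerm) : ResTerm := Quot.mk _ a

def var (n : ℕ) : ResTerm := mk (.var n)

def lam : ResTerm → ResTerm := Quot.map PreTerm.lam fun _ _ h => .lam h

def inl : ResTerm → ResTerm := Quot.map PreTerm.inl fun _ _ h => .inl h

def inr : ResTerm → ResTerm := Quot.map PreTerm.inr fun _ _ h => .inr h

/-- A representative of a resource term. -/
noncomputable def rep (s : ResTerm) : PreTerm := Quot.out s

theorem mk_rep (s : ResTerm) : mk (rep s) = s := Quot.out_eq s

/-- The application `⟨s⟩ t` of a resource term to a monomial. -/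
noncomputable def app (s : ResTerm) (t : ResMonomial) : ResTerm :=
  mk (.app (rep s) (t.toList.map rep))

theorem mk_app_congr_fun {a a' : PreTerm} (bs : List PreTerm) (h : mk a = mk a') :
    mk (.app a bs) = mk (.app a' bs) :=
  congrArg (Quot.lift (fun a => mk (.app a bs)) fun _ _ h => Quot.sound (.appFun bs h)) h

theorem mk_app_congr_args (a : PreTerm) {cs cs' : List PreTerm} (bs : List PreTerm)
    (h : cs.map mk = cs'.map mk) : mk (.app a (bs ++ cs)) = mk (.app a (bs ++ cs')) := by
  induction cs generalizing cs' bs with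
  | nil =>
    cases cs' with
    | nil => rfl
    | cons c' cs' => simp at h
  | cons c cs ih =>
    cases cs' with
    | nil => simp at h
    | cons c' cs' =>
      simp only [List.map_cons, List.cons.injEq] at h
      have h1 : mk (.app a (bs ++ c :: cs)) = mk (.app a (bs ++ c' :: cs)) :=
        congrArg (Quot.lift (fun c => mk (.app a (bs ++ c :: cs)))
          fun _ _ h => Quot.sound (.appArg a bs cs h)) h.1
      have h2 := ih (bs ++ [c']) h.2
      simp only [List.append_assoc, List.cons_append, List.nil_append] at h2
      exact h1.trans h2

/-- Application is computed on representatives. -/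
theorem app_mk (a : PreTerm) (bs : List PreTerm) :
    app (mk a) (bs.map mk : List ResTerm) = mk (.app a bs) := by
  have hp : ((bs.map mk : List ResTerm) : Multiset ResTerm).toList.Perm (bs.map mk) :=
    Multiset.coe_eq_coe.1 (Multiset.coe_toList _)
  have h1 : app (mk a) (bs.map mk : List ResTerm)
      = mk (.app (rep (mk a)) ((bs.map mk).map rep)) :=
    Quot.sound (.perm _ (hp.map _))
  rw [h1, mk_app_congr_fun _ (mk_rep (mk a))]
  refine mk_app_congr_args a [] ?_
  simp [mk_rep, Function.comp_def]

/-! #### Recursion on resource terms -/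

section Fold

variable {β : Type} (fvar : ℕ → β) (flam : ResTerm → β → β)
  (fapp : ResTerm → β → Multiset (ResTerm × β) → β) (finl finr : ResTerm → β → β)

mutual

/-- Recursion on preterms, with clauses insensitive to the order of arguments. -/
def foldPre : PreTerm → β
  | .var n => fvar n
  | .lam a => flam (mk a) (foldPre a)
  | .app a bs => fapp (mk a) (foldPre a) (foldPreList bs : List (ResTerm × β))
  | .inl a => finl (mk a) (foldPre a)
  | .inr a => finr (mk a) (foldPre a)

/-- Recursion on lists of preterms. -/
def foldPreList : List PreTerm → List (ResTerm × β)
  | [] => []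
  | b :: bs => (mk b, foldPre b) :: foldPreList bs

end

theorem foldPreList_eq (bs : List PreTerm) :
    foldPreList fvar flam fapp finl finr bs
      = bs.map fun b => (mk b, foldPre fvar flam fapp finl finr b) := by
  induction bs with
  | nil => simp [foldPreList]
  | cons b bs ih => simp [foldPreList, ih]

theorem foldPre_permStep {a a' : PreTerm} (h : PreTerm.PermStep a a') :
    foldPre fvar flam fapp finl finr a = foldPre fvar flam fapp finl finr a' := by
  induction h with
  | perm a h =>
    simp only [foldPre, foldPreList_eq]
    rw [Multiset.coe_eq_coe.2 (h.map _)]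
  | @lam a a' h ih =>
    have e : mk a = mk a' := Quot.sound h
    simp only [foldPre, ih, e]
  | @appFun a a' bs h ih =>
    have e : mk a = mk a' := Quot.sound h
    simp only [foldPre, ih, e]
  | @appArg a b b' bs cs h ih =>
    have e : mk b = mk b' := Quot.sound h
    simp only [foldPre, foldPreList_eq, List.map_append, List.map_cons, ih, e]
  | @inl a a' h ih =>
    have e : mk a = mk a' := Quot.sound h
    simp only [foldPre, ih, e]
  | @inr a a' h ih =>
    have e : mk a = mk a' := Quot.sound h
    simp only [foldPre, ih, e]

/-- Definition of functions by recursion on resource terms: each clause receives the immediate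
subterms together with the values of the function on them. -/
def fold : ResTerm → β :=
  Quot.lift (foldPre fvar flam fapp finl finr) fun _ _ h =>
    foldPre_permStep fvar flam fapp finl finr h

theorem fold_var (n : ℕ) : fold fvar flam fapp finl finr (var n) = fvar n := by
  simp [fold, var, mk, foldPre]

theorem fold_lam (s : ResTerm) :
    fold fvar flam fapp finl finr (lam s) = flam s (fold fvar flam fapp finl finr s) := by
  induction s using Quot.ind with
  | mk a => simp [fold, lam, mk, foldPre, Quot.map]

theorem fold_inl (s : ResTerm) :
    fold fvar flam fapp finl finr (inl s) = finl s (fold fvar flam fapp finl finr s) := by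
  induction s using Quot.ind with
  | mk a => simp [fold, inl, mk, foldPre, Quot.map]

theorem fold_inr (s : ResTerm) :
    fold fvar flam fapp finl finr (inr s) = finr s (fold fvar flam fapp finl finr s) := by
  induction s using Quot.ind with
  | mk a => simp [fold, inr, mk, foldPre, Quot.map]

theorem fold_app (s : ResTerm) (t : ResMonomial) :
    fold fvar flam fapp finl finr (app s t)
      = fapp s (fold fvar flam fapp finl finr s)
          (t.map fun u => (u, fold fvar flam fapp finl finr u)) := by
  have h : ∀ u : ResTerm,
      foldPre fvar flam fapp finl finr (rep u) = fold fvar flam fapp finl finr u :=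
    fun u => congrArg (fold fvar flam fapp finl finr) (mk_rep u)
  have e : fold fvar flam fapp finl finr (app s t)
      = foldPre fvar flam fapp finl finr (.app (rep s) (t.toList.map rep)) := rfl
  rw [e]
  simp only [foldPre, foldPreList_eq, List.map_map, Function.comp_def, mk_rep, h]
  rw [← Multiset.map_coe, Multiset.coe_toList]

end Fold

/-! #### Symmetric multilinear substitution -/

/-- Increment all variables of index at least `c`. -/
noncomputable def shift (c : ℕ) (s : ResTerm) : ResTerm :=
  fold (β := ℕ → ResTerm)
    (fun n c => var (if n < c then n else n + 1))
    (fun _ f c => lam (f (c + 1)))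
    (fun _ f ts c => app (f c) (ts.map fun p => p.2 c))
    (fun _ f c => inl (f c))
    (fun _ f c => inr (f c)) s c

/-- Given `f` and `g`, mapping a monomial `u` to a finite sum of terms and to a finite sum of
monomials respectively, this is the map `[u₁, …, uₙ] ↦ ∑ [f u_I] · g u_J`, where the sum ranges
over all the ordered partitions `(I, J)` of the index set `{1, …, n}`. -/
def consSubst (f : ResMonomial → ResSum) (g : ResMonomial → Multiset ResMonomial) :
    ResMonomial → Multiset ResMonomial := fun u =>
  u.antidiagonal.bind fun p => (f p.1).bind fun s => (g p.2).map fun t => s ::ₘ t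

theorem antidiagonal_bind_left_comm {γ : Type} (F : ResMonomial → ResMonomial → ResMonomial →
    Multiset γ) (u : ResMonomial) :
    (u.antidiagonal.bind fun p => p.2.antidiagonal.bind fun q => F p.1 q.1 q.2)
      = u.antidiagonal.bind fun p => p.2.antidiagonal.bind fun q => F q.1 p.1 q.2 := by
  induction u using Multiset.induction generalizing F with
  | empty => simp
  | cons a u ih =>
    simp only [Multiset.antidiagonal_cons, Multiset.add_bind, Multiset.bind_map, Prod.map_fst,
      Prod.map_snd, id_eq, Multiset.bind_add]
    rw [ih fun x y z => F x y (a ::ₘ z), ih fun x y z => F x (a ::ₘ y) z,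
      ih fun x y z => F (a ::ₘ x) y z]
    abel

instance consSubst_leftCommutative : LeftCommutative consSubst where
  left_comm f g h := by
    funext u
    have e : ∀ (f g : ResMonomial → ResSum),
        consSubst f (consSubst g h) u
          = u.antidiagonal.bind fun p => p.2.antidiagonal.bind fun q =>
              (f p.1).bind fun s => (g q.1).bind fun t => (h q.2).map fun r => s ::ₘ t ::ₘ r := by
      intro f g
      simp only [consSubst, Multiset.map_bind, Multiset.map_map, Function.comp_def]
      refine Multiset.bind_congr fun p _ => ?_
      rw [Multiset.bind_bind]
    rw [e f g, e g f, antidiagonal_bind_left_comm fun x y z =>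
      (f x).bind fun s => (g y).bind fun t => (h z).map fun r => s ::ₘ t ::ₘ r]
    refine Multiset.bind_congr fun p _ => Multiset.bind_congr fun q _ => ?_
    rw [Multiset.bind_bind]
    refine Multiset.bind_congr fun s _ => Multiset.bind_congr fun t _ => ?_
    simp only [Multiset.cons_swap]

/-- The substitution `∂ [t₁, …, tₖ] · u = ∑ [∂ t₁ · u_{I₁}, …, ∂ tₖ · u_{Iₖ}]` into a monomial,
the sum ranging over all the ordered partitions `(I₁, …, Iₖ)` of the index set of `u` (with possibly
empty parts), given the multiset of the functions `∂ tᵢ`. -/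
def monomialSubst (fs : Multiset (ResMonomial → ResSum)) : ResMonomial → Multiset ResMonomial :=
  fs.foldr consSubst fun u => if Multiset.card u = 0 then {0} else 0

/-- The symmetric multilinear substitution `∂_k s · u` of the monomial `u` for the variable `k` in
the resource term `s`, the variable `k` being removed from the context:
* `∂_k k · [u₁] = u₁`, `∂_k y · [] = y` for `y ≠ k`, and `∂_k y · u = 0` in the other cases;
* `∂_k` commutes with abstraction and with both injections;
* `∂_k ⟨s⟩t · u = ∑ ⟨∂_k s · u_I⟩ (∂_k t · u_J)` where the sum ranges over all the ordered
  partitions `(I, J)` of the index set of `u`. -/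
noncomputable def subst (k : ℕ) (s : ResTerm) (u : ResMonomial) : ResSum :=
  fold (β := ℕ → ResMonomial → ResSum)
    (fun n k u =>
      if n = k then (if Multiset.card u = 1 then u else 0)
      else if Multiset.card u = 0 then {var (if n < k then n else n - 1)} else 0)
    (fun _ f k u => (f (k + 1) (u.map (shift 0))).map lam)
    (fun _ f ts k u => u.antidiagonal.bind fun p =>
      (f k p.1).bind fun s => (monomialSubst (ts.map fun q => q.2 k) p.2).map fun t => app s t)
    (fun _ f k u => (f k u).map inl)
    (fun _ f k u => (f k u).map inr) s k u

/-! #### Reduction and normal forms -/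

/-- Reduction from resource terms to finite sums of resource terms. -/
inductive Red : ResTerm → ResSum → Prop
  | beta (s : ResTerm) (t : ResMonomial) : Red (app (lam s) t) (subst 0 s t)
  | appInl (s : ResTerm) (t : ResMonomial) : Red (app (inl s) t) {inl (app s t)}
  | appInr (s : ResTerm) (t : ResMonomial) : Red (app (inr s) t) {inr (app s t)}
  | lamInl (s : ResTerm) : Red (lam (inl s)) {inl (lam s)}
  | lamInr (s : ResTerm) : Red (lam (inr s)) {inr (lam s)}
  | lam {s : ResTerm} {S : ResSum} : Red s S → Red (lam s) (S.map lam)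
  | appFun {s : ResTerm} {S : ResSum} (t : ResMonomial) :
      Red s S → Red (app s t) (S.map fun s' => app s' t)
  | appArg (t : ResTerm) {s : ResTerm} {S : ResSum} (u : ResMonomial) :
      Red s S → Red (app t (s ::ₘ u)) (S.map fun s' => app t (s' ::ₘ u))
  | inl {s : ResTerm} {S : ResSum} : Red s S → Red (inl s) (S.map inl)
  | inr {s : ResTerm} {S : ResSum} : Red s S → Red (inr s) (S.map inr)

/-- Reduction of finite sums of resource terms: one summand is reduced. -/
inductive SumRed : ResSum → ResSum → Prop
  | mk {s : ResTerm} {S : ResSum} (F : ResSum) : Red s S → SumRed (s ::ₘ F) (S + F)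

/-- `F` is a normal form of `E`: it is reachable from `E` and it cannot be reduced. -/
def IsNormalFormOf (F E : ResSum) : Prop :=
  Relation.ReflTransGen SumRed E F ∧ ∀ G : ResSum, ¬ SumRed F G

open Classical in
/-- The normal form of a finite sum of resource terms (meaningful when `E` has exactly one normal
form). -/
noncomputable def NF (E : ResSum) : ResSum :=
  Classical.epsilon fun F => IsNormalFormOf F E

/-! #### Multiplicity coefficients -/

open Classical in
/-- The multiplicity coefficient:
`m (⟨s⟩ [t₁]^n₁ ⋯ [tₖ]^nₖ) = m s * ∏ i, nᵢ! * (m tᵢ) ^ nᵢ` for pairwise distinct `tᵢ`, and the other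
constructors do not contribute. -/
noncomputable def mult : ResTerm → ℕ :=
  fold (fun _ => 1) (fun _ x => x)
    (fun _ x ts => x *
      ∏ p ∈ ts.toFinset, (Nat.factorial (ts.count p) * p.2 ^ ts.count p))
    (fun _ x => x) (fun _ x => x)

open Classical in
theorem mult_app (s : ResTerm) (t : ResMonomial) :
    mult (app s t) = mult s *
      ∏ u ∈ t.toFinset, (Nat.factorial (t.count u) * mult u ^ t.count u) := by
  have hinj : Function.Injective fun u : ResTerm => (u, mult u) :=
    fun u v h => (Prod.ext_iff.1 h).1
  have e : (t.map fun u => (u, mult u)).toFinset = t.toFinset.image fun u => (u, mult u) := by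
    ext p
    simp
  rw [mult, fold_app]
  change mult s * ∏ p ∈ (t.map fun u => (u, mult u)).toFinset, _ = _
  rw [e, Finset.prod_image fun u _ v _ h => hinj h]
  refine congrArg _ (Finset.prod_congr rfl fun u _ => ?_)
  change Nat.factorial (Multiset.count (u, mult u) (t.map fun u => (u, mult u))) *
    mult u ^ (Multiset.count (u, mult u) (t.map fun u => (u, mult u))) = _
  rw [Multiset.count_map_eq_count' _ _ hinj]
  rfl

end ResTerm

/-! ### Infinite linear combinations and Taylor expansion -/

/-- Possibly infinite linear combinations of elements of `X` with nonnegative rational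
coefficients. -/
abbrev Vec (X : Type) : Type := X → ℚ≥0

namespace Vec

open Classical in
/-- A basis vector. -/
noncomputable def basis {X : Type} (x : X) : Vec X := fun y => if y = x then 1 else 0

/-- `∑ x, A x • f x`. In all the uses below, each component of this sum is finite. -/
noncomputable def map {X Y : Type} (f : X → Y) (A : Vec X) : Vec Y :=
  fun y => ∑ᶠ (x : X) (_ : f x = y), A x

/-- `∑ x, ∑ y, (A x * B y) • f x y`. In all the uses below, each component of this sum is
finite. -/
noncomputable def map₂ {X Y Z : Type} (f : X → Y → Z) (A : Vec X) (B : Vec Y) : Vec Z :=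
  map (fun p : X × Y => f p.1 p.2) fun p => A p.1 * B p.2

/-- The power `S ^ n`, with `S ^ 0 = []` and `S ^ (n + 1) = [S] · S ^ n`. -/
noncomputable def monomialPow (S : Vec ResTerm) : ℕ → Vec ResMonomial
  | 0 => basis 0
  | n + 1 => map₂ (fun s t => s ::ₘ t) S (monomialPow S n)

/-- The promotion `S^! = ∑ n, (1 / n!) S ^ n`. -/
noncomputable def promotion (S : Vec ResTerm) : Vec ResMonomial :=
  fun t => ∑ᶠ n : ℕ, ((Nat.factorial n : ℚ≥0))⁻¹ * monomialPow S n t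

open Classical in
/-- Termwise normalization `∑ s, S s • NF s` of a linear combination of resource terms (meaningful
when each component of this sum is finite). -/
noncomputable def NF (S : Vec ResTerm) : Vec ResTerm :=
  fun u => ∑ᶠ s : ResTerm, S s * ((ResTerm.NF {s}).count u : ℚ≥0)

end Vec

/-- The Taylor expansion of a term approximant. -/
noncomputable def Approx.taylor : Approx → Vec ResTerm
  | .bot => 0
  | .var n => Vec.basis (ResTerm.var n)
  | .lam A => Vec.map ResTerm.lam A.taylor
  | .app A B => Vec.map₂ ResTerm.app A.taylor B.taylor.promotion
  | .plus A B => Vec.map ResTerm.inl A.taylor + Vec.map ResTerm.inr B.taylor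

/-- The Taylor expansion of a term. -/
noncomputable def Term.taylor (M : Term) : Vec ResTerm := M.toApprox.taylor

/-- The support of the Taylor expansion of a term approximant. -/
def Approx.taylorSupport (A : Approx) : Set ResTerm := Function.support A.taylor

/-- The support of the Taylor expansion of a term. -/
def Term.taylorSupport (M : Term) : Set ResTerm := Function.support M.taylor

/-- The support of the Taylor expansion of the Böhm tree of a term. -/
def Term.taylorSupportBT (M : Term) : Set ResTerm := ⋃ A ∈ M.BT, A.taylorSupport

open Classical in
/-- The Taylor expansion of the Böhm tree of a term: the sum of the `(1 / m u) • u` over the elements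
`u` of its support. -/
noncomputable def Term.taylorBT (M : Term) : Vec ResTerm :=
  fun u => if u ∈ M.taylorSupportBT then ((u.mult : ℚ≥0))⁻¹ else 0

end NDLambda

namespace NDLambda

open scoped Classical

-- Existence and uniqueness of normal forms are Newman's lemma. Reduction terminates: firing a
-- β-redex decreases the number of variables, abstractions and applications, because the
-- substitution is linear. The other rules keep this number and decrease a weight that measures how
-- deep the injections lie. On sums, one summand is replaced by finitely many smaller ones, and the
-- multiset order is well founded. Local confluence comes from compatibility of reduction with
-- linear substitution, in the term (`Red.subst`) and in the arguments (`steps_subst_cons`). The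
-- first rests on the substitution lemma `subst_subst`.
--
-- For the commutation theorem, the coefficient of `u` in a Taylor expansion is `1 / m(u)` on the
-- support (`Approx.taylor_apply`), so only supports and integer coefficients of normal forms
-- remain. The central fact is that one step of hereditary head reduction `L` on `M` lifts to the
-- approximants. There is a map `K` from `T(M)` to finite sums over `T(L M)` such that `s` reduces
-- to `K(s)`, every element `u` of `T(L M)` occurs in `K(s)` for exactly one `s`, and its
-- coefficient there is `m(s) / m(u)`. This is `exists_isHeadStep`, phrased with the predicate
-- `Uniform`. The decisive case is β, where `uniform_subst` shows that linear substitution from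
-- `T(M)` and monomials over `T(N)` onto `T(M[N/x])` has these properties. The coefficients are
-- counts of ordered partitions (`count_antidiagonal`) and of ways to match a monomial with the
-- monomial it comes from (`Uniform.count_monomialSubst`).
--
-- These properties compose, hence hold for the `n`-fold iterate from `T(M)` to `T(L^n M)`. Each
-- head step fixes normal approximants and replaces any other one by smaller ones. So for every `s`
-- the iterate at `s` is eventually `NF(s)`, and the normal forms inherit disjointness and the
-- coefficients `m(s) / m(u)`. Moreover `T(eBT(M))` is the set of normal elements of `T(M)`, so
-- `T(BT(M))` consists of the normal elements of all the `T(L^n M)`, which are exactly the elements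
-- of the normal forms. Multiplying `m(s) / m(u)` by the coefficient `1 / m(s)` of `s` gives `1 /
-- m(u)`.

theorem _root_.Multiset.eq_of_map_eq_map {α β : Type*} {f : α → β} {s t : Multiset α}
    (hf : ∀ a ∈ s, ∀ b, f a = f b → a = b) (h : s.map f = t.map f) : s = t := by
  induction s using Multiset.induction generalizing t with
  | empty => simpa [eq_comm] using h
  | cons a s ih =>
    have ha : f a ∈ t.map f := by rw [← h]; simp
    obtain ⟨b, hb, hab⟩ := Multiset.mem_map.1 ha
    obtain rfl := hf a (by simp) b hab.symm
    obtain ⟨t, rfl⟩ := Multiset.exists_cons_of_mem hb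
    simp only [Multiset.map_cons, Multiset.cons_inj_right] at h ⊢
    exact ih (fun c hc => hf c (by simp [hc])) h

namespace ResTerm

/-! ### Resource terms: induction, case analysis and equations -/

/-- The recursor of the nested type of preterms is used with the second motive "every element of the
list satisfies the claim"; `app_mk` turns an application of preterms into one of classes. -/
theorem induction {motive : ResTerm → Prop} (hvar : ∀ n, motive (var n))
    (hlam : ∀ s, motive s → motive (lam s))
    (happ : ∀ s t, motive s → (∀ u ∈ t, motive u) → motive (app s t))
    (hinl : ∀ s, motive s → motive (inl s)) (hinr : ∀ s, motive s → motive (inr s)) :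
    ∀ s, motive s := by
  have key : ∀ a : PreTerm, motive (mk a) := by
    intro a
    induction a using PreTerm.rec (motive_2 := fun bs => ∀ b ∈ bs, motive (mk b)) with
    | var n => exact hvar n
    | lam a ih => exact hlam _ ih
    | app a bs ih ihs =>
      rw [← app_mk]
      refine happ _ _ ih fun u hu => ?_
      simp only [Multiset.mem_coe, List.mem_map] at hu
      obtain ⟨b, hb, rfl⟩ := hu
      exact ihs b hb
    | inl a ih => exact hinl _ ih
    | inr a ih => exact hinr _ ih
    | nil =>
      rename_i hb
      simp at hb
    | cons b bs ih ihs =>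
      rename_i c hc
      rcases List.mem_cons.1 hc with rfl | hc
      exacts [ih, ihs c hc]
  intro s
  induction s using Quot.ind with
  | mk a => exact key a

/-- The outermost constructor of a resource term, with its arguments. -/
inductive View : Type
  | var (n : ℕ) : View
  | lam (s : ResTerm) : View
  | app (s : ResTerm) (t : ResMonomial) : View
  | inl (s : ResTerm) : View
  | inr (s : ResTerm) : View

/-- The outermost constructor of a resource term. -/
def view : ResTerm → View :=
  fold View.var (fun s _ => View.lam s) (fun s _ ts => View.app s (ts.map Prod.fst))
    (fun s _ => View.inl s) (fun s _ => View.inr s)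

theorem view_var (n : ℕ) : view (var n) = View.var n := fold_var ..
theorem view_lam (s : ResTerm) : view (lam s) = View.lam s := fold_lam ..
theorem view_app (s : ResTerm) (t : ResMonomial) : view (app s t) = View.app s t := by
  rw [view, fold_app, Multiset.map_map]
  simp
theorem view_inl (s : ResTerm) : view (inl s) = View.inl s := fold_inl ..
theorem view_inr (s : ResTerm) : view (inr s) = View.inr s := fold_inr ..

/-- The target of `view` is a genuine inductive type, so injectivity and disjointness of the
constructors of the quotient can be read off there. -/
theorem eq_of_view {s t : ResTerm} (h : s = t) : view s = view t := congrArg view h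

@[simp] theorem var_inj {n m : ℕ} : var n = var m ↔ n = m :=
  ⟨fun h => by simpa [view_var] using eq_of_view h, fun h => h ▸ rfl⟩
@[simp] theorem lam_inj {s t : ResTerm} : lam s = lam t ↔ s = t :=
  ⟨fun h => by simpa [view_lam] using eq_of_view h, fun h => h ▸ rfl⟩
@[simp] theorem inl_inj {s t : ResTerm} : inl s = inl t ↔ s = t :=
  ⟨fun h => by simpa [view_inl] using eq_of_view h, fun h => h ▸ rfl⟩
@[simp] theorem inr_inj {s t : ResTerm} : inr s = inr t ↔ s = t :=
  ⟨fun h => by simpa [view_inr] using eq_of_view h, fun h => h ▸ rfl⟩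
@[simp] theorem app_inj {s s' : ResTerm} {t t' : ResMonomial} :
    app s t = app s' t' ↔ s = s' ∧ t = t' :=
  ⟨fun h => by simpa [view_app] using eq_of_view h, fun ⟨h, h'⟩ => h ▸ h' ▸ rfl⟩

section Ne

variable (n : ℕ) (s s' : ResTerm) (t : ResMonomial)

@[simp] theorem var_ne_lam : var n ≠ lam s :=
  fun h => by simpa [view_var, view_lam] using eq_of_view h
@[simp] theorem var_ne_app : var n ≠ app s t :=
  fun h => by simpa [view_var, view_app] using eq_of_view h
@[simp] theorem var_ne_inl : var n ≠ inl s :=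
  fun h => by simpa [view_var, view_inl] using eq_of_view h
@[simp] theorem var_ne_inr : var n ≠ inr s :=
  fun h => by simpa [view_var, view_inr] using eq_of_view h
@[simp] theorem lam_ne_app : lam s ≠ app s' t :=
  fun h => by simpa [view_lam, view_app] using eq_of_view h
@[simp] theorem lam_ne_inl : lam s ≠ inl s' :=
  fun h => by simpa [view_lam, view_inl] using eq_of_view h
@[simp] theorem lam_ne_inr : lam s ≠ inr s' :=
  fun h => by simpa [view_lam, view_inr] using eq_of_view h
@[simp] theorem app_ne_inl : app s t ≠ inl s' :=
  fun h => by simpa [view_app, view_inl] using eq_of_view h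
@[simp] theorem app_ne_inr : app s t ≠ inr s' :=
  fun h => by simpa [view_app, view_inr] using eq_of_view h
@[simp] theorem inl_ne_inr : inl s ≠ inr s' :=
  fun h => by simpa [view_inl, view_inr] using eq_of_view h
@[simp] theorem lam_ne_var : lam s ≠ var n := (var_ne_lam n s).symm
@[simp] theorem app_ne_var : app s t ≠ var n := (var_ne_app n s t).symm
@[simp] theorem inl_ne_var : inl s ≠ var n := (var_ne_inl n s).symm
@[simp] theorem inr_ne_var : inr s ≠ var n := (var_ne_inr n s).symm
@[simp] theorem app_ne_lam : app s t ≠ lam s' := (lam_ne_app s' s t).symm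
@[simp] theorem inl_ne_lam : inl s ≠ lam s' := (lam_ne_inl s' s).symm
@[simp] theorem inr_ne_lam : inr s ≠ lam s' := (lam_ne_inr s' s).symm
@[simp] theorem inl_ne_app : inl s ≠ app s' t := (app_ne_inl s' s t).symm
@[simp] theorem inr_ne_app : inr s ≠ app s' t := (app_ne_inr s' s t).symm
@[simp] theorem inr_ne_inl : inr s ≠ inl s' := (inl_ne_inr s' s).symm

end Ne

/-! #### Shifting -/

@[simp] theorem shift_var (c n : ℕ) : shift c (var n) = var (if n < c then n else n + 1) := by
  rw [shift, fold_var]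
@[simp] theorem shift_lam (c : ℕ) (s : ResTerm) : shift c (lam s) = lam (shift (c + 1) s) := by
  rw [shift, fold_lam]; rfl
@[simp] theorem shift_inl (c : ℕ) (s : ResTerm) : shift c (inl s) = inl (shift c s) := by
  rw [shift, fold_inl]; rfl
@[simp] theorem shift_inr (c : ℕ) (s : ResTerm) : shift c (inr s) = inr (shift c s) := by
  rw [shift, fold_inr]; rfl
@[simp] theorem shift_app (c : ℕ) (s : ResTerm) (t : ResMonomial) :
    shift c (app s t) = app (shift c s) (t.map (shift c)) := by
  rw [shift, fold_app, Multiset.map_map]; rfl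

theorem shift_shift {c d : ℕ} (h : c ≤ d) (s : ResTerm) :
    shift (d + 1) (shift c s) = shift c (shift d s) := by
  induction s using induction generalizing c d with
  | hvar n =>
    simp only [shift_var, var_inj]
    split_ifs <;> omega
  | hlam s ih => simp [ih (Nat.succ_le_succ h)]
  | happ s t ih iht =>
    simp only [shift_app, ih h, Multiset.map_map, app_inj, true_and]
    exact Multiset.map_congr rfl fun u hu => iht u hu h
  | hinl s ih => simp [ih h]
  | hinr s ih => simp [ih h]

theorem shift_injective (c : ℕ) : Function.Injective (shift c) := by
  intro s
  induction s using induction generalizing c with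
  | hvar n =>
    intro s' h
    induction s' using induction <;> simp at h ⊢
    split_ifs at h <;> omega
  | hlam s ih =>
    intro s' h
    induction s' using induction <;> simp at h ⊢
    exact ih _ h
  | happ s t ih iht =>
    intro s' h
    induction s' using induction with
    | happ s' t' =>
      simp only [shift_app, app_inj] at h ⊢
      refine ⟨ih _ h.1, ?_⟩
      -- The induction hypothesis gives injectivity only at the elements of `t`, which is all that
      -- this form of cancellation requires.
      exact Multiset.eq_of_map_eq_map (fun u hu v huv => iht u hu c huv) h.2
    | _ => simp at h
  | hinl s ih =>
    intro s' h
    induction s' using induction <;> simp at h ⊢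
    exact ih _ h
  | hinr s ih =>
    intro s' h
    induction s' using induction <;> simp at h ⊢
    exact ih _ h

/-! #### Substitution -/

/-- Symmetric multilinear substitution into a monomial. -/
noncomputable def msubst (k : ℕ) (t : ResMonomial) : ResMonomial → Multiset ResMonomial :=
  monomialSubst (t.map (subst k))

theorem subst_var (k n : ℕ) (u : ResMonomial) :
    subst k (var n) u = if n = k then (if Multiset.card u = 1 then u else 0)
      else if Multiset.card u = 0 then {var (if n < k then n else n - 1)} else 0 := by
  rw [subst, fold_var]
theorem subst_lam (k : ℕ) (s : ResTerm) (u : ResMonomial) :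
    subst k (lam s) u = (subst (k + 1) s (u.map (shift 0))).map lam := by
  rw [subst, fold_lam]; rfl
theorem subst_inl (k : ℕ) (s : ResTerm) (u : ResMonomial) :
    subst k (inl s) u = (subst k s u).map inl := by
  rw [subst, fold_inl]; rfl
theorem subst_inr (k : ℕ) (s : ResTerm) (u : ResMonomial) :
    subst k (inr s) u = (subst k s u).map inr := by
  rw [subst, fold_inr]; rfl
end ResTerm

/-- The convolution of two functions from monomials to finite sums, along an operation. -/
def conv {X Y Z : Type} (op : X → Y → Z) (f : ResMonomial → Multiset X)
    (g : ResMonomial → Multiset Y) (u : ResMonomial) : Multiset Z :=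
  u.antidiagonal.bind fun p => (f p.1).bind fun x => (g p.2).map (op x)

namespace ResTerm

theorem monomialSubst_zero (u : ResMonomial) :
    monomialSubst 0 u = if u = 0 then {0} else 0 := by
  simp [monomialSubst]
theorem monomialSubst_cons (f : ResMonomial → ResSum) (fs : Multiset (ResMonomial → ResSum)) :
    monomialSubst (f ::ₘ fs) = conv Multiset.cons f (monomialSubst fs) := by
  rw [monomialSubst, Multiset.foldr_cons]; rfl

theorem subst_app (k : ℕ) (s : ResTerm) (t : ResMonomial) :
    subst k (app s t) = conv app (subst k s) (msubst k t) := by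
  funext u
  rw [subst, fold_app]
  simp only [Multiset.map_map]
  rfl

theorem msubst_zero (k : ℕ) (u : ResMonomial) :
    msubst k 0 u = if u = 0 then {0} else 0 := monomialSubst_zero u
theorem msubst_cons (k : ℕ) (s : ResTerm) (t : ResMonomial) :
    msubst k (s ::ₘ t) = conv Multiset.cons (subst k s) (msubst k t) := by
  rw [msubst, Multiset.map_cons, monomialSubst_cons]; rfl

/-- Induction on resource terms and monomials simultaneously. -/
theorem induction₂ {motive : ResTerm → Prop} {mmotive : ResMonomial → Prop}
    (hvar : ∀ n, motive (var n)) (hlam : ∀ s, motive s → motive (lam s))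
    (happ : ∀ s t, motive s → mmotive t → motive (app s t))
    (hinl : ∀ s, motive s → motive (inl s)) (hinr : ∀ s, motive s → motive (inr s))
    (hzero : mmotive 0) (hcons : ∀ s t, motive s → mmotive t → mmotive (s ::ₘ t)) :
    (∀ s, motive s) ∧ ∀ t, mmotive t := by
  have h : ∀ t : ResMonomial, (∀ u ∈ t, motive u) → mmotive t := by
    intro t
    induction t using Multiset.induction with
    | empty => exact fun _ => hzero
    | cons a t ih => exact fun H => hcons _ _ (H a (by simp)) (ih fun u hu => H u (by simp [hu]))
  have h' : ∀ s, motive s :=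
    induction hvar hlam (fun s t hs ht => happ s t hs (h t ht)) hinl hinr
  exact ⟨h', fun t => h t fun u _ => h' u⟩

end ResTerm

/-! ### Convolution and substitution -/

theorem _root_.Multiset.bind_eq_zero_of_forall {α β : Type*} {m : Multiset α} {f : α → Multiset β}
    (h : ∀ a ∈ m, f a = 0) : m.bind f = 0 :=
  (Multiset.bind_congr h).trans (Multiset.bind_zero m)

theorem _root_.Multiset.bind_singleton_self {α : Type*} (m : Multiset α) :
    (m.bind fun a => {a}) = m :=
  (Multiset.bind_singleton m id).trans (Multiset.map_id m)

/-- A symmetry of ordered partitions of an index set. Here and in the exchange and associativity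
laws below, a new element goes to each part in turn; `F` is generalized so that it can absorb this
element. -/
theorem antidiagonal_bind_swap {γ : Type} (F : ResMonomial → ResMonomial → Multiset γ)
    (u : ResMonomial) :
    (u.antidiagonal.bind fun p => F p.2 p.1) = u.antidiagonal.bind fun p => F p.1 p.2 := by
  induction u using Multiset.induction generalizing F with
  | empty => simp
  | cons a u ih =>
    simp only [Multiset.antidiagonal_cons, Multiset.add_bind, Multiset.bind_map, Prod.map_fst,
      Prod.map_snd, id_eq]
    rw [ih fun x y => F (a ::ₘ x) y, ih fun x y => F x (a ::ₘ y)]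
    abel

theorem antidiagonal_bind_middle_comm {γ : Type}
    (F : ResMonomial → ResMonomial → ResMonomial → ResMonomial → Multiset γ) (u : ResMonomial) :
    (u.antidiagonal.bind fun p => p.1.antidiagonal.bind fun q => p.2.antidiagonal.bind fun r =>
        F q.1 q.2 r.1 r.2)
      = u.antidiagonal.bind fun p => p.1.antidiagonal.bind fun q =>
          p.2.antidiagonal.bind fun r => F q.1 r.1 q.2 r.2 := by
  induction u using Multiset.induction generalizing F with
  | empty => simp
  | cons a u ih =>
    simp only [Multiset.antidiagonal_cons, Multiset.add_bind, Multiset.bind_map, Prod.map_fst,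
      Prod.map_snd, id_eq, Multiset.bind_add]
    rw [ih fun x y z w => F x y z (a ::ₘ w), ih fun x y z w => F x y (a ::ₘ z) w,
      ih fun x y z w => F x (a ::ₘ y) z w, ih fun x y z w => F (a ::ₘ x) y z w]
    abel

theorem antidiagonal_bind_assoc {γ : Type}
    (F : ResMonomial → ResMonomial → ResMonomial → Multiset γ) (u : ResMonomial) :
    (u.antidiagonal.bind fun p => p.1.antidiagonal.bind fun q => F q.1 q.2 p.2)
      = u.antidiagonal.bind fun p => p.2.antidiagonal.bind fun q => F p.1 q.1 q.2 := by
  induction u using Multiset.induction generalizing F with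
  | empty => simp
  | cons a u ih =>
    simp only [Multiset.antidiagonal_cons, Multiset.add_bind, Multiset.bind_map, Prod.map_fst,
      Prod.map_snd, id_eq, Multiset.bind_add]
    rw [ih fun x y z => F x y (a ::ₘ z), ih fun x y z => F x (a ::ₘ y) z,
      ih fun x y z => F (a ::ₘ x) y z]
    abel

theorem antidiagonal_map {α β : Type} (f : α → β) (u : Multiset α) :
    (u.map f).antidiagonal = u.antidiagonal.map (Prod.map (Multiset.map f) (Multiset.map f)) := by
  induction u using Multiset.induction with
  | empty => simp
  | cons a u ih =>
    simp [Multiset.antidiagonal_cons, ih, Multiset.map_map, Prod.map]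

theorem antidiagonal_bind_of_fst {γ : Type} (F : ResMonomial → ResMonomial → Multiset γ)
    (hF : ∀ x y, x ≠ 0 → F x y = 0) (u : ResMonomial) :
    (u.antidiagonal.bind fun p => F p.1 p.2) = F 0 u := by
  induction u using Multiset.induction generalizing F with
  | empty => simp
  | cons a u ih =>
    simp only [Multiset.antidiagonal_cons, Multiset.add_bind, Multiset.bind_map, Prod.map_fst,
      Prod.map_snd, id_eq]
    rw [ih (fun x y => F x (a ::ₘ y)) fun x y h => hF _ _ h]
    simp [hF]

theorem antidiagonal_bind_of_snd {γ : Type} (F : ResMonomial → ResMonomial → Multiset γ)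
    (hF : ∀ x y, y ≠ 0 → F x y = 0) (u : ResMonomial) :
    (u.antidiagonal.bind fun p => F p.1 p.2) = F u 0 := by
  rw [← antidiagonal_bind_swap, antidiagonal_bind_of_fst (fun x y => F y x) fun x y h => hF _ _ h]

theorem conv_bind {X Y Z W : Type} (op : X → Y → Z) (f : ResMonomial → Multiset X)
    (g : ResMonomial → Multiset Y) (u : ResMonomial) (h : Z → Multiset W) :
    (conv op f g u).bind h
      = u.antidiagonal.bind fun p => (f p.1).bind fun x => (g p.2).bind fun y => h (op x y) := by
  simp only [conv, Multiset.bind_assoc, Multiset.bind_map]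

theorem conv_cons {X Y Z : Type} (op : X → Y → Z) (f : ResMonomial → Multiset X)
    (g : ResMonomial → Multiset Y) (a : ResTerm) (u : ResMonomial) :
    conv op f g (a ::ₘ u)
      = conv op f (fun v => g (a ::ₘ v)) u + conv op (fun v => f (a ::ₘ v)) g u := by
  simp only [conv, Multiset.antidiagonal_cons, Multiset.add_bind, Multiset.bind_map, Prod.map_fst,
      Prod.map_snd, id_eq]

theorem conv_map {X Y Z X' Y' Z' : Type} {op : X → Y → Z} {op' : X' → Y' → Z'}
    {f : ResMonomial → Multiset X} {g : ResMonomial → Multiset Y}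
    {f' : ResMonomial → Multiset X'} {g' : ResMonomial → Multiset Y'}
    {α : X → X'} {β : Y → Y'} {γ : Z → Z'} {δ : ResTerm → ResTerm}
    (hop : ∀ x y, γ (op x y) = op' (α x) (β y))
    (hf : ∀ u, f' (u.map δ) = (f u).map α) (hg : ∀ u, g' (u.map δ) = (g u).map β)
    (u : ResMonomial) : conv op' f' g' (u.map δ) = (conv op f g u).map γ := by
  simp only [conv, antidiagonal_map, Multiset.bind_map, Prod.map_fst, Prod.map_snd, hf, hg,
    Multiset.map_bind, Multiset.map_map, Function.comp_def, hop]

/-- If `χ` distributes over `op`, then both monomials are shared between the two factors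
independently, so the sum is indexed by a partition of `t` and one of `u`. -/
theorem conv_comp {X Y Z : Type} (op : X → Y → Z) {f : ResMonomial → Multiset X}
    {g : ResMonomial → Multiset Y} {φ : X → ResMonomial → Multiset X}
    {ψ : Y → ResMonomial → Multiset Y} {χ : Z → ResMonomial → Multiset Z}
    (hχ : ∀ x y, χ (op x y) = conv op (φ x) (ψ y)) (t u : ResMonomial) :
    (conv op f g t).bind (fun z => χ z u)
      = t.antidiagonal.bind fun p => u.antidiagonal.bind fun q =>
          ((f p.1).bind fun x => φ x q.1).bind fun x =>
            ((g p.2).bind fun y => ψ y q.2).map (op x) := by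
  rw [conv_bind]
  refine Multiset.bind_congr fun p _ => ?_
  simp only [hχ, conv, Multiset.bind_assoc, Multiset.map_bind]
  simp only [Multiset.bind_bind (g p.2) u.antidiagonal]
  rw [Multiset.bind_bind]
  refine Multiset.bind_congr fun q _ => ?_
  refine Multiset.bind_congr fun x _ => ?_
  rw [Multiset.bind_bind]

namespace ResTerm

/-- Each element of `t` receives one part of `J` and yields one element of the result, so splitting
the result means splitting `t` and distributing `J` between the two halves. -/
theorem msubst_antidiagonal {γ : Type} (j : ℕ) (t J : ResMonomial)
    (G : ResMonomial → ResMonomial → Multiset γ) :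
    ((msubst j t J).bind fun t' => t'.antidiagonal.bind fun p => G p.1 p.2)
      = t.antidiagonal.bind fun p => J.antidiagonal.bind fun q =>
          (msubst j p.1 q.1).bind fun t₁ => (msubst j p.2 q.2).bind fun t₂ => G t₁ t₂ := by
  induction t using Multiset.induction generalizing J G with
  | empty =>
    simp only [msubst_zero, Multiset.antidiagonal_zero, Multiset.singleton_bind]
    rw [antidiagonal_bind_of_fst (fun x y => (if x = 0 then {0} else 0 : Multiset _).bind
      fun t₁ => (if y = 0 then {0} else 0 : Multiset _).bind fun t₂ => G t₁ t₂)]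
    · by_cases h : J = 0 <;> simp [h]
    · intro x y h
      simp [h]
  | cons a t ih =>
    rw [msubst_cons, conv_bind]
    simp only [Multiset.antidiagonal_cons, Multiset.add_bind, Multiset.bind_map, Prod.map_fst,
      Prod.map_snd, id_eq, Multiset.bind_add]
    have ih₁ := fun a' J => ih J fun x y => G x (a' ::ₘ y)
    have ih₂ := fun a' J => ih J fun x y => G (a' ::ₘ x) y
    simp only [ih₁, ih₂, msubst_cons, conv_bind]
    -- The image of `a` lies in the second half in the first goal, in the first half in the second
    -- goal.
    congr 1
    · simp only [Multiset.bind_bind _ t.antidiagonal]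
      refine Multiset.bind_congr fun p _ => ?_
      simp only [Multiset.bind_bind (subst j a _) (Multiset.antidiagonal _)]
      rw [antidiagonal_bind_left_comm fun x y z => (subst j a x).bind fun a' =>
        (msubst j p.1 y).bind fun t₁ => (msubst j p.2 z).bind fun t₂ => G t₁ (a' ::ₘ t₂)]
      refine Multiset.bind_congr fun q _ => ?_
      rw [Multiset.bind_bind]
      refine Multiset.bind_congr fun r _ => ?_
      rw [Multiset.bind_bind]
    · simp only [Multiset.bind_bind _ t.antidiagonal]
      refine Multiset.bind_congr fun p _ => ?_
      simp only [Multiset.bind_bind (subst j a _) (Multiset.antidiagonal _)]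
      rw [antidiagonal_bind_assoc fun x y z => (subst j a x).bind fun a' =>
        (msubst j p.1 y).bind fun t₁ => (msubst j p.2 z).bind fun t₂ => G (a' ::ₘ t₁) t₂]

/-- Substituting in a shifted term with respect to a further variable. -/
theorem subst_shift_comm :
    (∀ s c j u, c ≤ j → subst (j + 1) (shift c s) (u.map (shift c))
        = (subst j s u).map (shift c)) ∧
      ∀ t c j u, c ≤ j → msubst (j + 1) (t.map (shift c)) (u.map (shift c))
        = (msubst j t u).map (Multiset.map (shift c)) := by
  refine induction₂ ?_ ?_ ?_ ?_ ?_ ?_ ?_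
  · intro n c j u h
    simp only [shift_var, subst_var, Multiset.card_map]
    split_ifs <;> first | omega | simp <;> try omega
    all_goals split_ifs <;> omega
  · intro s ih c j u h
    have e : (u.map (shift c)).map (shift 0) = (u.map (shift 0)).map (shift (c + 1)) := by
      simp [shift_shift]
    simp only [shift_lam, subst_lam, e, ih (c + 1) (j + 1) _ (by omega)]
    simp
  · intro s t ih iht c j u h
    rw [shift_app, subst_app, subst_app]
    exact conv_map (by simp) (fun u => ih c j u h) (fun u => iht c j u h) u
  · intro s ih c j u h
    simp [subst_inl, ih c j u h]
  · intro s ih c j u h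
    simp [subst_inr, ih c j u h]
  · intro c j u h
    by_cases hu : u = 0 <;> simp [msubst_zero, hu]
  · intro s t ih iht c j u h
    rw [Multiset.map_cons, msubst_cons, msubst_cons]
    exact conv_map (by simp) (fun u => ih c j u h) (fun u => iht c j u h) u

/-- Shifting a substitution with respect to a further variable. -/
theorem shift_subst_comm :
    (∀ s k c u, k ≤ c → subst k (shift (c + 1) s) (u.map (shift c))
        = (subst k s u).map (shift c)) ∧
      ∀ t k c u, k ≤ c → msubst k (t.map (shift (c + 1))) (u.map (shift c))
        = (msubst k t u).map (Multiset.map (shift c)) := by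
  refine induction₂ ?_ ?_ ?_ ?_ ?_ ?_ ?_
  · intro n k c u h
    simp only [shift_var, subst_var, Multiset.card_map]
    split_ifs <;> first | omega | simp <;> try omega
    all_goals split_ifs <;> omega
  · intro s ih k c u h
    have e : (u.map (shift c)).map (shift 0) = (u.map (shift 0)).map (shift (c + 1)) := by
      simp [shift_shift]
    simp only [shift_lam, subst_lam, e, ih (k + 1) (c + 1) _ (by omega)]
    simp
  · intro s t ih iht k c u h
    rw [shift_app, subst_app, subst_app]
    exact conv_map (by simp) (fun u => ih k c u h) (fun u => iht k c u h) u
  · intro s ih k c u h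
    simp [subst_inl, ih k c u h]
  · intro s ih k c u h
    simp [subst_inr, ih k c u h]
  · intro k c u h
    by_cases hu : u = 0 <;> simp [msubst_zero, hu]
  · intro s t ih iht k c u h
    rw [Multiset.map_cons, msubst_cons, msubst_cons]
    exact conv_map (by simp) (fun u => ih k c u h) (fun u => iht k c u h) u

theorem conv_ite {X Y Z : Type} (op : X → Y → Z) (x : X) (y : Y) (u : ResMonomial) :
    conv op (fun u => if u = 0 then {x} else 0) (fun u => if u = 0 then {y} else 0) u
      = if u = 0 then {op x y} else 0 := by
  rw [conv, antidiagonal_bind_of_fst (fun a b => (if a = 0 then {x} else 0 : Multiset _).bind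
      fun x => (if b = 0 then {y} else 0 : Multiset _).map (op x))]
  · by_cases h : u = 0 <;> simp [h]
  · intro x y h
    simp [h]

/-- Substituting for a variable that does not occur. -/
theorem subst_shift :
    (∀ s k, subst k (shift k s) = fun u => if u = 0 then {s} else 0) ∧
      ∀ t k, msubst k (t.map (shift k)) = fun u => if u = 0 then {t} else 0 := by
  refine induction₂ ?_ ?_ ?_ ?_ ?_ ?_ ?_
  · intro n k
    funext u
    simp only [shift_var, subst_var, Multiset.card_eq_zero]
    split_ifs <;> first | omega | simp
  · intro s ih k
    funext u
    by_cases hu : u = 0 <;> simp [subst_lam, ih, hu]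
  · intro s t ih iht k
    funext u
    rw [shift_app, subst_app, ih, iht, conv_ite]
  · intro s ih k
    funext u
    by_cases hu : u = 0 <;> simp [subst_inl, ih, hu]
  · intro s ih k
    funext u
    by_cases hu : u = 0 <;> simp [subst_inr, ih, hu]
  · intro k
    funext u
    simp [msubst_zero]
  · intro s t ih iht k
    funext u
    rw [Multiset.map_cons, msubst_cons, ih, iht, conv_ite]

theorem msubst_singleton (j : ℕ) (s : ResTerm) (u : ResMonomial) :
    msubst j {s} u = (subst j s u).map fun s' => {s'} := by
  rw [← Multiset.cons_zero, msubst_cons, conv, antidiagonal_bind_of_snd (fun a b =>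
    (subst j s a).bind fun x => (msubst j 0 b).map (Multiset.cons x))]
  · simp [msubst_zero, Multiset.bind_singleton]
  · intro x y h
    simp [msubst_zero, h]

/-- Both sides of the substitution lemma decompose in the same way. -/
theorem conv_subst_subst {X Y Z : Type} (op : X → Y → Z)
    {SX : ℕ → X → ResMonomial → Multiset X} {SY : ℕ → Y → ResMonomial → Multiset Y}
    {SZ : ℕ → Z → ResMonomial → Multiset Z}
    (h : ∀ k x y, SZ k (op x y) = conv op (SX k x) (SY k y)) {k j : ℕ} {x : X} {y : Y}
    (hx : ∀ t u, (SX k x t).bind (fun v => SX j v u) = u.antidiagonal.bind fun p =>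
      (msubst j t p.2).bind fun t' => (SX (j + 1) x (p.1.map (shift k))).bind fun x' => SX k x' t')
    (hy : ∀ t u, (SY k y t).bind (fun v => SY j v u) = u.antidiagonal.bind fun p =>
      (msubst j t p.2).bind fun t' => (SY (j + 1) y (p.1.map (shift k))).bind fun y' => SY k y' t')
    (t u : ResMonomial) :
    (SZ k (op x y) t).bind (fun v => SZ j v u) = u.antidiagonal.bind fun p =>
      (msubst j t p.2).bind fun t' =>
        (SZ (j + 1) (op x y) (p.1.map (shift k))).bind fun z => SZ k z t' := by
  -- Both sides become sums over partitions of `t` into two parts and of `u` into four: the elements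
  -- that go to `x`, to `y`, and to the parts of `t` destined for `x` and for `y`.
  rw [h, conv_comp op (h j)]
  simp only [hx, hy, h]
  have e : ∀ v t', (conv op (SX (j + 1) x) (SY (j + 1) y) v).bind (fun z => SZ k z t') = _ :=
    fun v t' => conv_comp op (h k) v t'
  simp only [e, antidiagonal_map, Multiset.bind_map, Prod.map_fst, Prod.map_snd]
  simp only [Multiset.bind_bind (msubst j t _) (Multiset.antidiagonal _)]
  have e' : ∀ (r : ResMonomial × ResMonomial) (v : ResMonomial), _ = _ := fun r v =>
    msubst_antidiagonal j t v fun a b =>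
      ((SX (j + 1) x (r.1.map (shift k))).bind fun x' => SX k x' a).bind fun x =>
        ((SY (j + 1) y (r.2.map (shift k))).bind fun y' => SY k y' b).map (op x)
  beta_reduce at e'
  simp only [e', Multiset.bind_bind _ t.antidiagonal]
  refine Multiset.bind_congr fun p _ => ?_
  -- The right side groups the parts of `u` as (`x`, `y`) and (`t₁`, `t₂`), the left side as (`x`,
  -- `t₁`) and (`y`, `t₂`).
  rw [antidiagonal_bind_middle_comm fun a b c d =>
    (msubst j p.1 c).bind fun t₁ => (msubst j p.2 d).bind fun t₂ =>
      ((SX (j + 1) x (a.map (shift k))).bind fun x' => SX k x' t₁).bind fun x =>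
        ((SY (j + 1) y (b.map (shift k))).bind fun y' => SY k y' t₂).map (op x)]
  refine Multiset.bind_congr fun q _ => ?_
  rw [Multiset.bind_assoc]
  refine Multiset.bind_congr fun r _ => ?_
  rw [Multiset.bind_assoc, Multiset.bind_bind q.2.antidiagonal]
  refine Multiset.bind_congr fun t₁ _ => ?_
  simp only [Multiset.map_bind (Multiset.antidiagonal _)]
  rw [Multiset.bind_bind _ q.2.antidiagonal]
  refine Multiset.bind_congr fun r' _ => ?_
  simp only [Multiset.map_bind (msubst _ _ _)]
  rw [Multiset.bind_bind _ (msubst _ _ _)]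

theorem card_of_mem_msubst {j : ℕ} {t t' u : ResMonomial} (h : t' ∈ msubst j t u) :
    Multiset.card t' = Multiset.card t := by
  induction t using Multiset.induction generalizing t' u with
  | empty =>
    rw [msubst_zero] at h
    split_ifs at h <;> simp_all
  | cons a t ih =>
    simp only [msubst_cons, conv, Multiset.mem_bind, Multiset.mem_map] at h
    obtain ⟨p, _, x, _, t'', h, rfl⟩ := h
    simp [ih h]

theorem ne_zero_of_mem_msubst {j : ℕ} {t t' u : ResMonomial} (h : t' ∈ msubst j t u)
    (ht : t ≠ 0) : t' ≠ 0 := by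
  rw [← Multiset.card_pos] at ht ⊢
  rwa [card_of_mem_msubst h]

theorem subst_subst_var {n k j : ℕ} (h : k ≤ j) (t u : ResMonomial) :
    (subst k (var n) t).bind (fun v => subst j v u) = u.antidiagonal.bind fun p =>
      (msubst j t p.2).bind fun t' =>
        (subst (j + 1) (var n) (p.1.map (shift k))).bind fun s' => subst k s' t' := by
  by_cases hn : n = k
  · subst hn
    have hj : n ≠ j + 1 := by omega
    have hj' : n < j + 1 := by omega
    simp only [subst_var, if_true, if_neg hj, if_pos hj', Multiset.card_eq_zero,
      Multiset.map_eq_zero]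
    -- The variable `n` is not `j + 1`, so all of `u` must go to `t`.
    rw [antidiagonal_bind_of_fst fun x y => (msubst j t y).bind fun t' =>
      (if x = 0 then {var n} else 0 : Multiset ResTerm).bind fun s' => subst n s' t']
    · simp only [if_true, Multiset.singleton_bind, subst_var]
      by_cases ht : Multiset.card t = 1
      · obtain ⟨a, rfl⟩ := Multiset.card_eq_one.1 ht
        simp [msubst_singleton, Multiset.bind_map, Multiset.bind_singleton_self]
      · rw [if_neg ht, Multiset.zero_bind, Multiset.bind_eq_zero_of_forall]
        exact fun t' ht' => by rw [card_of_mem_msubst ht', if_neg ht]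
    · intro x y hx
      simp [hx]
  · by_cases ht : t = 0
    · subst ht
      -- An empty `t` cannot receive any element of `u`.
      rw [antidiagonal_bind_of_snd fun x y => (msubst j 0 y).bind fun t' =>
        (subst (j + 1) (var n) (x.map (shift k))).bind fun s' => subst k s' t']
      · simp only [msubst_zero, if_true, Multiset.singleton_bind, subst_var, Multiset.card_map,
          Multiset.card_zero, if_neg hn]
        by_cases hj : n = j + 1
        · subst hj
          have hk : ¬ j + 1 < k := by omega
          by_cases hu : Multiset.card u = 1
          · simp [hu, hk, Multiset.bind_map, subst_shift.1, Multiset.bind_singleton_self]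
          · simp [hu, hk]
        · by_cases hu : Multiset.card u = 0
          · simp only [hu, if_true, if_neg hj, Multiset.singleton_bind, subst_var]
            split_ifs <;> simp_all <;> omega
          · simp only [hu, if_false, if_neg hj, Multiset.zero_bind]
            split_ifs <;> first | omega | rfl
      · intro x y hy
        simp [msubst_zero, hy]
    · rw [subst_var, if_neg hn, if_neg (by simpa using ht), Multiset.zero_bind]
      refine (Multiset.bind_eq_zero_of_forall fun p _ => Multiset.bind_eq_zero_of_forall
        fun t' ht' => Multiset.bind_eq_zero_of_forall fun s' hs' => ?_).symm
      have ht'' := ne_zero_of_mem_msubst ht' ht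
      rw [subst_var] at hs'
      split_ifs at hs' with h₁ h₂ h₃ h₄
      · obtain ⟨a, _, rfl⟩ := Multiset.mem_map.1 hs'
        simp [subst_shift.1, ht'']
      · simp at hs'
      · obtain rfl := Multiset.mem_singleton.1 hs'
        rw [subst_var, if_neg (by omega), if_neg (by simpa using ht'')]
      · obtain rfl := Multiset.mem_singleton.1 hs'
        rw [subst_var, if_neg (by omega), if_neg (by simpa using ht'')]
      · simp at hs'

/-- Substitution lemma. An occurrence of the outer variable after the first substitution comes from
`s` or from an element of `t`, and the index set of `u` splits accordingly. Inside `s` the variable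
`k ≤ j` has not been removed yet, hence the index `j + 1` and the shift of the elements of `u`. -/
theorem subst_subst :
    (∀ s k j t u, k ≤ j → (subst k s t).bind (fun v => subst j v u) = u.antidiagonal.bind fun p =>
      (msubst j t p.2).bind fun t' =>
        (subst (j + 1) s (p.1.map (shift k))).bind fun s' => subst k s' t') ∧
    ∀ s k j t u, k ≤ j → (msubst k s t).bind (fun v => msubst j v u) = u.antidiagonal.bind fun p =>
      (msubst j t p.2).bind fun t' =>
        (msubst (j + 1) s (p.1.map (shift k))).bind fun s' => msubst k s' t' := by
  refine induction₂ ?_ ?_ ?_ ?_ ?_ ?_ ?_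
  · intro n k j t u h
    exact subst_subst_var h t u
  · intro s ih k j t u h
    have e : ∀ v : ResMonomial,
        (v.map (shift k)).map (shift 0) = (v.map (shift 0)).map (shift (k + 1)) := by
      simp [shift_shift]
    simp only [subst_lam, Multiset.bind_map, ← Multiset.map_bind, ih _ _ _ _ (Nat.succ_le_succ h),
      antidiagonal_map, Prod.map_fst, Prod.map_snd, subst_shift_comm.2 _ _ _ _ (Nat.zero_le j), e]
  · intro s t ih iht k j v u h
    exact conv_subst_subst app subst_app (fun _ _ => ih _ _ _ _ h) (fun _ _ => iht _ _ _ _ h) _ _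
  · intro s ih k j t u h
    simp only [subst_inl, Multiset.bind_map, ← Multiset.map_bind, ih k j t u h]
  · intro s ih k j t u h
    simp only [subst_inr, Multiset.bind_map, ← Multiset.map_bind, ih k j t u h]
  · intro k j t u h
    simp only [msubst_zero, Multiset.map_eq_zero]
    rw [antidiagonal_bind_of_fst fun x y => (msubst j t y).bind fun t' =>
      (if x = 0 then {0} else 0 : Multiset ResMonomial).bind fun s' => msubst k s' t']
    · by_cases ht : t = 0
      · by_cases hu : u = 0 <;> simp [msubst_zero, ht, hu]
      · simp only [if_neg ht, Multiset.zero_bind]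
        refine (Multiset.bind_eq_zero_of_forall fun t' ht' => ?_).symm
        simp [msubst_zero, ne_zero_of_mem_msubst ht' ht]
    · intro x y hx
      simp [hx]
  · intro s t ih iht k j v u h
    exact conv_subst_subst Multiset.cons msubst_cons (fun _ _ => ih _ _ _ _ h)
      (fun _ _ => iht _ _ _ _ h) _ _

end ResTerm

/-! ### Reduction of sums over an arbitrary basis -/

/-- Reduction of finite sums generated by a reduction from elements to finite sums. -/
inductive SumStep {X : Type} (R : X → Multiset X → Prop) : Multiset X → Multiset X → Prop
  | mk {s : X} {S : Multiset X} (F : Multiset X) : R s S → SumStep R (s ::ₘ F) (S + F)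

/-- The reflexive transitive closure of `SumStep`. -/
abbrev Steps {X : Type} (R : X → Multiset X → Prop) : Multiset X → Multiset X → Prop :=
  Relation.ReflTransGen (SumStep R)

namespace Steps

variable {X Y Z : Type} {R : X → Multiset X → Prop} {Q : Y → Multiset Y → Prop}
  {P : Z → Multiset Z → Prop}

theorem refl (A : Multiset X) : Steps R A A := Relation.ReflTransGen.refl

theorem of_eq {A B : Multiset X} (h : A = B) : Steps R A B := h ▸ refl A

theorem single {s : X} {S : Multiset X} (h : R s S) : Steps R {s} S := by
  simpa using Relation.ReflTransGen.single (SumStep.mk 0 h)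

theorem lift {f : Multiset X → Multiset Y} (hf : ∀ A B, SumStep R A B → Steps Q (f A) (f B))
    {A B : Multiset X} (h : Steps R A B) : Steps Q (f A) (f B) := by
  induction h with
  | refl => exact refl _
  | tail _ h ih => exact ih.trans (hf _ _ h)

theorem add_right {A B : Multiset X} (h : Steps R A B) (C : Multiset X) :
    Steps R (A + C) (B + C) := by
  refine lift (f := fun A => A + C) ?_ h
  rintro _ _ ⟨F, h⟩
  have := SumStep.mk (F + C) h
  rw [← add_assoc] at this
  simpa using Relation.ReflTransGen.single this

theorem add {A B C D : Multiset X} (h : Steps R A B) (h' : Steps R C D) :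
    Steps R (A + C) (B + D) := by
  have := h'.add_right B
  rw [add_comm C, add_comm D] at this
  exact (h.add_right C).trans this

theorem map {f : X → Y} (hf : ∀ s S, R s S → Q (f s) (S.map f)) {A B : Multiset X}
    (h : Steps R A B) : Steps Q (A.map f) (B.map f) := by
  refine lift ?_ h
  rintro _ _ ⟨F, h⟩
  rw [Multiset.map_cons, Multiset.map_add]
  exact Relation.ReflTransGen.single (SumStep.mk _ (hf _ _ h))

theorem bind {E : Multiset Y} {F G : Y → Multiset X} (h : ∀ y ∈ E, Steps R (F y) (G y)) :
    Steps R (E.bind F) (E.bind G) := by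
  induction E using Multiset.induction with
  | empty => exact refl _
  | cons a E ih =>
    simp only [Multiset.cons_bind]
    exact (h a (by simp)).add (ih fun y hy => h y (by simp [hy]))

theorem map_map {E : Multiset Y} {f : Y → X} {g : Y → Multiset X} (h : ∀ y ∈ E, R (f y) (g y)) :
    Steps R (E.map f) (E.bind g) := by
  rw [← Multiset.bind_singleton]
  exact bind fun y hy => single (h y hy)

theorem map_map_singleton {E : Multiset Y} {f g : Y → X} (h : ∀ y ∈ E, R (f y) {g y}) :
    Steps R (E.map f) (E.map g) := by
  rw [← Multiset.bind_singleton E g]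
  exact map_map h

theorem conv_left {op : X → Y → Z} (hop : ∀ y s S, R s S → P (op s y) (S.map fun x => op x y))
    {f f' : ResMonomial → Multiset X} (h : ∀ u, Steps R (f u) (f' u))
    (g : ResMonomial → Multiset Y) (u : ResMonomial) :
    Steps P (conv op f g u) (conv op f' g u) := by
  simp only [conv]
  refine bind fun p _ => ?_
  rw [Multiset.bind_map_comm (f p.1), Multiset.bind_map_comm (f' p.1)]
  exact bind fun y _ => (h p.1).map fun s S hs => hop y s S hs

theorem conv_right {op : X → Y → Z} (hop : ∀ x s S, Q s S → P (op x s) (S.map (op x)))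
    (f : ResMonomial → Multiset X) {g g' : ResMonomial → Multiset Y}
    (h : ∀ u, Steps Q (g u) (g' u)) (u : ResMonomial) :
    Steps P (conv op f g u) (conv op f g' u) := by
  simp only [conv]
  exact bind fun p _ => bind fun x _ => (h p.2).map fun s S hs => hop x s S hs

end Steps

section ConvBind

variable {X Y Z W : Type} (op : X → Y → Z)

theorem conv_bind_left (A : Multiset W) (f : W → ResMonomial → Multiset X)
    (g : ResMonomial → Multiset Y) (u : ResMonomial) :
    conv op (fun v => A.bind fun a => f a v) g u = A.bind fun a => conv op (f a) g u := by
  simp only [conv, Multiset.bind_assoc]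
  rw [Multiset.bind_bind]

theorem conv_bind_right (A : Multiset W) (f : ResMonomial → Multiset X)
    (g : W → ResMonomial → Multiset Y) (u : ResMonomial) :
    conv op f (fun v => A.bind fun a => g a v) u = A.bind fun a => conv op f (g a) u := by
  simp only [conv, Multiset.map_bind, Multiset.bind_bind _ A]

end ConvBind

-- Compatibility of reduction with shifting and substitution

namespace ResTerm

/-- Reduction of one element of a monomial. -/
inductive RedMonomial : ResMonomial → Multiset ResMonomial → Prop
  | mk {s : ResTerm} {S : ResSum} (u : ResMonomial) :
      Red s S → RedMonomial (s ::ₘ u) (S.map fun s' => s' ::ₘ u)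

theorem RedMonomial.cons (a : ResTerm) {t : ResMonomial} {T : Multiset ResMonomial}
    (h : RedMonomial t T) : RedMonomial (a ::ₘ t) (T.map fun t' => a ::ₘ t') := by
  obtain ⟨u, h⟩ := h
  simpa [Multiset.cons_swap a, Multiset.map_map, Function.comp_def] using RedMonomial.mk (a ::ₘ u) h

theorem RedMonomial.app (s : ResTerm) {t : ResMonomial} {T : Multiset ResMonomial}
    (h : RedMonomial t T) : Red (app s t) (T.map fun t' => app s t') := by
  obtain ⟨u, h⟩ := h
  simpa [Multiset.map_map, Function.comp_def] using Red.appArg s u h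

theorem steps_red_iff {E F : ResSum} : Steps Red E F ↔ Relation.ReflTransGen SumRed E F := by
  have h : SumStep Red = SumRed := by
    funext E F
    apply propext
    constructor
    · rintro ⟨F, h⟩
      exact ⟨F, h⟩
    · rintro ⟨F, h⟩
      exact ⟨F, h⟩
  rw [Steps, h]

theorem Red.shift {s : ResTerm} {S : ResSum} (h : Red s S) (c : ℕ) :
    Red (shift c s) (S.map (shift c)) := by
  induction h generalizing c with
  | beta s t =>
    have h := Red.beta (ResTerm.shift (c + 1) s) (t.map (ResTerm.shift c))
    rw [shift_subst_comm.1 _ _ _ _ (Nat.zero_le c)] at h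
    simpa using h
  | appInl s t => simpa using Red.appInl _ _
  | appInr s t => simpa using Red.appInr _ _
  | lamInl s => simpa using Red.lamInl _
  | lamInr s => simpa using Red.lamInr _
  | lam h ih => simpa using Red.lam (ih (c + 1))
  | appFun t h ih => simpa using Red.appFun (t.map (ResTerm.shift c)) (ih c)
  | appArg t u h ih =>
    simpa using Red.appArg (ResTerm.shift c t) (u.map (ResTerm.shift c)) (ih c)
  | inl h ih => simpa using Red.inl (ih c)
  | inr h ih => simpa using Red.inr (ih c)

/-- By the Leibniz rule `conv_cons`, the element `a` goes to exactly one of the two factors, and the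
reduction takes place there. -/
theorem conv_cons_steps {X Y Z : Type} {R : X → Multiset X → Prop} {Q : Y → Multiset Y → Prop}
    {P : Z → Multiset Z → Prop} {op : X → Y → Z}
    (hR : ∀ y s S, R s S → P (op s y) (S.map fun x => op x y))
    (hQ : ∀ x s S, Q s S → P (op x s) (S.map (op x)))
    {f : ResMonomial → Multiset X} {g : ResMonomial → Multiset Y} {a : ResTerm} {A : ResSum}
    (hf : ∀ u, Steps R (f (a ::ₘ u)) (A.bind fun a' => f (a' ::ₘ u)))
    (hg : ∀ u, Steps Q (g (a ::ₘ u)) (A.bind fun a' => g (a' ::ₘ u))) (u : ResMonomial) :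
    Steps P (conv op f g (a ::ₘ u)) (A.bind fun a' => conv op f g (a' ::ₘ u)) := by
  simp only [conv_cons, Multiset.bind_add, ← conv_bind_left, ← conv_bind_right]
  exact (Steps.conv_right hQ f hg u).add (Steps.conv_left hR hf g u)

/-- Linearity: every summand contains exactly one copy of `a`, which can be reduced in place. -/
theorem steps_subst_cons :
    (∀ s k a A u, Red a A →
      Steps Red (subst k s (a ::ₘ u)) (A.bind fun a' => subst k s (a' ::ₘ u))) ∧
    ∀ t k a A u, Red a A →
      Steps RedMonomial (msubst k t (a ::ₘ u)) (A.bind fun a' => msubst k t (a' ::ₘ u)) := by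
  refine induction₂ ?_ ?_ ?_ ?_ ?_ ?_ ?_
  · intro n k a A u h
    simp only [subst_var, Multiset.card_cons]
    by_cases hn : n = k
    · by_cases hu : u = 0
      · subst hu
        simpa [hn, Multiset.bind_singleton_self] using Steps.single h
      · simp only [hn, if_true]
        simpa [hu] using Steps.refl (R := Red) 0
    · simpa [hn] using Steps.refl (R := Red) 0
  · intro s ih k a A u h
    have := (ih (k + 1) _ _ (u.map (shift 0)) (h.shift 0)).map (f := lam) fun _ _ => Red.lam
    simpa [subst_lam, Multiset.map_bind, Multiset.bind_map] using this
  · intro s t ih iht k a A u h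
    rw [subst_app]
    exact conv_cons_steps (fun _ _ _ => Red.appFun _) (fun _ _ _ => RedMonomial.app _)
      (fun u => ih k a A u h) (fun u => iht k a A u h) u
  · intro s ih k a A u h
    have := (ih k _ _ u h).map (f := inl) fun _ _ => Red.inl
    simpa [subst_inl, Multiset.map_bind] using this
  · intro s ih k a A u h
    have := (ih k _ _ u h).map (f := inr) fun _ _ => Red.inr
    simpa [subst_inr, Multiset.map_bind] using this
  · intro k a A u h
    simpa [msubst_zero] using Steps.refl (R := RedMonomial) 0
  · intro s t ih iht k a A u h
    rw [msubst_cons]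
    exact conv_cons_steps (fun _ _ _ => RedMonomial.mk _) (fun _ _ _ => RedMonomial.cons _)
      (fun u => ih k a A u h) (fun u => iht k a A u h) u

/-- The β case is the substitution lemma followed by one β-step in each summand; the other root
rules commute with substitution summand by summand. -/
theorem Red.subst {s : ResTerm} {S : ResSum} (h : Red s S) (k : ℕ) (u : ResMonomial) :
    Steps Red (subst k s u) (S.bind fun s' => subst k s' u) := by
  induction h generalizing k u with
  | beta s t =>
    rw [subst_subst.1 _ _ _ _ _ (Nat.zero_le k), subst_app, conv]
    refine Steps.bind fun p _ => ?_
    rw [subst_lam, Multiset.bind_map, Multiset.bind_bind]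
    exact Steps.bind fun s' _ => Steps.map_map fun t' _ => Red.beta _ _
  | appInl s t =>
    rw [Multiset.singleton_bind, subst_inl, subst_app, subst_app]
    simp only [conv, subst_inl, Multiset.map_bind, Multiset.bind_map, Multiset.map_map,
      Function.comp_def]
    exact Steps.bind fun p _ => Steps.bind fun s' _ => Steps.map_map_singleton fun t' _ =>
      Red.appInl _ _
  | appInr s t =>
    rw [Multiset.singleton_bind, subst_inr, subst_app, subst_app]
    simp only [conv, subst_inr, Multiset.map_bind, Multiset.bind_map, Multiset.map_map,
      Function.comp_def]
    exact Steps.bind fun p _ => Steps.bind fun s' _ => Steps.map_map_singleton fun t' _ =>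
      Red.appInr _ _
  | lamInl s =>
    simp only [Multiset.singleton_bind, subst_inl, subst_lam, Multiset.map_map]
    exact Steps.map_map_singleton fun _ _ => Red.lamInl _
  | lamInr s =>
    simp only [Multiset.singleton_bind, subst_inr, subst_lam, Multiset.map_map]
    exact Steps.map_map_singleton fun _ _ => Red.lamInr _
  | lam h ih =>
    have := (ih (k + 1) (u.map (ResTerm.shift 0))).map (f := ResTerm.lam) fun _ _ => Red.lam
    simpa [subst_lam, Multiset.map_bind, Multiset.bind_map] using this
  | appFun t h ih =>
    simp only [Multiset.bind_map, subst_app, ← conv_bind_left]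
    exact Steps.conv_left (fun _ _ _ => Red.appFun _) (ih k) _ _
  | appArg t v h ih =>
    simp only [Multiset.bind_map, subst_app, ← conv_bind_right, msubst_cons, ← conv_bind_left]
    exact Steps.conv_right (fun _ _ _ => RedMonomial.app _) _
      (Steps.conv_left (fun _ _ _ => RedMonomial.mk _) (ih k) _) _
  | inl h ih =>
    have := (ih k u).map (f := ResTerm.inl) fun _ _ => Red.inl
    simpa [subst_inl, Multiset.map_bind, Multiset.bind_map] using this
  | inr h ih =>
    have := (ih k u).map (f := ResTerm.inr) fun _ _ => Red.inr
    simpa [subst_inr, Multiset.map_bind, Multiset.bind_map] using this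

/-! ### Local confluence -/

/-- Reduction at the root of a resource term. -/
inductive RootRed : ResTerm → ResSum → Prop
  | beta (s : ResTerm) (t : ResMonomial) : RootRed (app (lam s) t) (subst 0 s t)
  | appInl (s : ResTerm) (t : ResMonomial) : RootRed (app (inl s) t) {inl (app s t)}
  | appInr (s : ResTerm) (t : ResMonomial) : RootRed (app (inr s) t) {inr (app s t)}
  | lamInl (s : ResTerm) : RootRed (lam (inl s)) {inl (lam s)}
  | lamInr (s : ResTerm) : RootRed (lam (inr s)) {inr (lam s)}

/-- The left sides of the root rules do not overlap and determine their parameters. -/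
theorem RootRed.unique {s : ResTerm} {S S' : ResSum} (h : RootRed s S) (h' : RootRed s S') :
    S = S' := by
  have key : ∀ {s s'}, RootRed s S → RootRed s' S' → s = s' → S = S' := by
    intro s s' h h' e
    cases h <;> cases h' <;> simp_all
  exact key h h' rfl

theorem not_red_var (n : ℕ) (S : ResSum) : ¬ Red (var n) S := by
  intro h
  -- The constructors are functions into a quotient, which `cases` cannot unify; the index is
  -- generalized and the equation is treated by injectivity and disjointness. The same device recurs
  -- below.
  generalize hx : var n = x at h
  cases h <;> simp at hx

theorem red_lam {s : ResTerm} {S : ResSum} (h : Red (lam s) S) :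
    RootRed (lam s) S ∨ ∃ S', Red s S' ∧ S = S'.map lam := by
  generalize hx : lam s = x at h
  cases h with
  | lamInl => exact .inl (.lamInl _)
  | lamInr => exact .inl (.lamInr _)
  | lam h =>
    obtain rfl := lam_inj.1 hx
    exact .inr ⟨_, h, rfl⟩
  | _ => simp at hx

theorem red_inl {s : ResTerm} {S : ResSum} (h : Red (inl s) S) :
    ∃ S', Red s S' ∧ S = S'.map inl := by
  generalize hx : inl s = x at h
  cases h with
  | inl h =>
    obtain rfl := inl_inj.1 hx
    exact ⟨_, h, rfl⟩
  | _ => simp at hx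

theorem red_inr {s : ResTerm} {S : ResSum} (h : Red (inr s) S) :
    ∃ S', Red s S' ∧ S = S'.map inr := by
  generalize hx : inr s = x at h
  cases h with
  | inr h =>
    obtain rfl := inr_inj.1 hx
    exact ⟨_, h, rfl⟩
  | _ => simp at hx

theorem red_app {s : ResTerm} {t : ResMonomial} {S : ResSum} (h : Red (app s t) S) :
    RootRed (app s t) S ∨ (∃ S', Red s S' ∧ S = S'.map fun s' => app s' t) ∨
      ∃ a A u, t = a ::ₘ u ∧ Red a A ∧ S = A.map fun a' => app s (a' ::ₘ u) := by
  generalize hx : app s t = x at h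
  cases h with
  | beta => exact .inl (.beta _ _)
  | appInl => exact .inl (.appInl _ _)
  | appInr => exact .inl (.appInr _ _)
  | appFun t h =>
    obtain ⟨rfl, rfl⟩ := app_inj.1 hx
    exact .inr (.inl ⟨_, h, rfl⟩)
  | appArg t u h =>
    obtain ⟨rfl, rfl⟩ := app_inj.1 hx
    exact .inr (.inr ⟨_, _, u, rfl, h, rfl⟩)
  | _ => simp at hx

/-- Two sums have a common reduct. -/
def Joinable (E F : ResSum) : Prop := ∃ G, Steps Red E G ∧ Steps Red F G

theorem Joinable.symm {E F : ResSum} (h : Joinable E F) : Joinable F E :=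
  let ⟨G, h, h'⟩ := h
  ⟨G, h', h⟩

theorem Joinable.refl (E : ResSum) : Joinable E E := ⟨E, Steps.refl _, Steps.refl _⟩

theorem Joinable.map {E F : ResSum} (h : Joinable E F) {f : ResTerm → ResTerm}
    (hf : ∀ s S, Red s S → Red (f s) (S.map f)) : Joinable (E.map f) (F.map f) :=
  let ⟨G, h, h'⟩ := h
  ⟨G.map f, h.map hf, h'.map hf⟩

theorem joinable_lam {s : ResTerm} {S S' : ResSum} (h : RootRed (lam s) S) (hr : Red s S') :
    Joinable S (S'.map lam) := by
  generalize hx : lam s = x at h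
  cases h with
  | lamInl =>
    obtain rfl := lam_inj.1 hx
    obtain ⟨S', h', rfl⟩ := red_inl hr
    refine ⟨(S'.map lam).map inl, Steps.single h'.lam.inl, ?_⟩
    rw [Multiset.map_map, Multiset.map_map]
    exact Steps.map_map_singleton fun _ _ => Red.lamInl _
  | lamInr =>
    obtain rfl := lam_inj.1 hx
    obtain ⟨S', h', rfl⟩ := red_inr hr
    refine ⟨(S'.map lam).map inr, Steps.single h'.lam.inr, ?_⟩
    rw [Multiset.map_map, Multiset.map_map]
    exact Steps.map_map_singleton fun _ _ => Red.lamInr _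
  | _ => simp at hx

/-- The critical pairs overlap β with an injection under the abstraction: moving the injection out
through the abstraction and the application and then firing β gives the result of the direct β-step.
Other reductions in the body of a β-redex are covered by `Red.subst`. -/
theorem joinable_appFun {s : ResTerm} {t : ResMonomial} {S S' : ResSum}
    (h : RootRed (app s t) S) (hr : Red s S') : Joinable S (S'.map fun s' => app s' t) := by
  generalize hx : app s t = x at h
  cases h with
  | beta =>
    obtain ⟨rfl, rfl⟩ := app_inj.1 hx
    rcases red_lam hr with h' | ⟨S', h', rfl⟩
    · generalize hx : lam _ = x at h'
      cases h' with
      | lamInl s =>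
        obtain rfl := lam_inj.1 hx
        refine ⟨_, Steps.refl _, ?_⟩
        rw [subst_inl, Multiset.map_singleton]
        exact (Steps.single (Red.appInl _ _)).trans (Steps.single (Red.beta _ _).inl)
      | lamInr s =>
        obtain rfl := lam_inj.1 hx
        refine ⟨_, Steps.refl _, ?_⟩
        rw [subst_inr, Multiset.map_singleton]
        exact (Steps.single (Red.appInr _ _)).trans (Steps.single (Red.beta _ _).inr)
      | _ => simp at hx
    · refine ⟨_, h'.subst 0 t, ?_⟩
      rw [Multiset.map_map]
      exact Steps.map_map fun _ _ => Red.beta _ _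
  | appInl =>
    obtain ⟨rfl, rfl⟩ := app_inj.1 hx
    obtain ⟨S', h', rfl⟩ := red_inl hr
    refine ⟨_, Steps.single (h'.appFun t).inl, ?_⟩
    rw [Multiset.map_map, Multiset.map_map]
    exact Steps.map_map_singleton fun _ _ => Red.appInl _ _
  | appInr =>
    obtain ⟨rfl, rfl⟩ := app_inj.1 hx
    obtain ⟨S', h', rfl⟩ := red_inr hr
    refine ⟨_, Steps.single (h'.appFun t).inr, ?_⟩
    rw [Multiset.map_map, Multiset.map_map]
    exact Steps.map_map_singleton fun _ _ => Red.appInr _ _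
  | _ => simp at hx

theorem joinable_appArg {s a : ResTerm} {u : ResMonomial} {S A : ResSum}
    (h : RootRed (app s (a ::ₘ u)) S) (h' : Red a A) :
    Joinable S (A.map fun a' => app s (a' ::ₘ u)) := by
  generalize hx : app s (a ::ₘ u) = x at h
  cases h with
  | beta =>
    obtain ⟨rfl, rfl⟩ := app_inj.1 hx
    exact ⟨_, steps_subst_cons.1 _ _ _ _ _ h', Steps.map_map fun _ _ => Red.beta _ _⟩
  | appInl =>
    obtain ⟨rfl, rfl⟩ := app_inj.1 hx
    refine ⟨_, Steps.single (h'.appArg _ u).inl, ?_⟩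
    rw [Multiset.map_map]
    exact Steps.map_map_singleton fun _ _ => Red.appInl _ _
  | appInr =>
    obtain ⟨rfl, rfl⟩ := app_inj.1 hx
    refine ⟨_, Steps.single (h'.appArg _ u).inr, ?_⟩
    rw [Multiset.map_map]
    exact Steps.map_map_singleton fun _ _ => Red.appInr _ _
  | _ => simp at hx

theorem joinable_appFun_appArg {s a : ResTerm} {u : ResMonomial} {S A : ResSum} (h : Red s S)
    (h' : Red a A) :
    Joinable (S.map fun s' => app s' (a ::ₘ u)) (A.map fun a' => app s (a' ::ₘ u)) := by
  refine ⟨S.bind fun s' => A.map fun a' => app s' (a' ::ₘ u),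
    Steps.map_map fun s' _ => h'.appArg s' u, ?_⟩
  rw [Multiset.bind_map_comm]
  exact Steps.map_map fun a' _ => h.appFun _

/-- Reduction of resource terms is locally confluent. -/
theorem red_locally_confluent (s : ResTerm) :
    ∀ {S S' : ResSum}, Red s S → Red s S' → Joinable S S' := by
  induction s using induction with
  | hvar n => exact fun h => absurd h (not_red_var n _)
  | hlam s ih =>
    intro T T' hr hr'
    rcases red_lam hr with h | ⟨S, h, rfl⟩ <;> rcases red_lam hr' with h' | ⟨S', h', rfl⟩
    · exact h.unique h' ▸ Joinable.refl _
    · exact joinable_lam h h'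
    · exact (joinable_lam h' h).symm
    · exact (ih h h').map fun _ _ => Red.lam
  | happ s t ih iht =>
    intro T T' hr hr'
    rcases red_app hr with h | ⟨S, h, rfl⟩ | ⟨a, A, u, rfl, h, rfl⟩
    · rcases red_app hr' with h' | ⟨S', h', rfl⟩ | ⟨a, A, u, rfl, h', rfl⟩
      · exact h.unique h' ▸ Joinable.refl _
      · exact joinable_appFun h h'
      · exact joinable_appArg h h'
    · rcases red_app hr' with h' | ⟨S', h', rfl⟩ | ⟨a, A, u, rfl, h', rfl⟩
      · exact (joinable_appFun h' h).symm
      · exact (ih h h').map fun _ _ => Red.appFun t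
      · exact joinable_appFun_appArg h h'
    · rcases red_app hr' with h' | ⟨S', h', rfl⟩ | ⟨b, B, v, e, h', rfl⟩
      · exact (joinable_appArg h' h).symm
      · exact (joinable_appFun_appArg h' h).symm
      -- Equal elements of a multiset are indistinguishable: either both steps reduce the same term,
      -- or they concern distinct elements and commute.
      · rcases Multiset.cons_eq_cons.1 e with ⟨rfl, rfl⟩ | ⟨_, w, rfl, rfl⟩
        · exact (iht a (by simp) h h').map fun _ _ => Red.appArg s u
        · refine ⟨A.bind fun a' => B.map fun b' => app s (a' ::ₘ b' ::ₘ w), ?_, ?_⟩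
          · refine Steps.map_map fun a' _ => ?_
            simpa only [Multiset.cons_swap a'] using h'.appArg s (a' ::ₘ w)
          · rw [Multiset.bind_map_comm]
            refine Steps.map_map fun b' _ => ?_
            simpa only [Multiset.cons_swap b'] using h.appArg s (b' ::ₘ w)
  | hinl s ih =>
    intro T T' hr hr'
    obtain ⟨S, h, rfl⟩ := red_inl hr
    obtain ⟨S', h', rfl⟩ := red_inl hr'
    exact (ih h h').map fun _ _ => Red.inl
  | hinr s ih =>
    intro T T' hr hr'
    obtain ⟨S, h, rfl⟩ := red_inr hr
    obtain ⟨S', h', rfl⟩ := red_inr hr'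
    exact (ih h h').map fun _ _ => Red.inr

end ResTerm

namespace ResTerm

/-! ### Termination -/

/-- The number of variable occurrences, abstractions and applications. -/
def size : ResTerm → ℕ :=
  fold (fun _ => 1) (fun _ x => x + 1) (fun _ x ts => x + (ts.map Prod.snd).sum + 1)
    (fun _ x => x) (fun _ x => x)

/-- A weight that decreases when an injection moves outwards. -/
def weight : ResTerm → ℕ :=
  fold (fun _ => 0) (fun _ x => 2 * x + 1) (fun _ x ts => 2 * x + (ts.map Prod.snd).sum + 1)
    (fun _ x => x + 1) (fun _ x => x + 1)

@[simp] theorem size_var (n : ℕ) : size (var n) = 1 := fold_var ..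
@[simp] theorem size_lam (s : ResTerm) : size (lam s) = size s + 1 := fold_lam ..
@[simp] theorem size_inl (s : ResTerm) : size (inl s) = size s := fold_inl ..
@[simp] theorem size_inr (s : ResTerm) : size (inr s) = size s := fold_inr ..
@[simp] theorem size_app (s : ResTerm) (t : ResMonomial) :
    size (app s t) = size s + (t.map size).sum + 1 := by
  rw [size, fold_app, Multiset.map_map]; rfl

@[simp] theorem weight_lam (s : ResTerm) : weight (lam s) = 2 * weight s + 1 := fold_lam ..
@[simp] theorem weight_inl (s : ResTerm) : weight (inl s) = weight s + 1 := fold_inl ..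
@[simp] theorem weight_inr (s : ResTerm) : weight (inr s) = weight s + 1 := fold_inr ..
@[simp] theorem weight_app (s : ResTerm) (t : ResMonomial) :
    weight (app s t) = 2 * weight s + (t.map weight).sum + 1 := by
  rw [weight, fold_app, Multiset.map_map]; rfl

@[simp] theorem size_shift (s : ResTerm) (c : ℕ) : size (shift c s) = size s := by
  induction s using induction generalizing c with
  | hvar n => simp
  | hlam s ih => simp [ih]
  | happ s t ih iht =>
    simp only [shift_app, size_app, ih, Multiset.map_map, Function.comp_def]
    rw [Multiset.map_congr rfl fun u hu => iht u hu c]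
  | hinl s ih => simp [ih]
  | hinr s ih => simp [ih]

/-- In a nonzero summand each element of `t` replaces one variable occurrence, of size `1`, and
there are as many occurrences as elements. -/
theorem size_of_mem_subst :
    (∀ s k t u, u ∈ subst k s t → size u + Multiset.card t = size s + (t.map size).sum) ∧
    ∀ s k t u, u ∈ msubst k s t →
      (u.map size).sum + Multiset.card t = (s.map size).sum + (t.map size).sum := by
  refine induction₂ ?_ ?_ ?_ ?_ ?_ ?_ ?_
  · intro n k t u h
    rw [subst_var] at h
    split_ifs at h with h₁ h₂ h₂
    · obtain ⟨a, rfl⟩ := Multiset.card_eq_one.1 h₂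
      obtain rfl := Multiset.mem_singleton.1 h
      simp [add_comm]
    · simp at h
    · obtain rfl := Multiset.card_eq_zero.1 h₂
      obtain rfl := Multiset.mem_singleton.1 h
      simp
    · obtain rfl := Multiset.card_eq_zero.1 h₂
      obtain rfl := Multiset.mem_singleton.1 h
      simp
    · simp at h
  · intro s ih k t u h
    rw [subst_lam] at h
    obtain ⟨v, hv, rfl⟩ := Multiset.mem_map.1 h
    have := ih _ _ _ hv
    have e : (t.map (shift 0)).map size = t.map size := by simp
    rw [e, Multiset.card_map] at this
    simp only [size_lam]
    omega
  · intro s t ih iht k v u h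
    simp only [subst_app, conv, Multiset.mem_bind, Multiset.mem_map] at h
    obtain ⟨p, hp, s', hs, t', ht, rfl⟩ := h
    have h₁ := ih _ _ _ hs
    have h₂ := iht _ _ _ ht
    rw [Multiset.mem_antidiagonal] at hp
    subst hp
    simp only [size_app, Multiset.card_add, Multiset.map_add, Multiset.sum_add]
    omega
  · intro s ih k t u h
    rw [subst_inl] at h
    obtain ⟨v, hv, rfl⟩ := Multiset.mem_map.1 h
    simpa using ih _ _ _ hv
  · intro s ih k t u h
    rw [subst_inr] at h
    obtain ⟨v, hv, rfl⟩ := Multiset.mem_map.1 h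
    simpa using ih _ _ _ hv
  · intro k t u h
    rw [msubst_zero] at h
    split_ifs at h with ht
    · obtain rfl := Multiset.mem_singleton.1 h
      simp [ht]
    · simp at h
  · intro s t ih iht k v u h
    simp only [msubst_cons, conv, Multiset.mem_bind, Multiset.mem_map] at h
    obtain ⟨p, hp, s', hs, t', ht, rfl⟩ := h
    have h₁ := ih _ _ _ hs
    have h₂ := iht _ _ _ ht
    rw [Multiset.mem_antidiagonal] at hp
    subst hp
    simp only [Multiset.map_cons, Multiset.sum_cons, Multiset.card_add, Multiset.map_add,
      Multiset.sum_add]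
    omega

/-- The well-founded order for which reduction decreases. -/
def Smaller (u s : ResTerm) : Prop := size u < size s ∨ size u = size s ∧ weight u < weight s

theorem wellFounded_smaller : WellFounded Smaller := by
  have h : Smaller = InvImage (Prod.Lex (· < ·) (· < ·)) fun s => (size s, weight s) := by
    funext u s
    simp [Smaller, InvImage, Prod.lex_def]
  rw [h]
  exact InvImage.wf _ (WellFounded.prod_lex wellFounded_lt wellFounded_lt)

instance : Std.Irrefl Smaller := ⟨fun a h => by simp [Smaller] at h⟩

/-- β removes an abstraction and an application besides the replaced variables. Moving an injection
outwards keeps the size and lowers the weight, because weights are doubled under abstractions and in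
function position: `2(w + 1) + 1 > (2w + 1) + 1`. -/
theorem Red.smaller {s : ResTerm} {S : ResSum} (h : Red s S) : ∀ u ∈ S, Smaller u s := by
  induction h with
  | beta s t =>
    intro u hu
    have := size_of_mem_subst.1 _ _ _ _ hu
    left
    simp only [size_app, size_lam]
    omega
  | appInl s t => simp [Smaller]; omega
  | appInr s t => simp [Smaller]; omega
  | lamInl s => simp [Smaller]; omega
  | lamInr s => simp [Smaller]; omega
  | appArg t u h ih =>
    simp only [Multiset.mem_map, Smaller, forall_exists_index, and_imp, forall_apply_eq_imp_iff₂,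
      size_app, weight_app, Multiset.map_cons, Multiset.sum_cons] at ih ⊢
    intro v hv
    have := ih v hv
    omega
  | _ =>
    rename_i ih
    simp only [Multiset.mem_map, Smaller, forall_exists_index, and_imp, forall_apply_eq_imp_iff₂,
      size_app, weight_app, size_lam, weight_lam, size_inl, weight_inl, size_inr, weight_inr] at ih ⊢
    intro v hv
    have := ih v hv
    omega

/-- One summand is replaced by finitely many smaller ones, as in the hydra game. -/
theorem wellFounded_sumStep : WellFounded fun F E : ResSum => SumStep Red E F := by
  refine Subrelation.wf (r := Relation.CutExpand Smaller) ?_ wellFounded_smaller.cutExpand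
  rintro _ _ ⟨F, h⟩
  refine ⟨_, _, h.smaller, ?_⟩
  rw [← Multiset.singleton_add]
  abel

/-! ### Confluence and normal forms -/

theorem Joinable.add_right {E F : ResSum} (h : Joinable E F) (G : ResSum) :
    Joinable (E + G) (F + G) :=
  let ⟨H, h, h'⟩ := h
  ⟨H + G, h.add_right G, h'.add_right G⟩

theorem sumStep_locally_confluent {E F F' : ResSum} (h : SumStep Red E F)
    (h' : SumStep Red E F') : Joinable F F' := by
  obtain ⟨G, h⟩ := h
  generalize hE : _ ::ₘ G = E at h'
  obtain ⟨G', h'⟩ := h'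
  rcases Multiset.cons_eq_cons.1 hE with ⟨rfl, rfl⟩ | ⟨_, H, rfl, rfl⟩
  · exact (red_locally_confluent _ h h').add_right _
  · rename_i s S s' S' _
    refine ⟨S + (S' + H), ?_, ?_⟩
    · have := (Steps.single h').add_right (S + H)
      rwa [Multiset.singleton_add, ← Multiset.add_cons, add_left_comm] at this
    · have := (Steps.single h).add_right (S' + H)
      rwa [Multiset.singleton_add, ← Multiset.add_cons] at this

/-- Newman's lemma, by well-founded induction on the sum. -/
theorem steps_confluent {E F F' : ResSum} (h : Steps Red E F) (h' : Steps Red E F') :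
    Joinable F F' := by
  induction E using wellFounded_sumStep.induction generalizing F F' with
  | _ E ih =>
    rcases h.cases_head with rfl | ⟨E₁, h₁, h⟩
    · exact ⟨F', h', Steps.refl _⟩
    rcases h'.cases_head with rfl | ⟨E₂, h₂, h'⟩
    · exact ⟨F, Steps.refl _, .head h₁ h⟩
    obtain ⟨G, hG₁, hG₂⟩ := sumStep_locally_confluent h₁ h₂
    obtain ⟨H, hH₁, hH₂⟩ := ih _ h₁ h hG₁
    obtain ⟨K, hK₁, hK₂⟩ := ih _ h₂ (hG₂.trans hH₂) h'
    exact ⟨K, hH₁.trans hK₁, hK₂⟩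

/-- Resource terms that cannot be reduced. -/
def Irreducible (s : ResTerm) : Prop := ∀ S, ¬ Red s S

theorem isNormalFormOf_iff {E F : ResSum} :
    IsNormalFormOf F E ↔ Steps Red E F ∧ ∀ s ∈ F, Irreducible s := by
  rw [IsNormalFormOf, steps_red_iff]
  refine and_congr_right fun _ => ⟨fun h s hs S hS => ?_, ?_⟩
  · obtain ⟨F, rfl⟩ := Multiset.exists_cons_of_mem hs
    exact h _ ⟨F, hS⟩
  · rintro h _ ⟨F, hF⟩
    exact h _ (by simp) _ hF

theorem Steps.eq_of_irreducible {E F : ResSum} (h : Steps Red E F) (hE : ∀ s ∈ E, Irreducible s) :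
    E = F := by
  rcases h.cases_head with rfl | ⟨_, ⟨G, h'⟩, _⟩
  · rfl
  · exact absurd h' (hE _ (Multiset.mem_cons_self _ _) _)

theorem existsUnique_isNormalFormOf (E : ResSum) : ∃! F, IsNormalFormOf F E := by
  have hex : ∃ F, IsNormalFormOf F E := by
    simp only [isNormalFormOf_iff]
    induction E using wellFounded_sumStep.induction with
    | _ E ih =>
      by_cases hE : ∀ s ∈ E, Irreducible s
      · exact ⟨E, Steps.refl _, hE⟩
      · simp only [Irreducible, not_forall, not_not] at hE
        obtain ⟨s, hs, S, hS⟩ := hE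
        obtain ⟨G, rfl⟩ := Multiset.exists_cons_of_mem hs
        obtain ⟨F, h, hF⟩ := ih _ ⟨G, hS⟩
        exact ⟨F, .head ⟨G, hS⟩ h, hF⟩
  obtain ⟨F, hF⟩ := hex
  refine ⟨F, hF, fun F' hF' => ?_⟩
  rw [isNormalFormOf_iff] at hF hF'
  obtain ⟨G, h, h'⟩ := steps_confluent hF.1 hF'.1
  rw [Steps.eq_of_irreducible h hF.2, Steps.eq_of_irreducible h' hF'.2]

theorem isNormalFormOf_NF (E : ResSum) : IsNormalFormOf (NF E) E :=
  Classical.epsilon_spec (existsUnique_isNormalFormOf E).exists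

theorem irreducible_of_mem_NF {E : ResSum} {u : ResTerm} (h : u ∈ NF E) : Irreducible u :=
  (isNormalFormOf_iff.1 (isNormalFormOf_NF E)).2 u h

theorem NF_eq_of_steps {E F : ResSum} (h : Steps Red E F) : NF E = NF F := by
  have hF := isNormalFormOf_iff.1 (isNormalFormOf_NF F)
  exact (existsUnique_isNormalFormOf E).unique (isNormalFormOf_NF E)
    (isNormalFormOf_iff.2 ⟨h.trans hF.1, hF.2⟩)

theorem NF_of_irreducible {E : ResSum} (h : ∀ s ∈ E, Irreducible s) : NF E = E :=
  (existsUnique_isNormalFormOf E).unique (isNormalFormOf_NF E)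
    (isNormalFormOf_iff.2 ⟨Steps.refl _, h⟩)

theorem NF_add (E F : ResSum) : NF (E + F) = NF E + NF F := by
  have hE := isNormalFormOf_iff.1 (isNormalFormOf_NF E)
  have hF := isNormalFormOf_iff.1 (isNormalFormOf_NF F)
  rw [NF_eq_of_steps (hE.1.add hF.1), NF_of_irreducible]
  intro s hs
  rcases Multiset.mem_add.1 hs with hs | hs
  exacts [hE.2 s hs, hF.2 s hs]

theorem mem_NF_of_irreducible {E : ResSum} {u : ResTerm} (h : u ∈ E) (hu : Irreducible u) :
    u ∈ NF E := by
  obtain ⟨F, rfl⟩ := Multiset.exists_cons_of_mem h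
  rw [← Multiset.singleton_add, NF_add, NF_of_irreducible (E := {u}) (by simpa)]
  simp

end ResTerm

namespace ResTerm

/-! ### Multiplicities of monomials -/

@[simp] theorem mult_var (n : ℕ) : mult (var n) = 1 := fold_var ..
@[simp] theorem mult_lam (s : ResTerm) : mult (lam s) = mult s := fold_lam ..
@[simp] theorem mult_inl (s : ResTerm) : mult (inl s) = mult s := fold_inl ..
@[simp] theorem mult_inr (s : ResTerm) : mult (inr s) = mult s := fold_inr ..

/-- The multiplicity coefficient of a monomial. -/
noncomputable def mmult (t : ResMonomial) : ℕ :=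
  ∏ u ∈ t.toFinset, (Nat.factorial (t.count u) * mult u ^ t.count u)

theorem mult_app_eq (s : ResTerm) (t : ResMonomial) : mult (app s t) = mult s * mmult t :=
  mult_app s t

@[simp] theorem mmult_zero : mmult 0 = 1 := by simp [mmult]

theorem mmult_eq_prod {t : ResMonomial} {F : Finset ResTerm} (h : t.toFinset ⊆ F) :
    mmult t = ∏ u ∈ F, (Nat.factorial (t.count u) * mult u ^ t.count u) := by
  refine Finset.prod_subset h fun u _ hu => ?_
  rw [Multiset.mem_toFinset] at hu
  simp [Multiset.count_eq_zero_of_notMem hu]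

/-- One more copy of `a` multiplies the factorial by the new count and the power by `mult a`. This
recursion drives the inductions on monomials. -/
theorem mmult_cons (a : ResTerm) (t : ResMonomial) :
    mmult (a ::ₘ t) = (t.count a + 1) * mult a * mmult t := by
  have h : t.toFinset ⊆ (a ::ₘ t).toFinset := by simp
  have ha : a ∈ (a ::ₘ t).toFinset := by simp
  rw [mmult_eq_prod h, mmult, ← Finset.mul_prod_erase _ _ ha,
    ← Finset.mul_prod_erase _ (fun u => Nat.factorial (t.count u) * mult u ^ t.count u) ha,
    Multiset.count_cons_self, Nat.factorial_succ, pow_succ,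
    Finset.prod_congr rfl fun u hu => by
      rw [Multiset.count_cons_of_ne (Finset.ne_of_mem_erase hu)]]
  ring

theorem mult_pos (s : ResTerm) : 0 < mult s := by
  induction s using induction with
  | hvar n => simp
  | happ s t ih iht =>
    rw [mult_app_eq]
    refine Nat.mul_pos ih (Finset.prod_pos fun u hu => ?_)
    exact Nat.mul_pos (Nat.factorial_pos _) (pow_pos (iht u (Multiset.mem_toFinset.1 hu)) _)
  | _ => simpa

theorem mmult_pos (t : ResMonomial) : 0 < mmult t :=
  Finset.prod_pos fun u _ => Nat.mul_pos (Nat.factorial_pos _) (pow_pos (mult_pos u) _)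

theorem mult_shift (s : ResTerm) (c : ℕ) : mult (shift c s) = mult s := by
  have key : (∀ s c, mult (shift c s) = mult s) ∧ ∀ t c, mmult (t.map (shift c)) = mmult t := by
    refine induction₂ ?_ ?_ ?_ ?_ ?_ ?_ ?_
    · simp
    · intro s ih c
      simp [ih]
    · intro s t ih iht c
      rw [shift_app, mult_app_eq, mult_app_eq, ih, iht]
    · intro s ih c
      simp [ih]
    · intro s ih c
      simp [ih]
    · simp
    · intro s t ih iht c
      rw [Multiset.map_cons, mmult_cons, mmult_cons, ih, iht,
        Multiset.count_map_eq_count' _ _ (shift_injective c)]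
  exact key.1 s c

theorem mmult_map_shift (t : ResMonomial) (c : ℕ) : mmult (t.map (shift c)) = mmult t := by
  induction t using Multiset.induction with
  | empty => simp
  | cons a t ih =>
    rw [Multiset.map_cons, mmult_cons, mmult_cons, ih, mult_shift,
      Multiset.count_map_eq_count' _ _ (shift_injective c)]

theorem count_map_cons (a : ResTerm) (v : ResMonomial) (W : Multiset ResMonomial) :
    (W.map (Multiset.cons a)).count v = if a ∈ v then W.count (v.erase a) else 0 := by
  split_ifs with h
  · conv_lhs => rw [← Multiset.cons_erase h]
    exact Multiset.count_map_eq_count' _ _ (fun _ _ h => (Multiset.cons_inj_right a).1 h) _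
  · refine Multiset.count_eq_zero_of_notMem fun h' => ?_
    obtain ⟨w, _, rfl⟩ := Multiset.mem_map.1 h'
    simp at h

theorem count_map_prodMap_cons (a : ResTerm) (p q : ResMonomial)
    (W : Multiset (ResMonomial × ResMonomial)) :
    (W.map (Prod.map id (Multiset.cons a))).count (p, q)
      = if a ∈ q then W.count (p, q.erase a) else 0 := by
  split_ifs with h
  · conv_lhs => rw [← Multiset.cons_erase h]
    exact Multiset.count_map_eq_count' (Prod.map id (Multiset.cons a)) W
      (Function.injective_id.prodMap (fun _ _ h => (Multiset.cons_inj_right a).1 h)) (p, q.erase a)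
  · refine Multiset.count_eq_zero_of_notMem fun h' => ?_
    obtain ⟨w, _, hw⟩ := Multiset.mem_map.1 h'
    simp only [Prod.map, Prod.mk.injEq] at hw
    rw [← hw.2] at h
    simp at h

theorem count_map_prodMap_cons' (a : ResTerm) (p q : ResMonomial)
    (W : Multiset (ResMonomial × ResMonomial)) :
    (W.map (Prod.map (Multiset.cons a) id)).count (p, q)
      = if a ∈ p then W.count (p.erase a, q) else 0 := by
  split_ifs with h
  · conv_lhs => rw [← Multiset.cons_erase h]
    exact Multiset.count_map_eq_count' (Prod.map (Multiset.cons a) id) W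
      (Function.Injective.prodMap (fun _ _ h => (Multiset.cons_inj_right a).1 h)
        Function.injective_id) (p.erase a, q)
  · refine Multiset.count_eq_zero_of_notMem fun h' => ?_
    obtain ⟨w, _, hw⟩ := Multiset.mem_map.1 h'
    simp only [Prod.map, Prod.mk.injEq] at hw
    rw [← hw.1] at h
    simp at h

theorem mmult_of_mem {a : ResTerm} {t : ResMonomial} (h : a ∈ t) :
    mmult t = t.count a * mult a * mmult (t.erase a) := by
  obtain ⟨t, rfl⟩ := Multiset.exists_cons_of_mem h
  rw [mmult_cons, Multiset.count_cons_self, Multiset.erase_cons_head]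

/-- The number of ways to split `p + q` into `p` and `q` is a product of binomial coefficients, and
the powers of the `mult a` cancel. The induction is Pascal's rule: a new copy of `a` goes to `p` or
to `q`, and its counts in `p` and `q` add up to its count in the sum. -/
theorem count_antidiagonal (p q : ResMonomial) :
    (p + q).antidiagonal.count (p, q) * (mmult p * mmult q) = mmult (p + q) := by
  generalize ht : p + q = t
  induction t using Multiset.induction generalizing p q with
  | empty =>
    obtain ⟨rfl, rfl⟩ := add_eq_zero.1 ht
    simp
  | cons a t ih =>
    rw [Multiset.antidiagonal_cons, Multiset.count_add, count_map_prodMap_cons,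
      count_map_prodMap_cons', add_mul]
    have h₁ : (if a ∈ q then t.antidiagonal.count (p, q.erase a) else 0) * (mmult p * mmult q)
        = q.count a * mult a * mmult t := by
      split_ifs with h
      · rw [mmult_of_mem h, ← ih p (q.erase a)]
        · ring
        · rw [← Multiset.cons_inj_right a, ← ht, ← Multiset.add_cons, Multiset.cons_erase h]
      · simp [Multiset.count_eq_zero_of_notMem h]
    have h₂ : (if a ∈ p then t.antidiagonal.count (p.erase a, q) else 0) * (mmult p * mmult q)
        = p.count a * mult a * mmult t := by
      split_ifs with h
      · rw [mmult_of_mem h, ← ih (p.erase a) q]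
        · ring
        · rw [← Multiset.cons_inj_right a, ← ht, ← Multiset.cons_add, Multiset.cons_erase h]
      · simp [Multiset.count_eq_zero_of_notMem h]
    have h₃ := congrArg (Multiset.count a) ht
    rw [Multiset.count_add, Multiset.count_cons_self] at h₃
    rw [h₁, h₂, mmult_cons, ← h₃]
    ring

theorem count_bind_map {X Y Z : Type} [DecidableEq X] [DecidableEq Y] [DecidableEq Z]
    {op : X → Y → Z} (hop : Function.Injective2 op)
    (A : Multiset X) (B : Multiset Y) (x : X) (y : Y) :
    (A.bind fun a => B.map (op a)).count (op x y) = A.count x * B.count y := by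
  induction A using Multiset.induction with
  | empty => simp
  | cons a A ih =>
    rw [Multiset.cons_bind, Multiset.count_add, ih]
    by_cases h : x = a
    · subst h
      rw [Multiset.count_map_eq_count' _ _ (hop.right x), Multiset.count_cons_self]
      ring
    · rw [Multiset.count_cons_of_ne h, Multiset.count_eq_zero_of_notMem, zero_add]
      rintro h'
      obtain ⟨b, _, hb⟩ := Multiset.mem_map.1 h'
      exact h (hop hb).1.symm

/-- Unlike application, `Multiset.cons` is not injective on pairs: any element `b` of `v` may be the
one coming from `A`. -/
theorem count_bind_map_cons (A : ResSum) (W : Multiset ResMonomial) (v : ResMonomial) :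
    (A.bind fun a => W.map (Multiset.cons a)).count v
      = ∑ b ∈ v.toFinset, A.count b * W.count (v.erase b) := by
  induction A using Multiset.induction with
  | empty => simp
  | cons a A ih =>
    rw [Multiset.cons_bind, Multiset.count_add, ih, count_map_cons]
    simp only [Multiset.count_cons, add_mul, Finset.sum_add_distrib, ite_mul, one_mul, zero_mul,
      Finset.sum_ite_eq', Multiset.mem_toFinset]
    rw [add_comm]

theorem count_map_eq_sum (f : ResTerm → ResTerm) (a : ResTerm) (v : ResMonomial) :
    (v.map f).count a = ∑ b ∈ v.toFinset, if f b = a then v.count b else 0 := by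
  have h : (v.map f).count a = (v.map fun b => if f b = a then 1 else 0).sum := by
    induction v using Multiset.induction with
    | empty => simp
    | cons b v ih => simp [Multiset.count_cons, ih, add_comm, eq_comm]
  rw [h, Finset.sum_multiset_map_count]
  simp

/-! ### Uniform reductions -/

/-- The monomials over a set of resource terms. -/
def monomials (X : Set ResTerm) : Set ResMonomial := {t | ∀ a ∈ t, a ∈ X}

/-- `K` maps each `s ∈ X` and each monomial `t` over `Z` to a finite sum of elements of `Y`, where
each element of `Y` comes from a unique pair `(s, t)`, and the coefficients are quotients of
multiplicities. -/
structure Uniform {α : Type} [DecidableEq α] (w : α → ℕ) (X Y : Set α) (Z : Set ResTerm)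
    (K : α → ResMonomial → Multiset α) : Prop where
  maps : ∀ {s t u}, s ∈ X → t ∈ monomials Z → u ∈ K s t → u ∈ Y
  surj : ∀ {u}, u ∈ Y → ∃ s ∈ X, ∃ t ∈ monomials Z, u ∈ K s t
  inj : ∀ {s s' t t' u}, s ∈ X → s' ∈ X → u ∈ K s t → u ∈ K s' t' → s = s' ∧ t = t'
  count : ∀ {s t u}, s ∈ X → u ∈ K s t → (K s t).count u * w u = w s * mmult t

theorem monomials_add {Z : Set ResTerm} {t t' : ResMonomial} :
    t + t' ∈ monomials Z ↔ t ∈ monomials Z ∧ t' ∈ monomials Z := by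
  simp [monomials, or_imp, forall_and]

theorem monomials_cons {Z : Set ResTerm} {a : ResTerm} {t : ResMonomial} :
    a ::ₘ t ∈ monomials Z ↔ a ∈ Z ∧ t ∈ monomials Z := by
  simp [monomials]

theorem zero_mem_monomials {Z : Set ResTerm} : 0 ∈ monomials Z := by
  simp [monomials]

theorem mem_conv {X Y Z : Type} {op : X → Y → Z} {f : ResMonomial → Multiset X}
    {g : ResMonomial → Multiset Y} {u : ResMonomial} {z : Z} :
    z ∈ conv op f g u ↔ ∃ p q, p + q = u ∧ ∃ x ∈ f p, ∃ y ∈ g q, op x y = z := by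
  simp [conv]

/-- An application determines its two components, and these determine their origins and their parts
`p`, `q` of the monomial. The coefficient is the number of splittings into `p` and `q` times the two
coefficients, and the splittings account exactly for the multiplicity of `p + q`. -/
theorem Uniform.app {X Y : Set ResTerm} {X' Y' : Set ResMonomial} {Z : Set ResTerm}
    {K L : ResTerm → ResMonomial → ResSum} {K' : ResMonomial → ResMonomial → Multiset ResMonomial}
    (h : Uniform mult X Y Z K) (h' : Uniform mmult X' Y' Z K')
    (hL : ∀ s ∈ X, ∀ t, L (app s t) = conv app (K s) (K' t)) :
    Uniform mult (Set.image2 app X X') (Set.image2 app Y Y') Z L where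
  maps := by
    rintro _ t u ⟨s, hs, s', hs', rfl⟩ ht hu
    rw [hL s hs, mem_conv] at hu
    obtain ⟨p, q, rfl, x, hx, y, hy, rfl⟩ := hu
    rw [monomials_add] at ht
    exact ⟨x, h.maps hs ht.1 hx, y, h'.maps hs' ht.2 hy, rfl⟩
  surj := by
    rintro _ ⟨x, hx, y, hy, rfl⟩
    obtain ⟨s, hs, p, hp, hx⟩ := h.surj hx
    obtain ⟨s', hs', q, hq, hy⟩ := h'.surj hy
    refine ⟨_, ⟨s, hs, s', hs', rfl⟩, p + q, monomials_add.2 ⟨hp, hq⟩, ?_⟩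
    rw [hL s hs, mem_conv]
    exact ⟨p, q, rfl, x, hx, y, hy, rfl⟩
  inj := by
    rintro _ _ t t' u ⟨s, hs, s', hs', rfl⟩ ⟨r, hr, r', hr', rfl⟩ hu hu'
    rw [hL s hs, mem_conv] at hu
    rw [hL r hr, mem_conv] at hu'
    obtain ⟨p, q, rfl, x, hx, y, hy, rfl⟩ := hu
    obtain ⟨p', q', rfl, x', hx', y', hy', e⟩ := hu'
    obtain ⟨rfl, rfl⟩ := app_inj.1 e
    obtain ⟨rfl, rfl⟩ := h.inj hs hr hx hx'
    obtain ⟨rfl, rfl⟩ := h'.inj hs' hr' hy hy'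
    exact ⟨rfl, rfl⟩
  count := by
    rintro _ t u ⟨s, hs, s', hs', rfl⟩ hu
    rw [hL s hs] at hu ⊢
    obtain ⟨p, q, rfl, x, hx, y, hy, rfl⟩ := mem_conv.1 hu
    rw [conv, Multiset.count_bind]
    simp only [count_bind_map (op := ResTerm.app) fun _ _ _ _ h => app_inj.1 h]
    -- By injectivity only the splitting into `p` and `q` contributes, once for each of its
    -- occurrences in the antidiagonal.
    rw [Multiset.sum_map_eq_nsmul_single (p, q), smul_eq_mul, mult_app_eq, mult_app_eq,
      ← count_antidiagonal p q]
    · calc _ = Multiset.count (p, q) (p + q).antidiagonal * ((K s p).count x * mult x) *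
            ((K' s' q).count y * mmult y) := by ring
        _ = _ := by
          rw [h.count hs hx, h'.count hs' hy]
          ring
    · rintro ⟨p', q'⟩ hne _
      by_contra hc
      obtain ⟨h₁, h₂⟩ := mul_ne_zero_iff.1 hc
      obtain ⟨-, rfl⟩ := h.inj hs hs hx (Multiset.count_ne_zero.1 h₁)
      obtain ⟨-, rfl⟩ := h'.inj hs' hs' hy (Multiset.count_ne_zero.1 h₂)
      exact hne rfl

section Monomial

variable {X Y Z : Set ResTerm} {K : ResTerm → ResMonomial → ResSum}

/-- Here `φ b` plays the part of the origin of `b`: the term and the monomial that produced it.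
Origins of the elements of `v` assemble into an origin of `v`. -/
theorem mem_monomialSubst_of_forall {φ : ResTerm → ResTerm × ResMonomial} {v : ResMonomial}
    (h : ∀ b ∈ v, b ∈ K (φ b).1 (φ b).2) :
    v ∈ monomialSubst ((v.map fun b => (φ b).1).map K) (v.map fun b => (φ b).2).sum := by
  induction v using Multiset.induction with
  | empty => simp [monomialSubst_zero]
  | cons b v ih =>
    simp only [Multiset.map_cons, Multiset.sum_cons, monomialSubst_cons]
    exact mem_conv.2 ⟨_, _, rfl, b, h b (by simp), v, ih fun c hc => h c (by simp [hc]), rfl⟩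

/-- The origin of a monomial can be recovered element by element, which yields injectivity on
monomials. -/
theorem map_of_mem_monomialSubst {φ : ResTerm → ResTerm × ResMonomial}
    (hφ : ∀ s ∈ X, ∀ t, ∀ u ∈ K s t, φ u = (s, t)) {s t v : ResMonomial} (hs : s ∈ monomials X)
    (h : v ∈ monomialSubst (s.map K) t) :
    (v.map fun b => (φ b).1) = s ∧ (v.map fun b => (φ b).2).sum = t ∧
      ∀ b ∈ v, b ∈ K (φ b).1 (φ b).2 := by
  induction s using Multiset.induction generalizing t v with
  | empty =>
    rw [Multiset.map_zero, monomialSubst_zero] at h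
    split_ifs at h with ht
    · obtain rfl := Multiset.mem_singleton.1 h
      simp [ht]
    · simp at h
  | cons a s ih =>
    rw [Multiset.map_cons, monomialSubst_cons, mem_conv] at h
    obtain ⟨p, q, rfl, b, hb, w, hw, rfl⟩ := h
    rw [monomials_cons] at hs
    obtain ⟨rfl, rfl, h⟩ := ih hs.2 hw
    have hφb := hφ a hs.1 p b hb
    simp only [Multiset.map_cons, hφb, Multiset.sum_cons, true_and, Multiset.forall_mem_cons]
    exact ⟨hb, h⟩

/-- Induction on `s`. The element `b` of `v` produced by the new `a` can be any element with origin
`a`. With repetitions there are `s.count a + 1` of them, which is the extra factor in `mmult_cons`.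
-/
theorem Uniform.count_monomialSubst (h : Uniform mult X Y Z K)
    {φ : ResTerm → ResTerm × ResMonomial} (hφ : ∀ s ∈ X, ∀ t, ∀ u ∈ K s t, φ u = (s, t))
    {s t v : ResMonomial} (hs : s ∈ monomials X) (hv : v ∈ monomialSubst (s.map K) t) :
    (monomialSubst (s.map K) t).count v * mmult v = mmult s * mmult t := by
  induction s using Multiset.induction generalizing t v with
  | empty =>
    rw [Multiset.map_zero, monomialSubst_zero] at hv ⊢
    split_ifs at hv ⊢ with ht
    · obtain rfl := Multiset.mem_singleton.1 hv
      simp [ht]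
    · simp at hv
  | cons a s ih =>
    obtain ⟨hv₁, hv₂, hv₃⟩ := map_of_mem_monomialSubst hφ hs hv
    rw [monomials_cons] at hs
    rw [Multiset.map_cons, monomialSubst_cons]
    rw [conv, Multiset.count_bind]
    simp only [count_bind_map_cons]
    rw [Finset.sum_multiset_map_count]
    simp only [smul_eq_mul, Finset.mul_sum]
    rw [Finset.sum_comm, Finset.sum_mul]
    -- The contribution of the choice of `b` as the element produced by `a`, multiplied by `mmult
    -- v`.
    have key : ∀ b ∈ v.toFinset,
        (∑ p ∈ t.antidiagonal.toFinset, t.antidiagonal.count p *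
          ((K a p.1).count b * (monomialSubst (s.map K) p.2).count (v.erase b))) * mmult v
          = (if (φ b).1 = a then v.count b else 0) * (mult a * mmult s * mmult t) := by
      intro b hb
      rw [Multiset.mem_toFinset] at hb
      split_ifs with hba
      · obtain ⟨w, rfl⟩ := Multiset.exists_cons_of_mem hb
        simp only [Multiset.map_cons, Multiset.sum_cons, hba, Multiset.cons_inj_right,
          Multiset.forall_mem_cons] at hv₁ hv₂ hv₃
        have hw := mem_monomialSubst_of_forall hv₃.2
        rw [hv₁] at hw
        set q := (w.map fun b => (φ b).2).sum with hq
        have hb' := hv₃.1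
        set p := (φ b).2 with hp
        -- The part of `t` used by `b` is forced by its origin, and the rest goes to the other
        -- elements.
        rw [Finset.sum_eq_single (p, q)]
        · rw [Multiset.erase_cons_head, mmult_cons, ← hv₂, ← count_antidiagonal p q,
            Multiset.count_cons_self]
          calc _ = Multiset.count (p, q) (p + q).antidiagonal * ((K a p).count b * mult b) *
                  ((monomialSubst (s.map K) q).count w * mmult w) * (w.count b + 1) := by ring
            _ = _ := by
              rw [h.count hs.1 hb', ih hs.2 hw]
              ring
        · rintro ⟨p', q'⟩ hpq hne
          rw [Multiset.mem_toFinset, Multiset.mem_antidiagonal] at hpq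
          rw [Multiset.count_eq_zero_of_notMem (a := b), zero_mul, mul_zero]
          intro hb''
          obtain rfl : p = p' := congrArg Prod.snd (hφ a hs.1 _ _ hb'')
          rw [← hv₂] at hpq
          exact hne (Prod.ext rfl (add_left_cancel hpq))
        · intro hpq
          rw [Multiset.mem_toFinset, Multiset.mem_antidiagonal] at hpq
          exact absurd hv₂ hpq
      · rw [zero_mul, mul_eq_zero]
        refine .inl (Finset.sum_eq_zero fun p _ => ?_)
        rw [Multiset.count_eq_zero_of_notMem (a := b), zero_mul, mul_zero]
        exact fun hb' => hba (by rw [hφ a hs.1 _ _ hb'])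
    rw [Finset.sum_congr rfl key, ← Finset.sum_mul, ← count_map_eq_sum, hv₁,
      Multiset.count_cons_self, mmult_cons]
    ring

theorem Uniform.exists_inverse (h : Uniform mult X Y Z K) :
    ∃ φ : ResTerm → ResTerm × ResMonomial, ∀ s ∈ X, ∀ t, ∀ u ∈ K s t, φ u = (s, t) := by
  have : Nonempty (ResTerm × ResMonomial) := ⟨(var 0, 0)⟩
  refine ⟨fun u => Classical.epsilon fun p => p.1 ∈ X ∧ u ∈ K p.1 p.2, fun s hs t u hu => ?_⟩
  have := Classical.epsilon_spec (p := fun p : ResTerm × ResMonomial => p.1 ∈ X ∧ u ∈ K p.1 p.2)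
    ⟨(s, t), hs, hu⟩
  exact Prod.ext_iff.2 (h.inj this.1 hs this.2 hu)

theorem Uniform.monomial (h : Uniform mult X Y Z K) :
    Uniform mmult (monomials X) (monomials Y) Z fun s => monomialSubst (s.map K) := by
  obtain ⟨φ, hφ⟩ := h.exists_inverse
  refine ⟨?_, ?_, ?_, fun hs hv => h.count_monomialSubst hφ hs hv⟩
  · intro s t v hs ht hv
    induction s using Multiset.induction generalizing t v with
    | empty =>
      rw [Multiset.map_zero, monomialSubst_zero] at hv
      split_ifs at hv
      · obtain rfl := Multiset.mem_singleton.1 hv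
        exact zero_mem_monomials
      · simp at hv
    | cons a s ih =>
      rw [Multiset.map_cons, monomialSubst_cons, mem_conv] at hv
      obtain ⟨p, q, rfl, b, hb, w, hw, rfl⟩ := hv
      rw [monomials_cons] at hs ⊢
      rw [monomials_add] at ht
      exact ⟨h.maps hs.1 ht.1 hb, ih hs.2 ht.2 hw⟩
  · intro v hv
    induction v using Multiset.induction with
    | empty =>
      refine ⟨0, zero_mem_monomials, 0, zero_mem_monomials, ?_⟩
      simp [monomialSubst_zero]
    | cons b v ih =>
      rw [monomials_cons] at hv
      obtain ⟨a, ha, p, hp, hb⟩ := h.surj hv.1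
      obtain ⟨s, hs, q, hq, hv⟩ := ih hv.2
      refine ⟨a ::ₘ s, monomials_cons.2 ⟨ha, hs⟩, p + q, monomials_add.2 ⟨hp, hq⟩, ?_⟩
      rw [Multiset.map_cons, monomialSubst_cons, mem_conv]
      exact ⟨p, q, rfl, b, hb, v, hv, rfl⟩
  · intro s s' t t' v hs hs' hv hv'
    obtain ⟨rfl, rfl, -⟩ := map_of_mem_monomialSubst hφ hs hv
    obtain ⟨rfl, rfl, -⟩ := map_of_mem_monomialSubst hφ hs' hv'
    exact ⟨rfl, rfl⟩

end Monomial

end ResTerm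

/-! ### Coefficients of Taylor expansions -/

namespace Vec

theorem map_eq {X Y : Type} (f : X → Y) (A : Vec X) (y : Y) :
    map f A y = ∑ᶠ x : X, if f x = y then A x else 0 := by
  simp only [map, finsum_eq_if]

theorem map_apply {X Y : Type} {f : X → Y} (hf : Function.Injective f) (A : Vec X) (x : X) :
    map f A (f x) = A x := by
  rw [map_eq, finsum_eq_single _ x]
  · simp
  · intro x' hx'
    rw [if_neg fun h => hx' (hf h)]

theorem map_apply_of_forall_ne {X Y : Type} {f : X → Y} (A : Vec X) {y : Y}
    (hy : ∀ x, f x ≠ y) : map f A y = 0 := by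
  rw [map_eq]
  simp [hy]

theorem map₂_apply {X Y Z : Type} {f : X → Y → Z} (hf : Function.Injective2 f) (A : Vec X)
    (B : Vec Y) (x : X) (y : Y) : map₂ f A B (f x y) = A x * B y :=
  map_apply (f := fun p : X × Y => f p.1 p.2) (fun _ _ h => Prod.ext (hf h).1 (hf h).2) _ (x, y)

theorem map₂_apply_of_forall_ne {X Y Z : Type} {f : X → Y → Z} (A : Vec X) (B : Vec Y) {z : Z}
    (hz : ∀ x y, f x y ≠ z) : map₂ f A B z = 0 :=
  map_apply_of_forall_ne _ fun p => hz p.1 p.2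

/-- The pairs with `s ::ₘ t'` equal to a given monomial correspond to its distinct elements, so the
fibre is finite although `Multiset.cons` is not injective. -/
theorem map₂_cons_apply (S : Vec ResTerm) (P : Vec ResMonomial) (t : ResMonomial) :
    map₂ (fun s t => s ::ₘ t) S P t = ∑ a ∈ t.toFinset, S a * P (t.erase a) := by
  rw [map₂, map_eq, finsum_eq_sum_of_support_subset
    (s := t.toFinset.image fun a => (a, t.erase a))]
  · rw [Finset.sum_image fun a _ b _ h => congrArg Prod.fst h]
    refine Finset.sum_congr rfl fun a ha => ?_
    rw [if_pos (Multiset.cons_erase (Multiset.mem_toFinset.1 ha))]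
  · intro p hp
    have h : p.1 ::ₘ p.2 = t := by
      by_contra h
      simp [h] at hp
    subst h
    simp only [Finset.coe_image, Set.mem_image, Finset.mem_coe, Multiset.mem_toFinset]
    exact ⟨p.1, by simp, by simp⟩

open ResTerm in
-- Removing `a` from `t` divides the multiplicity by `t.count a * mult a`, so each `a` contributes
-- `t.count a` times the same quantity; the counts add up to `n + 1` and turn `n!` into `(n + 1)!`.
theorem monomialPow_apply {S : Vec ResTerm} {X : Set ResTerm}
    (hS : ∀ u, S u = if u ∈ X then (mult u : ℚ≥0)⁻¹ else 0) (n : ℕ) (t : ResMonomial) :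
    monomialPow S n t = if Multiset.card t = n ∧ t ∈ monomials X
      then (Nat.factorial n : ℚ≥0) * (mmult t : ℚ≥0)⁻¹ else 0 := by
  induction n generalizing t with
  | zero =>
    by_cases h : t = 0
    · subst h
      simp [monomialPow, basis, zero_mem_monomials]
    · simp [monomialPow, basis, h]
  | succ n ih =>
    rw [monomialPow, map₂_cons_apply]
    simp only [ih, hS]
    by_cases ht : Multiset.card t = n + 1 ∧ t ∈ monomials X
    · rw [if_pos ht]
      have key : ∀ a ∈ t.toFinset, ((if a ∈ X then (mult a : ℚ≥0)⁻¹ else 0) *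
          if Multiset.card (t.erase a) = n ∧ t.erase a ∈ monomials X
            then (Nat.factorial n : ℚ≥0) * (mmult (t.erase a) : ℚ≥0)⁻¹ else 0)
          = (t.count a : ℚ≥0) * ((Nat.factorial n : ℚ≥0) * (mmult t : ℚ≥0)⁻¹) := by
        intro a ha
        rw [Multiset.mem_toFinset] at ha
        have h₁ : Multiset.card (t.erase a) = n := by
          rw [Multiset.card_erase_of_mem ha, ht.1, Nat.pred_succ]
        have h₂ : t.erase a ∈ monomials X := fun b hb => ht.2 b (Multiset.mem_of_mem_erase hb)
        have h₃ : (mult a : ℚ≥0) ≠ 0 := by exact_mod_cast (mult_pos a).ne'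
        have h₄ : (mmult (t.erase a) : ℚ≥0) ≠ 0 := by exact_mod_cast (mmult_pos _).ne'
        have h₅ : (t.count a : ℚ≥0) ≠ 0 := by exact_mod_cast (Multiset.count_pos.2 ha).ne'
        rw [if_pos (ht.2 a ha), if_pos ⟨h₁, h₂⟩, mmult_of_mem ha]
        push_cast
        field_simp
      rw [Finset.sum_congr rfl key, ← Finset.sum_mul, ← Nat.cast_sum,
        Multiset.toFinset_sum_count_eq, ht.1, Nat.factorial_succ]
      push_cast
      ring
    · rw [if_neg ht]
      refine Finset.sum_eq_zero fun a ha => ?_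
      rw [Multiset.mem_toFinset] at ha
      obtain ⟨t, rfl⟩ := Multiset.exists_cons_of_mem ha
      rw [Multiset.erase_cons_head]
      by_cases h : a ∈ X
      · rw [if_neg (c := Multiset.card t = n ∧ _), mul_zero]
        rintro ⟨h₁, h₂⟩
        exact ht ⟨by simp [h₁], monomials_cons.2 ⟨h, h₂⟩⟩
      · simp [h]

open ResTerm in
theorem promotion_apply {S : Vec ResTerm} {X : Set ResTerm}
    (hS : ∀ u, S u = if u ∈ X then (mult u : ℚ≥0)⁻¹ else 0) (t : ResMonomial) :
    promotion S t = if t ∈ monomials X then (mmult t : ℚ≥0)⁻¹ else 0 := by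
  -- Only the power equal to the cardinality of `t` contains `t`, and its factorial cancels.
  rw [promotion, finsum_eq_single _ (Multiset.card t)]
  · rw [monomialPow_apply hS]
    have : (Nat.factorial (Multiset.card t) : ℚ≥0) ≠ 0 := by
      exact_mod_cast Nat.factorial_ne_zero _
    by_cases h : t ∈ monomials X <;> simp [h, this]
  · intro n hn
    rw [monomialPow_apply hS, if_neg fun h => hn h.1.symm, mul_zero]

end Vec

open ResTerm

/-- The resource terms that approximate a term approximant. -/
def Approx.resSet : Approx → Set ResTerm
  | .bot => ∅
  | .var n => {ResTerm.var n}
  | .lam A => ResTerm.lam '' A.resSet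
  | .app A B => Set.image2 ResTerm.app A.resSet (monomials B.resSet)
  | .plus A B => ResTerm.inl '' A.resSet ∪ ResTerm.inr '' B.resSet

/-- The coefficients of Taylor expansions. -/
theorem Approx.taylor_apply (A : Approx) (u : ResTerm) :
    A.taylor u = if u ∈ A.resSet then (mult u : ℚ≥0)⁻¹ else 0 := by
  induction A generalizing u with
  | bot => simp [taylor, resSet]
  | var n =>
    simp only [taylor, resSet, Vec.basis, Set.mem_singleton_iff]
    split_ifs with h <;> simp [h]
  | lam A ih =>
    simp only [taylor, resSet]
    by_cases h : ∃ s, ResTerm.lam s = u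
    · obtain ⟨s, rfl⟩ := h
      rw [Vec.map_apply fun _ _ h => lam_inj.1 h, ih]
      simp
    · rw [Vec.map_apply_of_forall_ne _ (by simpa using h)]
      refine (if_neg ?_).symm
      exact fun ⟨s, _, hs⟩ => h ⟨s, hs⟩
  | app A B ihA ihB =>
    simp only [taylor, resSet]
    by_cases h : ∃ s t, ResTerm.app s t = u
    · obtain ⟨s, t, rfl⟩ := h
      rw [Vec.map₂_apply fun _ _ _ _ h => app_inj.1 h, ihA, Vec.promotion_apply ihB, mult_app_eq]
      have e : ResTerm.app s t ∈ Set.image2 ResTerm.app A.resSet (monomials B.resSet)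
          ↔ s ∈ A.resSet ∧ t ∈ monomials B.resSet := by
        simp [Set.mem_image2]
      by_cases hs : s ∈ A.resSet <;> by_cases ht : t ∈ monomials B.resSet <;>
        simp [hs, ht, e, mul_comm]
    · rw [Vec.map₂_apply_of_forall_ne _ _ (by simpa using h)]
      refine (if_neg ?_).symm
      exact fun ⟨s, _, t, _, hs⟩ => h ⟨s, t, hs⟩
  | plus A B ihA ihB =>
    simp only [taylor, resSet, Pi.add_apply]
    by_cases h : ∃ s, ResTerm.inl s = u
    · obtain ⟨s, rfl⟩ := h
      rw [Vec.map_apply fun _ _ h => inl_inj.1 h, ihA, Vec.map_apply_of_forall_ne _ (by simp)]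
      simp
    · rw [Vec.map_apply_of_forall_ne (f := ResTerm.inl) _ (by simpa using h)]
      by_cases h' : ∃ s, ResTerm.inr s = u
      · obtain ⟨s, rfl⟩ := h'
        rw [Vec.map_apply fun _ _ h => inr_inj.1 h, ihB]
        simp
      · rw [Vec.map_apply_of_forall_ne _ (by simpa using h'), add_zero]
        refine (if_neg ?_).symm
        rintro (⟨s, _, hs⟩ | ⟨s, _, hs⟩)
        exacts [h ⟨s, hs⟩, h' ⟨s, hs⟩]

theorem Approx.taylorSupport_eq (A : Approx) : A.taylorSupport = A.resSet := by
  ext u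
  have : (mult u : ℚ≥0) ≠ 0 := by exact_mod_cast (mult_pos u).ne'
  simp [taylorSupport, taylor_apply, this]

theorem Approx.Le.resSet_subset {A B : Approx} (h : A.Le B) : A.resSet ⊆ B.resSet := by
  induction h with
  | bot A => exact Set.empty_subset _
  | refl A => exact subset_rfl
  | trans _ _ h h' => exact h.trans h'
  | lam _ h => exact Set.image_mono h
  | app _ _ h h' => exact Set.image2_subset h fun t ht a ha => h' (ht a ha)
  | plus _ _ h h' => exact Set.union_subset_union (Set.image_mono h) (Set.image_mono h')

/-- The resource terms that approximate a term. -/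
def Term.resSet (M : Term) : Set ResTerm := M.toApprox.resSet

namespace Term

theorem taylorSupport_eq (M : Term) : M.taylorSupport = M.resSet := M.toApprox.taylorSupport_eq

@[simp] theorem resSet_var (n : ℕ) : resSet (var n) = {ResTerm.var n} := rfl
@[simp] theorem resSet_lam (M : Term) : resSet (lam M) = ResTerm.lam '' M.resSet := rfl
@[simp] theorem resSet_app (M N : Term) :
    resSet (app M N) = Set.image2 ResTerm.app M.resSet (monomials N.resSet) := rfl
@[simp] theorem resSet_plus (M N : Term) :
    resSet (plus M N) = ResTerm.inl '' M.resSet ∪ ResTerm.inr '' N.resSet := rfl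

theorem monomials_image (f : ResTerm → ResTerm) (X : Set ResTerm) :
    monomials (f '' X) = Multiset.map f '' monomials X := by
  ext t
  constructor
  · intro h
    induction t using Multiset.induction with
    | empty => exact ⟨0, zero_mem_monomials, rfl⟩
    | cons a t ih =>
      rw [monomials_cons] at h
      obtain ⟨b, hb, rfl⟩ := h.1
      obtain ⟨t, ht, rfl⟩ := ih h.2
      exact ⟨b ::ₘ t, monomials_cons.2 ⟨hb, ht⟩, by simp⟩
  · rintro ⟨t, ht, rfl⟩ a ha
    obtain ⟨b, hb, rfl⟩ := Multiset.mem_map.1 ha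
    exact ⟨b, ht b hb, rfl⟩

theorem resSet_shift (M : Term) (c : ℕ) : (M.shift c).resSet = ResTerm.shift c '' M.resSet := by
  induction M generalizing c with
  | var n => simp [shift]
  | lam M ih => simp [shift, ih, Set.image_image]
  | app M N ihM ihN =>
    simp only [shift, resSet_app, ihM, ihN, monomials_image, Set.image2_image_left,
      Set.image2_image_right, Set.image_image2, shift_app]
  | plus M N ihM ihN => simp [shift, ihM, ihN, Set.image_image, Set.image_union]

end Term

/-! ### Substitution is uniform -/

namespace ResTerm

theorem Uniform.map {X Y Z : Set ResTerm} {K L : ResTerm → ResMonomial → ResSum}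
    (h : Uniform mult X Y Z K) {f : ResTerm → ResTerm} (hf : Function.Injective f)
    (hm : ∀ s, mult (f s) = mult s) (hL : ∀ s ∈ X, ∀ t, L (f s) t = (K s t).map f) :
    Uniform mult (f '' X) (f '' Y) Z L where
  maps := by
    rintro _ t u ⟨s, hs, rfl⟩ ht hu
    rw [hL s hs] at hu
    obtain ⟨v, hv, rfl⟩ := Multiset.mem_map.1 hu
    exact ⟨v, h.maps hs ht hv, rfl⟩
  surj := by
    rintro _ ⟨v, hv, rfl⟩
    obtain ⟨s, hs, t, ht, hv⟩ := h.surj hv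
    exact ⟨_, ⟨s, hs, rfl⟩, t, ht, by rw [hL s hs]; exact Multiset.mem_map_of_mem f hv⟩
  inj := by
    rintro _ _ t t' u ⟨s, hs, rfl⟩ ⟨s', hs', rfl⟩ hu hu'
    rw [hL s hs] at hu
    rw [hL s' hs'] at hu'
    obtain ⟨v, hv, rfl⟩ := Multiset.mem_map.1 hu
    rw [Multiset.mem_map_of_injective hf] at hu'
    obtain ⟨rfl, rfl⟩ := h.inj hs hs' hv hu'
    exact ⟨rfl, rfl⟩
  count := by
    rintro _ t u ⟨s, hs, rfl⟩ hu
    rw [hL s hs] at hu ⊢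
    obtain ⟨v, hv, rfl⟩ := Multiset.mem_map.1 hu
    rw [Multiset.count_map_eq_count' _ _ hf, hm, hm, h.count hs hv]

/-- The disjointness hypothesis secures unique origins across the two pieces; for sums it holds
because the injections keep left and right apart. -/
theorem Uniform.union {X Y X' Y' Z : Set ResTerm} {K : ResTerm → ResMonomial → ResSum}
    (h : Uniform mult X Y Z K) (h' : Uniform mult X' Y' Z K)
    (hd : ∀ s ∈ X, ∀ s' ∈ X', ∀ t t' u, u ∈ K s t → u ∉ K s' t') :
    Uniform mult (X ∪ X') (Y ∪ Y') Z K where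
  maps := by
    rintro s t u (hs | hs) ht hu
    exacts [.inl (h.maps hs ht hu), .inr (h'.maps hs ht hu)]
  surj := by
    rintro u (hu | hu)
    · obtain ⟨s, hs, h⟩ := h.surj hu
      exact ⟨s, .inl hs, h⟩
    · obtain ⟨s, hs, h⟩ := h'.surj hu
      exact ⟨s, .inr hs, h⟩
  inj := by
    rintro s s' t t' u (hs | hs) (hs' | hs') hu hu'
    · exact h.inj hs hs' hu hu'
    · exact absurd hu' (hd _ hs _ hs' _ _ _ hu)
    · exact absurd hu (hd _ hs' _ hs _ _ _ hu')
    · exact h'.inj hs hs' hu hu'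
  count := by
    rintro s t u (hs | hs) hu
    exacts [h.count hs hu, h'.count hs hu]

theorem Uniform.plus {X Y X' Y' Z : Set ResTerm} {K K' L : ResTerm → ResMonomial → ResSum}
    (h : Uniform mult X Y Z K) (h' : Uniform mult X' Y' Z K')
    (hl : ∀ s ∈ X, ∀ t, L (inl s) t = (K s t).map inl)
    (hr : ∀ s ∈ X', ∀ t, L (inr s) t = (K' s t).map inr) :
    Uniform mult (inl '' X ∪ inr '' X') (inl '' Y ∪ inr '' Y') Z L := by
  refine (h.map (fun _ _ => inl_inj.1) mult_inl hl).union
    (h'.map (fun _ _ => inr_inj.1) mult_inr hr) ?_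
  rintro _ ⟨s, hs, rfl⟩ _ ⟨s', hs', rfl⟩ t t' u hu hu'
  rw [hl s hs] at hu
  rw [hr s' hs'] at hu'
  obtain ⟨v, -, rfl⟩ := Multiset.mem_map.1 hu
  simp at hu'

/-- Under an abstraction the substituted monomial is shifted; this is harmless since shifting is
injective and preserves multiplicities. -/
theorem Uniform.shift {X Y Z : Set ResTerm} {K : ResTerm → ResMonomial → ResSum} {c : ℕ}
    (h : Uniform mult X Y (shift c '' Z) K) :
    Uniform mult X Y Z fun s t => K s (t.map (shift c)) where
  maps hs ht hu := by
    refine h.maps hs ?_ hu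
    rw [Term.monomials_image]
    exact ⟨_, ht, rfl⟩
  surj hu := by
    obtain ⟨s, hs, t, ht, hu⟩ := h.surj hu
    rw [Term.monomials_image] at ht
    obtain ⟨t, ht, rfl⟩ := ht
    exact ⟨s, hs, t, ht, hu⟩
  inj hs hs' hu hu' := by
    obtain ⟨h₁, h₂⟩ := h.inj hs hs' hu hu'
    exact ⟨h₁, Multiset.map_injective (shift_injective c) h₂⟩
  count hs hu := by
    rw [h.count hs hu, mmult_map_shift]

/-- Induction on `M`, whose syntax tells which parts of an approximant of `M[N/k]` come from `M` and
which from `N`. This is why origins are unique, a property that fails for arbitrary resource terms.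
-/
theorem uniform_subst (M N : Term) (k : ℕ) :
    Uniform mult M.resSet (Term.subst k N M).resSet N.resSet (subst k) := by
  induction M generalizing N k with
  | var n =>
    by_cases hn : n = k
    -- The variable being replaced: `u` can only come from the singleton monomial `{u}`.
    · have e : ∀ t, subst k (var n) t = if Multiset.card t = 1 then t else 0 := fun t => by
        rw [subst_var, if_pos hn]
      have hmem : ∀ {t u}, u ∈ subst k (var n) t → t = {u} := by
        intro t u hu
        rw [e] at hu
        split_ifs at hu with h
        · obtain ⟨a, rfl⟩ := Multiset.card_eq_one.1 h
          rw [Multiset.mem_singleton.1 hu]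
        · simp at hu
      rw [Term.subst, if_pos hn]
      refine ⟨?_, ?_, ?_, ?_⟩
      · rintro _ t u rfl ht hu
        exact ht u (by simp [hmem hu])
      · intro u hu
        exact ⟨_, rfl, {u}, by simpa [monomials] using hu, by simp [e]⟩
      · rintro _ _ t t' u rfl rfl hu hu'
        exact ⟨rfl, (hmem hu).trans (hmem hu').symm⟩
      · rintro _ t u rfl hu
        obtain rfl := hmem hu
        simp [e, mmult]
    -- Any other variable: the monomial must be empty.
    · have e : ∀ t, subst k (var n) t
          = if t = 0 then {var (if n < k then n else n - 1)} else 0 := fun t => by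
        rw [subst_var, if_neg hn]
        simp
      have hmem : ∀ {t u}, u ∈ subst k (var n) t → t = 0 ∧ u = var (if n < k then n else n - 1) := by
        intro t u hu
        rw [e] at hu
        split_ifs at hu ⊢ with h <;> simp_all
      rw [Term.subst, if_neg hn]
      refine ⟨?_, ?_, ?_, ?_⟩
      · rintro _ t u rfl ht hu
        exact (hmem hu).2
      · rintro u rfl
        exact ⟨_, rfl, 0, zero_mem_monomials, by simp [e]⟩
      · rintro _ _ t t' u rfl rfl hu hu'
        exact ⟨rfl, (hmem hu).1.trans (hmem hu').1.symm⟩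
      · rintro _ t u rfl hu
        obtain ⟨rfl, rfl⟩ := hmem hu
        simp [e]
  | lam M ih =>
    have := ih (N.shift 0) (k + 1)
    rw [Term.resSet_shift] at this
    exact this.shift.map (fun _ _ => lam_inj.1) mult_lam fun s _ t => subst_lam k s t
  | app M P ihM ihP =>
    exact (ihM N k).app (ihP N k).monomial fun s _ t => subst_app k s t
  | plus M P ihM ihP =>
    exact (ihM N k).plus (ihP N k) (fun s _ t => subst_inl k s t) fun s _ t => subst_inr k s t

end ResTerm

namespace ResTerm

/-! ### Irreducible resource terms -/

theorem irreducible_var (n : ℕ) : Irreducible (var n) := not_red_var n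

theorem irreducible_inl {s : ResTerm} : Irreducible (inl s) ↔ Irreducible s := by
  refine ⟨fun h S hS => h _ hS.inl, fun h S hS => ?_⟩
  obtain ⟨S, hS', rfl⟩ := red_inl hS
  exact h _ hS'

theorem irreducible_inr {s : ResTerm} : Irreducible (inr s) ↔ Irreducible s := by
  refine ⟨fun h S hS => h _ hS.inr, fun h S hS => ?_⟩
  obtain ⟨S, hS', rfl⟩ := red_inr hS
  exact h _ hS'

theorem irreducible_lam {s : ResTerm} :
    Irreducible (lam s) ↔ Irreducible s ∧ (∀ r, s ≠ inl r) ∧ ∀ r, s ≠ inr r := by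
  refine ⟨fun h => ⟨fun S hS => h _ hS.lam, ?_, ?_⟩, fun ⟨h, hl, hr⟩ S hS => ?_⟩
  · rintro r rfl
    exact h _ (Red.lamInl r)
  · rintro r rfl
    exact h _ (Red.lamInr r)
  · rcases red_lam hS with hS' | ⟨S, hS', rfl⟩
    · generalize hx : lam s = x at hS'
      cases hS' <;> simp_all
    · exact h _ hS'

theorem irreducible_app {s : ResTerm} {t : ResMonomial} :
    Irreducible (app s t) ↔ Irreducible s ∧ (∀ r, s ≠ lam r) ∧ (∀ r, s ≠ inl r) ∧
      (∀ r, s ≠ inr r) ∧ ∀ u ∈ t, Irreducible u := by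
  refine ⟨fun h => ⟨fun S hS => h _ (hS.appFun t), ?_, ?_, ?_, ?_⟩,
    fun ⟨h, hb, hl, hr, ht⟩ S hS => ?_⟩
  · rintro r rfl
    exact h _ (Red.beta r t)
  · rintro r rfl
    exact h _ (Red.appInl r t)
  · rintro r rfl
    exact h _ (Red.appInr r t)
  · intro u hu S hS
    obtain ⟨t, rfl⟩ := Multiset.exists_cons_of_mem hu
    exact h _ (hS.appArg s t)
  · rcases red_app hS with hS' | ⟨S, hS', rfl⟩ | ⟨a, A, u, rfl, hS', rfl⟩
    · generalize hx : app s t = x at hS'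
      cases hS' <;> simp_all
    · exact h _ hS'
    · exact ht a (by simp) _ hS'

end ResTerm

open ResTerm

-- Elementary Böhm trees and normal approximants

namespace Term

/-- An irreducible application has an irreducible function part that is again neither an abstraction
nor an injection, so the spine ends in a variable; `M` has the same spine. -/
theorem isNeutral_of_irreducible {M : Term} {s : ResTerm} (hs : s ∈ M.resSet) (h : Irreducible s)
    (hb : ∀ r, s ≠ ResTerm.lam r) (hl : ∀ r, s ≠ inl r) (hr : ∀ r, s ≠ inr r) : M.isNeutral := by
  induction M generalizing s with
  | var n => rfl
  | lam M ih =>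
    obtain ⟨r, _, rfl⟩ := hs
    exact absurd rfl (hb r)
  | app M N ihM ihN =>
    obtain ⟨r, hrM, t, ht, rfl⟩ := hs
    obtain ⟨h₁, h₂, h₃, h₄, -⟩ := irreducible_app.1 h
    exact ihM hrM h₁ h₂ h₃ h₄
  | plus M N ihM ihN =>
    rcases hs with ⟨r, _, rfl⟩ | ⟨r, _, rfl⟩
    exacts [absurd rfl (hl r), absurd rfl (hr r)]

theorem isHeadNormal_of_irreducible {M : Term} {s : ResTerm} (hs : s ∈ M.resSet)
    (h : Irreducible s) (hl : ∀ r, s ≠ inl r) (hr : ∀ r, s ≠ inr r) : M.isHeadNormal := by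
  induction M generalizing s with
  | var n => rfl
  | lam M ih =>
    obtain ⟨r, hrM, rfl⟩ := hs
    obtain ⟨h₁, h₂, h₃⟩ := irreducible_lam.1 h
    exact ih hrM h₁ h₂ h₃
  | app M N ihM ihN =>
    refine isNeutral_of_irreducible hs h ?_ hl hr
    obtain ⟨r, hr, t, ht, rfl⟩ := hs
    simp
  | plus M N ihM ihN =>
    rcases hs with ⟨r, _, rfl⟩ | ⟨r, _, rfl⟩
    exacts [absurd rfl (hl r), absurd rfl (hr r)]

theorem ne_of_mem_resSet_of_isNeutral {M : Term} (hM : M.isNeutral) {s : ResTerm}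
    (hs : s ∈ M.resSet) : (∀ r, s ≠ ResTerm.lam r) ∧ (∀ r, s ≠ inl r) ∧ ∀ r, s ≠ inr r := by
  cases M with
  | var n =>
    obtain rfl := Set.mem_singleton_iff.1 hs
    simp
  | app M N =>
    obtain ⟨r, hr, t, ht, rfl⟩ := hs
    simp
  | _ => simp [isNeutral] at hM

theorem ne_of_mem_resSet_of_isHeadNormal {M : Term} (hM : M.isHeadNormal) {s : ResTerm}
    (hs : s ∈ M.resSet) : (∀ r, s ≠ inl r) ∧ ∀ r, s ≠ inr r := by
  cases M with
  | lam M =>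
    obtain ⟨r, hr, rfl⟩ := hs
    simp
  | plus M N => simp [isHeadNormal, isNeutral] at hM
  | _ => exact (ne_of_mem_resSet_of_isNeutral hM hs).2

/-- With the converse `of_mem_resSet_eBT`, this shows that the approximants of `eBT M` are exactly
the normal approximants of `M`: a subterm cut to `⊥` has only reducible ones. -/
theorem mem_resSet_eBT_of_irreducible {M : Term} {s : ResTerm} (hs : s ∈ M.resSet)
    (h : Irreducible s) : s ∈ M.eBT.resSet := by
  induction M generalizing s with
  | var n => exact hs
  | lam M ih =>
    obtain ⟨r, hr, rfl⟩ := hs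
    obtain ⟨h₁, h₂, h₃⟩ := irreducible_lam.1 h
    rw [eBT, if_pos (isHeadNormal_of_irreducible hr h₁ h₂ h₃)]
    exact ⟨r, ih hr h₁, rfl⟩
  | app M N ihM ihN =>
    obtain ⟨r, hr, t, ht, rfl⟩ := hs
    obtain ⟨h₁, h₂, h₃, h₄, h₅⟩ := irreducible_app.1 h
    rw [eBT, if_pos (isNeutral_of_irreducible hr h₁ h₂ h₃ h₄)]
    exact ⟨r, ihM hr h₁, t, fun a ha => ihN (ht a ha) (h₅ a ha), rfl⟩
  | plus M N ihM ihN =>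
    rcases hs with ⟨r, hr, rfl⟩ | ⟨r, hr, rfl⟩
    · exact .inl ⟨r, ihM hr (irreducible_inl.1 h), rfl⟩
    · exact .inr ⟨r, ihN hr (irreducible_inr.1 h), rfl⟩

theorem of_mem_resSet_eBT {M : Term} {s : ResTerm} (hs : s ∈ M.eBT.resSet) :
    s ∈ M.resSet ∧ Irreducible s := by
  induction M generalizing s with
  | var n =>
    obtain rfl := Set.mem_singleton_iff.1 hs
    exact ⟨hs, irreducible_var n⟩
  | lam M ih =>
    rw [eBT] at hs
    split_ifs at hs with hM
    · obtain ⟨r, hr, rfl⟩ := hs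
      obtain ⟨h₁, h₂⟩ := ih hr
      exact ⟨⟨r, h₁, rfl⟩, irreducible_lam.2 ⟨h₂, ne_of_mem_resSet_of_isHeadNormal hM h₁⟩⟩
    · exact hs.elim
  | app M N ihM ihN =>
    rw [eBT] at hs
    split_ifs at hs with hM
    · obtain ⟨r, hr, t, ht, rfl⟩ := hs
      obtain ⟨h₁, h₂⟩ := ihM hr
      obtain ⟨h₃, h₄, h₅⟩ := ne_of_mem_resSet_of_isNeutral hM h₁
      exact ⟨⟨r, h₁, t, fun a ha => (ihN (ht a ha)).1, rfl⟩,
        irreducible_app.2 ⟨h₂, h₃, h₄, h₅, fun a ha => (ihN (ht a ha)).2⟩⟩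
    · exact hs.elim
  | plus M N ihM ihN =>
    rcases hs with ⟨r, hr, rfl⟩ | ⟨r, hr, rfl⟩
    · obtain ⟨h₁, h₂⟩ := ihM hr
      exact ⟨.inl ⟨r, h₁, rfl⟩, irreducible_inl.2 h₂⟩
    · obtain ⟨h₁, h₂⟩ := ihN hr
      exact ⟨.inr ⟨r, h₁, rfl⟩, irreducible_inr.2 h₂⟩

theorem _root_.NDLambda.Approx.apps_append (A B : Approx) (Ns : List Approx) :
    Approx.apps A (Ns ++ [B]) = Approx.app (Approx.apps A Ns) B := by
  induction Ns generalizing A with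
  | nil => rfl
  | cons N Ns ih => exact ih _

theorem isElementary_eBT (M : Term) : M.eBT.IsElementary := by
  -- The list of arguments and the number of abstractions are carried along, since `IsElementary`
  -- builds a whole head normal form at once.
  suffices h : (M.isNeutral → ∃ x Ns, (∀ N ∈ Ns, Approx.IsElementary N) ∧
      M.eBT = Approx.apps (.var x) Ns) ∧ (M.isHeadNormal → ∃ n x Ns,
      (∀ N ∈ Ns, Approx.IsElementary N) ∧ M.eBT = Approx.lams n (Approx.apps (.var x) Ns)) ∧
      M.eBT.IsElementary from h.2.2
  induction M with
  | var n =>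
    exact ⟨fun _ => ⟨n, [], by simp, rfl⟩, fun _ => ⟨0, n, [], by simp, rfl⟩,
      .head 0 n [] (by simp)⟩
  | lam M ih =>
    have h : (lam M).isHeadNormal → ∃ n x Ns, (∀ N ∈ Ns, Approx.IsElementary N) ∧
        (lam M).eBT = Approx.lams n (Approx.apps (.var x) Ns) := by
      intro hM
      obtain ⟨n, x, Ns, hNs, h⟩ := ih.2.1 hM
      refine ⟨n + 1, x, Ns, hNs, ?_⟩
      rw [isHeadNormal] at hM
      rw [eBT, if_pos hM, h, Approx.lams]
    refine ⟨by simp [isNeutral], h, ?_⟩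
    by_cases hM : M.isHeadNormal
    · obtain ⟨n, x, Ns, hNs, h⟩ := h hM
      rw [h]
      exact .head n x Ns hNs
    · rw [eBT, if_neg hM]
      exact .bot
  | app M N ihM ihN =>
    have h : (app M N).isNeutral → ∃ x Ns, (∀ N ∈ Ns, Approx.IsElementary N) ∧
        (app M N).eBT = Approx.apps (.var x) Ns := by
      intro hM
      obtain ⟨x, Ns, hNs, h⟩ := ihM.1 hM
      refine ⟨x, Ns ++ [N.eBT], ?_, ?_⟩
      · intro A hA
        rcases List.mem_append.1 hA with hA | hA
        · exact hNs A hA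
        · rw [List.mem_singleton.1 hA]
          exact ihN.2.2
      · rw [isNeutral] at hM
        rw [eBT, if_pos hM, h, Approx.apps_append]
    refine ⟨h, fun hM => ⟨0, h hM⟩, ?_⟩
    by_cases hM : M.isNeutral
    · obtain ⟨x, Ns, hNs, h⟩ := h hM
      rw [h]
      exact .head 0 x Ns hNs
    · rw [eBT, if_neg hM]
      exact .bot
  | plus M N ihM ihN =>
    exact ⟨by simp [isNeutral], by simp [isHeadNormal, isNeutral], .plus ihM.2.2 ihN.2.2⟩

end Term

/-! ### Hereditary head reduction of resource terms -/

namespace ResTerm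

/-- Functions given by clauses on the outermost constructor; it serves to define kernels on
approximants of a known shape, with arbitrary values elsewhere. -/
theorem exists_casesOn {β : Type} (fv : ℕ → β) (fl : ResTerm → β) (fa : ResTerm → ResMonomial → β)
    (fi fr : ResTerm → β) : ∃ f : ResTerm → β, (∀ n, f (var n) = fv n) ∧ (∀ s, f (lam s) = fl s) ∧
      (∀ s t, f (app s t) = fa s t) ∧ (∀ s, f (inl s) = fi s) ∧ ∀ s, f (inr s) = fr s := by
  refine ⟨fun s => match view s with
    | .var n => fv n
    | .lam s => fl s
    | .app s t => fa s t
    | .inl s => fi s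
    | .inr s => fr s, ?_⟩
  simp [view_var, view_lam, view_app, view_inl, view_inr]

/-- The function `K`, taken on the empty monomial, reduces the approximants of `M` to
approximants of `M'`, in a uniform way. -/
structure IsHeadStep (M M' : Term) (K : ResTerm → ResMonomial → ResSum) : Prop where
  uniform : Uniform mult M.resSet M'.resSet ∅ K
  steps : ∀ s ∈ M.resSet, Steps Red {s} (K s 0)
  smaller : ∀ s ∈ M.resSet, ∀ u ∈ K s 0, u = s ∧ Irreducible s ∨ Smaller u s

theorem monomials_empty {t : ResMonomial} : t ∈ monomials ∅ ↔ t = 0 :=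
  ⟨fun h => Multiset.eq_zero_of_forall_notMem fun a ha => h a ha,
    fun h => h ▸ zero_mem_monomials⟩

/-- The kernel that applies a function to terms. -/
noncomputable def pureKernel (f : ResTerm → ResTerm) (s : ResTerm) (t : ResMonomial) : ResSum :=
  if t = 0 then {f s} else 0

theorem mem_pureKernel {f : ResTerm → ResTerm} {s u : ResTerm} {t : ResMonomial} :
    u ∈ pureKernel f s t ↔ t = 0 ∧ u = f s := by
  rw [pureKernel]
  split_ifs with h <;> simp [h]

theorem uniform_pureKernel {X Y : Set ResTerm} {f : ResTerm → ResTerm} (hf : Set.InjOn f X)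
    (hY : f '' X = Y) (hm : ∀ s ∈ X, mult (f s) = mult s) :
    Uniform mult X Y ∅ (pureKernel f) where
  maps hs _ hu := by
    rw [(mem_pureKernel.1 hu).2, ← hY]
    exact ⟨_, hs, rfl⟩
  surj hu := by
    rw [← hY] at hu
    obtain ⟨s, hs, rfl⟩ := hu
    exact ⟨s, hs, 0, zero_mem_monomials, mem_pureKernel.2 ⟨rfl, rfl⟩⟩
  inj hs hs' hu hu' := by
    rw [mem_pureKernel] at hu hu'
    exact ⟨hf hs hs' (hu.2.symm.trans hu'.2), hu.1.trans hu'.1.symm⟩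
  count hs hu := by
    obtain ⟨rfl, rfl⟩ := mem_pureKernel.1 hu
    simp [pureKernel, hm _ hs]

/-- The case of steps with a single summand of the same multiplicity, as when an injection is moved
outwards. -/
theorem isHeadStep_pureKernel {M M' : Term} {f : ResTerm → ResTerm} (hf : Set.InjOn f M.resSet)
    (hM' : f '' M.resSet = M'.resSet) (hm : ∀ s ∈ M.resSet, mult (f s) = mult s)
    (hr : ∀ s ∈ M.resSet, f s = s ∧ Irreducible s ∨ Red s {f s}) :
    IsHeadStep M M' (pureKernel f) where
  uniform := uniform_pureKernel hf hM' hm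
  steps s hs := by
    rw [pureKernel, if_pos rfl]
    rcases hr s hs with ⟨h, -⟩ | h
    exacts [Steps.of_eq (by rw [h]), Steps.single h]
  smaller s hs u hu := by
    obtain ⟨-, rfl⟩ := mem_pureKernel.1 hu
    rcases hr s hs with h | h
    exacts [.inl h, .inr (h.smaller _ (by simp))]

theorem exists_isHeadStep_lam_plus (M N : Term) :
    ∃ K, IsHeadStep (.lam (.plus M N)) (.plus (.lam M) (.lam N)) K := by
  -- The function `f` strips the abstraction and `g` examines the injection below it.
  obtain ⟨g, -, -, -, hg₁, hg₂⟩ := exists_casesOn var lam app (fun s => inl (lam s))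
    fun s => inr (lam s)
  obtain ⟨f, -, hf, -⟩ := exists_casesOn var g app inl inr
  refine ⟨_, isHeadStep_pureKernel (f := f) ?_ ?_ ?_ ?_⟩
  · rintro _ ⟨_, ⟨s, hs, rfl⟩ | ⟨s, hs, rfl⟩, rfl⟩ _ ⟨_, ⟨s', hs', rfl⟩ | ⟨s', hs', rfl⟩, rfl⟩ <;>
      simp [hf, hg₁, hg₂]
  · simp [Set.image_union, Set.image_image, hf, hg₁, hg₂]
  · rintro _ ⟨_, ⟨s, hs, rfl⟩ | ⟨s, hs, rfl⟩, rfl⟩ <;> simp [hf, hg₁, hg₂]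
  · rintro _ ⟨_, ⟨s, hs, rfl⟩ | ⟨s, hs, rfl⟩, rfl⟩ <;> right <;> simp only [hf, hg₁, hg₂]
    exacts [.lamInl s, .lamInr s]

theorem exists_isHeadStep_app_plus (M N P : Term) :
    ∃ K, IsHeadStep (.app (.plus M N) P) (.plus (.app M P) (.app N P)) K := by
  choose g hg using fun t => exists_casesOn var lam app (fun s => inl (app s t))
    fun s => inr (app s t)
  have hg₁ := fun t s => (hg t).2.2.2.1 s
  have hg₂ := fun t s => (hg t).2.2.2.2 s
  obtain ⟨f, -, -, hf, -⟩ := exists_casesOn var lam (fun s t => g t s) inl inr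
  refine ⟨_, isHeadStep_pureKernel (f := f) ?_ ?_ ?_ ?_⟩
  · rintro _ ⟨_, ⟨s, hs, rfl⟩ | ⟨s, hs, rfl⟩, t, ht, rfl⟩
      _ ⟨_, ⟨s', hs', rfl⟩ | ⟨s', hs', rfl⟩, t', ht', rfl⟩ <;> simp [hf, hg₁, hg₂]
  · simp [Set.image_union, Set.image_image2, Set.image2_union_left, Set.image2_image_left, hf, hg₁,
      hg₂]
  · rintro _ ⟨_, ⟨s, hs, rfl⟩ | ⟨s, hs, rfl⟩, t, ht, rfl⟩ <;> simp [hf, hg₁, hg₂, mult_app_eq]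
  · rintro _ ⟨_, ⟨s, hs, rfl⟩ | ⟨s, hs, rfl⟩, t, ht, rfl⟩ <;> right <;> simp only [hf, hg₁, hg₂]
    exacts [.appInl s t, .appInr s t]

theorem exists_isHeadStep_var (n : ℕ) : ∃ K, IsHeadStep (.var n) (.var n) K :=
  ⟨_, isHeadStep_pureKernel (f := id) (Set.injOn_id _) (Set.image_id _) (fun _ _ => rfl)
    (by simp [irreducible_var])⟩

/-- The pair `(s, t)` of `uniform_subst` is packed into the term `⟨λ s⟩ t`, whose multiplicity is
`mult s * mmult t`; no external monomial remains. -/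
theorem exists_isHeadStep_beta (M N : Term) :
    ∃ K, IsHeadStep (.app (.lam M) N) (Term.subst 0 N M) K := by
  obtain ⟨g, -, hg, -⟩ := exists_casesOn (fun _ _ => 0) (fun s t => subst 0 s t) (fun _ _ _ => 0)
    (fun _ _ => 0) fun _ _ => 0
  obtain ⟨f, -, -, hf, -⟩ := exists_casesOn (fun _ _ => 0) (fun _ _ => 0)
    (fun s t (u : ResMonomial) => if u = 0 then g s t else 0) (fun _ _ => 0)
    fun _ _ => (0 : ResSum)
  have h := uniform_subst M N 0
  have hmem : ∀ {s t u v}, v ∈ f (app (lam s) t) u → u = 0 ∧ v ∈ subst 0 s t := by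
    intro s t u v hv
    simp only [hf, hg] at hv
    split_ifs at hv with hu
    exacts [⟨hu, hv⟩, by simp at hv]
  have h₀ : ∀ s t, f (app (lam s) t) 0 = subst 0 s t := fun s t => by simp [hf, hg]
  refine ⟨f, ⟨?_, ?_, ?_, ?_⟩, ?_, ?_⟩
  · rintro _ u v ⟨_, ⟨s, hs, rfl⟩, t, ht, rfl⟩ - hv
    exact h.maps hs ht (hmem hv).2
  · intro v hv
    obtain ⟨s, hs, t, ht, hv⟩ := h.surj hv
    exact ⟨_, ⟨_, ⟨s, hs, rfl⟩, t, ht, rfl⟩, 0, zero_mem_monomials, by rwa [h₀]⟩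
  · rintro _ _ u u' v ⟨_, ⟨s, hs, rfl⟩, t, ht, rfl⟩ ⟨_, ⟨s', hs', rfl⟩, t', ht', rfl⟩ hv hv'
    obtain ⟨rfl, h₁⟩ := hmem hv
    obtain ⟨rfl, h₂⟩ := hmem hv'
    obtain ⟨rfl, rfl⟩ := h.inj hs hs' h₁ h₂
    exact ⟨rfl, rfl⟩
  · rintro _ u v ⟨_, ⟨s, hs, rfl⟩, t, ht, rfl⟩ hv
    obtain ⟨rfl, h₁⟩ := hmem hv
    rw [h₀, h.count hs h₁, mult_app_eq, mult_lam, mmult_zero, mul_one]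
  · rintro _ ⟨_, ⟨s, hs, rfl⟩, t, ht, rfl⟩
    rw [h₀]
    exact Steps.single (Red.beta s t)
  · rintro _ ⟨_, ⟨s, hs, rfl⟩, t, ht, rfl⟩ u hu
    rw [h₀] at hu
    exact .inr ((Red.beta s t).smaller u hu)

theorem IsHeadStep.plus {M M' N N' : Term} {K L : ResTerm → ResMonomial → ResSum}
    (h : IsHeadStep M M' K) (h' : IsHeadStep N N' L) :
    ∃ F, IsHeadStep (.plus M N) (.plus M' N') F := by
  obtain ⟨f, -, -, -, hl, hr⟩ := exists_casesOn (fun _ _ => 0) (fun _ _ => 0) (fun _ _ _ => 0)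
    (fun s t => (K s t).map inl) fun s t => (L s t).map inr
  replace hl : ∀ s t, f (inl s) t = (K s t).map inl := fun s t => by rw [hl]
  replace hr : ∀ s t, f (inr s) t = (L s t).map inr := fun s t => by rw [hr]
  refine ⟨f, h.uniform.plus h'.uniform (fun s _ => hl s) fun s _ => hr s, ?_, ?_⟩
  · rintro _ (⟨s, hs, rfl⟩ | ⟨s, hs, rfl⟩)
    · rw [hl, ← Multiset.map_singleton]
      exact (h.steps s hs).map fun _ _ => Red.inl
    · rw [hr, ← Multiset.map_singleton]
      exact (h'.steps s hs).map fun _ _ => Red.inr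
  · rintro _ (⟨s, hs, rfl⟩ | ⟨s, hs, rfl⟩) u hu
    · rw [hl] at hu
      obtain ⟨v, hv, rfl⟩ := Multiset.mem_map.1 hu
      simpa [irreducible_inl, Smaller] using h.smaller s hs v hv
    · rw [hr] at hu
      obtain ⟨v, hv, rfl⟩ := Multiset.mem_map.1 hu
      simpa [irreducible_inr, Smaller] using h'.smaller s hs v hv

/-- The hypothesis `hM` rules out an injection under the abstraction, which would make the
abstraction reducible even over an irreducible body. -/
theorem IsHeadStep.lam {M M' : Term} {K : ResTerm → ResMonomial → ResSum}
    (h : IsHeadStep M M' K) (hM : ∀ s ∈ M.resSet, (∀ r, s ≠ inl r) ∧ ∀ r, s ≠ inr r) :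
    ∃ F, IsHeadStep (.lam M) (.lam M') F := by
  obtain ⟨f, -, hf, -⟩ := exists_casesOn (fun _ _ => 0) (fun s t => (K s t).map ResTerm.lam)
    (fun _ _ _ => 0) (fun _ _ => 0) fun _ _ => 0
  replace hf : ∀ s t, f (ResTerm.lam s) t = (K s t).map ResTerm.lam := fun s t => by rw [hf]
  refine ⟨f, h.uniform.map (fun _ _ => lam_inj.1) mult_lam fun s _ => hf s, ?_, ?_⟩
  · rintro _ ⟨s, hs, rfl⟩
    rw [hf, ← Multiset.map_singleton]
    exact (h.steps s hs).map fun _ _ => Red.lam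
  · rintro _ ⟨s, hs, rfl⟩ u hu
    rw [hf] at hu
    obtain ⟨v, hv, rfl⟩ := Multiset.mem_map.1 hu
    rcases h.smaller s hs v hv with ⟨rfl, h⟩ | h
    · exact .inl ⟨rfl, irreducible_lam.2 ⟨h, hM v hs⟩⟩
    · right
      simp only [Smaller, size_lam, weight_lam] at h ⊢
      omega

theorem steps_bind_map {X Y Z : Type} {R : X → Multiset X → Prop} {Q : Y → Multiset Y → Prop}
    {P : Z → Multiset Z → Prop} {op : X → Y → Z}
    (hR : ∀ y s S, R s S → P (op s y) (S.map fun x => op x y))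
    (hQ : ∀ x s S, Q s S → P (op x s) (S.map (op x))) {x : X} {y : Y} {A : Multiset X}
    {B : Multiset Y} (hA : Steps R {x} A) (hB : Steps Q {y} B) :
    Steps P {op x y} (A.bind fun a => B.map (op a)) := by
  have h₁ : Steps P {op x y} (A.map fun a => op a y) := by
    simpa using hA.map (f := fun a => op a y) fun s S h => hR y s S h
  refine h₁.trans ?_
  rw [← Multiset.bind_singleton]
  refine Steps.bind fun a _ => ?_
  simpa using hB.map (f := op a) fun s S h => hQ a s S h

theorem conv_zero {X Y Z : Type} (op : X → Y → Z) (f : ResMonomial → Multiset X)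
    (g : ResMonomial → Multiset Y) :
    conv op f g 0 = (f 0).bind fun x => (g 0).map (op x) := by
  simp [conv]

theorem IsHeadStep.steps_monomial {M M' : Term} {K : ResTerm → ResMonomial → ResSum}
    (h : IsHeadStep M M' K) {t : ResMonomial} (ht : t ∈ monomials M.resSet) :
    Steps RedMonomial {t} (monomialSubst (t.map K) 0) := by
  induction t using Multiset.induction with
  | empty => simpa [monomialSubst_zero] using Steps.refl (R := RedMonomial) {0}
  | cons a t ih =>
    rw [monomials_cons] at ht
    rw [Multiset.map_cons, monomialSubst_cons, conv_zero]
    exact steps_bind_map (fun _ _ _ => RedMonomial.mk _) (fun _ _ _ => RedMonomial.cons _)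
      (h.steps a ht.1) (ih ht.2)

theorem IsHeadStep.smaller_monomial {M M' : Term} {K : ResTerm → ResMonomial → ResSum}
    (h : IsHeadStep M M' K) {t : ResMonomial} (ht : t ∈ monomials M.resSet) :
    ∀ v ∈ monomialSubst (t.map K) 0, v = t ∧ (∀ a ∈ t, Irreducible a) ∨
      (v.map size).sum < (t.map size).sum ∨
        (v.map size).sum = (t.map size).sum ∧ (v.map weight).sum < (t.map weight).sum := by
  induction t using Multiset.induction with
  | empty => simp [monomialSubst_zero]
  | cons a t ih =>
    rw [monomials_cons] at ht
    rw [Multiset.map_cons, monomialSubst_cons, conv_zero]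
    intro v hv
    simp only [Multiset.mem_bind, Multiset.mem_map] at hv
    obtain ⟨b, hb, w, hw, rfl⟩ := hv
    simp only [Multiset.map_cons, Multiset.sum_cons, Multiset.forall_mem_cons]
    rcases h.smaller a ht.1 b hb with ⟨rfl, h₁⟩ | h₁ <;>
      rcases ih ht.2 w hw with ⟨rfl, h₂⟩ | h₂
    · exact .inl ⟨rfl, h₁, h₂⟩
    · right
      omega
    · right
      simp only [Smaller] at h₁
      omega
    · right
      simp only [Smaller] at h₁
      omega

theorem IsHeadStep.app_neutral {M M' N N' : Term} {K L : ResTerm → ResMonomial → ResSum}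
    (h : IsHeadStep M M' K) (h' : IsHeadStep N N' L) (hM : M.isNeutral) :
    ∃ F, IsHeadStep (.app M N) (.app M' N') F := by
  obtain ⟨f, -, -, hf, -⟩ := exists_casesOn (fun _ _ => 0) (fun _ _ => 0)
    (fun s t => conv ResTerm.app (K s) (monomialSubst (t.map L))) (fun _ _ => 0) fun _ _ => 0
  refine ⟨f, h.uniform.app h'.uniform.monomial fun s _ t => hf s t, ?_, ?_⟩
  · rintro _ ⟨s, hs, t, ht, rfl⟩
    rw [hf, conv_zero]
    exact steps_bind_map (fun _ _ _ => Red.appFun _) (fun _ _ _ => RedMonomial.app _)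
      (h.steps s hs) (h'.steps_monomial ht)
  · rintro _ ⟨s, hs, t, ht, rfl⟩ u hu
    rw [hf, conv_zero] at hu
    simp only [Multiset.mem_bind, Multiset.mem_map] at hu
    obtain ⟨b, hb, w, hw, rfl⟩ := hu
    simp only [Smaller, size_app, weight_app]
    rcases h.smaller s hs b hb with ⟨rfl, h₁⟩ | h₁ <;>
      rcases h'.smaller_monomial ht w hw with ⟨rfl, h₂⟩ | h₂
    · obtain ⟨h₃, h₄, h₅⟩ := Term.ne_of_mem_resSet_of_isNeutral hM hs
      exact .inl ⟨rfl, irreducible_app.2 ⟨h₁, h₃, h₄, h₅, h₂⟩⟩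
    · right
      omega
    · right
      simp only [Smaller] at h₁
      omega
    · right
      simp only [Smaller] at h₁
      omega

theorem monomialSubst_pureKernel_id (t : ResMonomial) :
    monomialSubst (t.map (pureKernel id)) = fun u => if u = 0 then {t} else 0 := by
  induction t using Multiset.induction with
  | empty =>
    funext u
    rw [Multiset.map_zero, monomialSubst_zero]
  | cons a t ih =>
    funext u
    rw [Multiset.map_cons, monomialSubst_cons, ih]
    exact conv_ite _ _ _ _

/-- The arguments stay fixed and need not be normal, so `hM` is needed to exclude that the function
part is left unchanged as well. -/
theorem IsHeadStep.app_left {M M' N : Term} {K : ResTerm → ResMonomial → ResSum}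
    (h : IsHeadStep M M' K) (hM : ∀ s ∈ M.resSet, ¬ Irreducible s) :
    ∃ F, IsHeadStep (.app M N) (.app M' N) F := by
  obtain ⟨f, -, -, hf, -⟩ := exists_casesOn (fun _ _ => 0) (fun _ _ => 0)
    (fun s t => conv ResTerm.app (K s) (monomialSubst (t.map (pureKernel id)))) (fun _ _ => 0)
    fun _ _ => 0
  have hN : Uniform mult N.resSet N.resSet ∅ (pureKernel id) :=
    uniform_pureKernel (Set.injOn_id _) (Set.image_id _) fun _ _ => rfl
  have h₀ : ∀ s t, f (ResTerm.app s t) 0 = (K s 0).map fun s' => ResTerm.app s' t := by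
    intro s t
    rw [hf, conv_zero, monomialSubst_pureKernel_id]
    simp [Multiset.bind_singleton]
  refine ⟨f, h.uniform.app hN.monomial fun s _ t => hf s t, ?_, ?_⟩
  · rintro _ ⟨s, hs, t, ht, rfl⟩
    rw [h₀]
    simpa using (h.steps s hs).map fun _ _ => Red.appFun t
  · rintro _ ⟨s, hs, t, ht, rfl⟩ u hu
    rw [h₀] at hu
    obtain ⟨b, hb, rfl⟩ := Multiset.mem_map.1 hu
    rcases h.smaller s hs b hb with ⟨rfl, h₁⟩ | h₁
    · exact absurd h₁ (hM b hs)
    · right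
      simp only [Smaller, size_app, weight_app] at h₁ ⊢
      omega

theorem exists_isHeadStep (M : Term) : ∃ K, IsHeadStep M M.headRed K := by
  induction M with
  | var n => exact exists_isHeadStep_var n
  | plus M N ihM ihN =>
    obtain ⟨K, hK⟩ := ihM
    obtain ⟨L, hL⟩ := ihN
    exact hK.plus hL
  | lam M ih =>
    obtain ⟨K, hK⟩ := ih
    cases M with
    | plus M N => exact exists_isHeadStep_lam_plus M N
    | var n => exact hK.lam (by simp)
    | lam M =>
      refine hK.lam ?_
      rintro _ ⟨s, hs, rfl⟩
      simp
    | app M N =>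
      refine hK.lam ?_
      rintro _ ⟨s, hs, t, ht, rfl⟩
      simp
  | app M N ihM ihN =>
    obtain ⟨K, hK⟩ := ihM
    obtain ⟨L, hL⟩ := ihN
    cases M with
    | plus M P => exact exists_isHeadStep_app_plus M P N
    | lam M => exact exists_isHeadStep_beta M N
    | var n => exact hK.app_neutral hL rfl
    | app M P =>
      rw [Term.headRed]
      · split_ifs with h
        · exact hK.app_neutral hL h
        -- An irreducible approximant would force the function part `M P` to be neutral.
        · refine hK.app_left ?_
          rintro _ ⟨s, hs, t, ht, rfl⟩ hi
          exact h (Term.isNeutral_of_irreducible (M := .app M P) ⟨s, hs, t, ht, rfl⟩ hi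
            (by simp) (by simp) (by simp))
      all_goals simp

end ResTerm

namespace ResTerm

/-! ### Iterated head reduction -/

/-- Composition of kernels on the empty monomial. -/
noncomputable def compKernel (K L : ResTerm → ResMonomial → ResSum) (s : ResTerm)
    (t : ResMonomial) : ResSum :=
  if t = 0 then (K s 0).bind fun u => L u 0 else 0

theorem compKernel_zero (K L : ResTerm → ResMonomial → ResSum) (s : ResTerm) :
    compKernel K L s 0 = (K s 0).bind fun u => L u 0 := if_pos rfl

theorem mem_compKernel {K L : ResTerm → ResMonomial → ResSum} {s u : ResTerm} {t : ResMonomial} :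
    u ∈ compKernel K L s t ↔ t = 0 ∧ ∃ v ∈ K s 0, u ∈ L v 0 := by
  rw [compKernel]
  split_ifs with h <;> simp [h]

/-- The intermediate term `v` is determined by `u`, and the coefficients `mult s / mult v` and `mult
v / mult u` multiply. -/
theorem Uniform.comp {X Y W : Set ResTerm} {K L : ResTerm → ResMonomial → ResSum}
    (h : Uniform mult X Y ∅ K) (h' : Uniform mult Y W ∅ L) :
    Uniform mult X W ∅ (compKernel K L) where
  maps hs ht hu := by
    obtain ⟨-, v, hv, hu⟩ := mem_compKernel.1 hu
    exact h'.maps (h.maps hs zero_mem_monomials hv) zero_mem_monomials hu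
  surj hu := by
    obtain ⟨v, hv, t', ht', hu⟩ := h'.surj hu
    obtain ⟨s, hs, t, ht, hv⟩ := h.surj hv
    obtain rfl := monomials_empty.1 ht
    obtain rfl := monomials_empty.1 ht'
    exact ⟨s, hs, 0, zero_mem_monomials, mem_compKernel.2 ⟨rfl, v, hv, hu⟩⟩
  inj hs hs' hu hu' := by
    obtain ⟨rfl, v, hv, hu⟩ := mem_compKernel.1 hu
    obtain ⟨rfl, v', hv', hu'⟩ := mem_compKernel.1 hu'
    obtain ⟨rfl, -⟩ := h'.inj (h.maps hs zero_mem_monomials hv)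
      (h.maps hs' zero_mem_monomials hv') hu hu'
    exact ⟨(h.inj hs hs' hv hv').1, rfl⟩
  count {s t u} hs hu := by
    obtain ⟨rfl, v, hv, hu⟩ := mem_compKernel.1 hu
    have hvY := h.maps hs zero_mem_monomials hv
    rw [compKernel_zero, Multiset.count_bind, Multiset.sum_map_eq_nsmul_single v, smul_eq_mul,
      mul_assoc, h'.count hvY hu, mmult_zero, mul_one, h.count hs hv, mmult_zero, mul_one]
    intro v' hne hv'
    by_contra hc
    exact hne (h'.inj (h.maps hs zero_mem_monomials hv') hvY (Multiset.count_ne_zero.1 hc) hu).1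

/-- Hereditary head reduction of the approximants of a term. -/
noncomputable def headKernel (M : Term) : ResTerm → ResMonomial → ResSum :=
  (exists_isHeadStep M).choose

theorem isHeadStep_headKernel (M : Term) : IsHeadStep M M.headRed (headKernel M) :=
  (exists_isHeadStep M).choose_spec

/-- Iterated hereditary head reduction of the approximants of a term. -/
noncomputable def iterKernel : ℕ → Term → ResTerm → ResMonomial → ResSum
  | 0, _ => pureKernel id
  | n + 1, M => compKernel (headKernel M) (iterKernel n M.headRed)

theorem iterKernel_zero (M : Term) (s : ResTerm) : iterKernel 0 M s 0 = {s} := by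
  simp [iterKernel, pureKernel]

theorem iterKernel_succ (n : ℕ) (M : Term) (s : ResTerm) : iterKernel (n + 1) M s 0
    = (headKernel M s 0).bind fun u => iterKernel n M.headRed u 0 := compKernel_zero _ _ _

theorem uniform_iterKernel (n : ℕ) (M : Term) :
    Uniform mult M.resSet (Term.headRed^[n] M).resSet ∅ (iterKernel n M) := by
  induction n generalizing M with
  | zero => exact uniform_pureKernel (Set.injOn_id _) (Set.image_id _) fun _ _ => rfl
  | succ n ih => exact (isHeadStep_headKernel M).uniform.comp (ih _)

theorem mem_headRed_of_mem_headKernel {M : Term} {s u : ResTerm} (hs : s ∈ M.resSet)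
    (hu : u ∈ headKernel M s 0) : u ∈ M.headRed.resSet :=
  (isHeadStep_headKernel M).uniform.maps hs zero_mem_monomials hu

theorem steps_iterKernel (n : ℕ) {M : Term} {s : ResTerm} (hs : s ∈ M.resSet) :
    Steps Red {s} (iterKernel n M s 0) := by
  induction n generalizing M s with
  | zero => exact Steps.of_eq (iterKernel_zero M s).symm
  | succ n ih =>
    rw [iterKernel_succ]
    refine ((isHeadStep_headKernel M).steps s hs).trans ?_
    conv_lhs => rw [← Multiset.bind_singleton_self (headKernel M s 0)]
    exact Steps.bind fun u hu => ih (mem_headRed_of_mem_headKernel hs hu)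

/-- A head step is a reduction, so it cannot change a sum that is already normal. -/
theorem irreducible_iterKernel_succ {n : ℕ} {M : Term} {s : ResTerm} (hs : s ∈ M.resSet)
    (h : ∀ u ∈ iterKernel n M s 0, Irreducible u) :
    ∀ u ∈ iterKernel (n + 1) M s 0, Irreducible u := by
  induction n generalizing M s with
  | zero =>
    have := Steps.eq_of_irreducible ((isHeadStep_headKernel M).steps s hs) h
    rw [iterKernel_succ, ← this, Multiset.singleton_bind, iterKernel_zero]
    exact h
  | succ n ih =>
    intro u hu
    rw [iterKernel_succ] at hu h
    obtain ⟨v, hv, hu⟩ := Multiset.mem_bind.1 hu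
    exact ih (mem_headRed_of_mem_headKernel hs hv)
      (fun w hw => h w (Multiset.mem_bind.2 ⟨v, hv, hw⟩)) u hu

theorem irreducible_iterKernel_of_le {m n : ℕ} (hmn : m ≤ n) {M : Term} {s : ResTerm}
    (hs : s ∈ M.resSet) (h : ∀ u ∈ iterKernel m M s 0, Irreducible u) :
    ∀ u ∈ iterKernel n M s 0, Irreducible u := by
  induction n, hmn using Nat.le_induction with
  | base => exact h
  | succ n _ ih => exact irreducible_iterKernel_succ hs ih

/-- Well-founded induction on `s`: unless `s` is normal, a head step yields finitely many smaller
terms. -/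
theorem exists_irreducible_iterKernel {M : Term} {s : ResTerm} (hs : s ∈ M.resSet) :
    ∃ n, ∀ u ∈ iterKernel n M s 0, Irreducible u := by
  induction s using wellFounded_smaller.induction generalizing M with
  | _ s ih =>
    by_cases h : Irreducible s
    · exact ⟨0, by simpa [iterKernel_zero]⟩
    have key : ∀ u ∈ headKernel M s 0, ∃ n, ∀ v ∈ iterKernel n M.headRed u 0, Irreducible v := by
      intro u hu
      rcases (isHeadStep_headKernel M).smaller s hs u hu with h' | h'
      · exact absurd h'.2 h
      · exact ih u h' (mem_headRed_of_mem_headKernel hs hu)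
    choose! n hn using key
    -- The largest stage needed by the summands, plus the step that produced them.
    refine ⟨(headKernel M s 0).toFinset.sup n + 1, fun v hv => ?_⟩
    rw [iterKernel_succ] at hv
    obtain ⟨u, hu, hv⟩ := Multiset.mem_bind.1 hv
    exact irreducible_iterKernel_of_le (Finset.le_sup (Multiset.mem_toFinset.2 hu))
      (mem_headRed_of_mem_headKernel hs hu) (hn u hu) v hv

/-- Stating this for all large `n` allows normal forms of two approximants to be compared at a
common stage. -/
theorem exists_NF_eq_iterKernel {M : Term} {s : ResTerm} (hs : s ∈ M.resSet) :
    ∃ m, ∀ n, m ≤ n → NF {s} = iterKernel n M s 0 := by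
  obtain ⟨m, hm⟩ := exists_irreducible_iterKernel hs
  refine ⟨m, fun n hn => ?_⟩
  rw [NF_eq_of_steps (steps_iterKernel n hs),
    NF_of_irreducible (irreducible_iterKernel_of_le hn hs hm)]

end ResTerm

open ResTerm

-- Normal forms of approximants and the Böhm tree

namespace Term

/-- Every `eBT (L^n M)` belongs to the Böhm tree and dominates the members below it, and supports
are monotone. -/
theorem mem_taylorSupportBT {M : Term} {u : ResTerm} :
    u ∈ M.taylorSupportBT ↔ ∃ n, u ∈ (headRed^[n] M).resSet ∧ Irreducible u := by
  simp only [taylorSupportBT, Set.mem_iUnion, Approx.taylorSupport_eq]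
  constructor
  · rintro ⟨B, ⟨-, n, hB⟩, hu⟩
    exact ⟨n, of_mem_resSet_eBT (hB.resSet_subset hu)⟩
  · rintro ⟨n, hu, h⟩
    exact ⟨_, ⟨isElementary_eBT _, n, .refl _⟩, mem_resSet_eBT_of_irreducible hu h⟩

theorem mem_taylorSupportBT_of_mem_NF {M : Term} {s u : ResTerm} (hs : s ∈ M.resSet)
    (hu : u ∈ NF {s}) : u ∈ M.taylorSupportBT := by
  obtain ⟨n, hn⟩ := exists_NF_eq_iterKernel hs
  refine mem_taylorSupportBT.2 ⟨n, ?_, irreducible_of_mem_NF hu⟩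
  rw [hn n le_rfl] at hu
  exact (uniform_iterKernel n M).maps hs zero_mem_monomials hu

theorem count_NF_mul_mult {M : Term} {s u : ResTerm} (hs : s ∈ M.resSet) (hu : u ∈ NF {s}) :
    (NF {s}).count u * mult u = mult s := by
  obtain ⟨n, hn⟩ := exists_NF_eq_iterKernel hs
  rw [hn n le_rfl] at hu ⊢
  rw [(uniform_iterKernel n M).count hs hu, mmult_zero, mul_one]

theorem eq_of_mem_NF {M : Term} {s s' u : ResTerm} (hs : s ∈ M.resSet) (hs' : s' ∈ M.resSet)
    (hu : u ∈ NF {s}) (hu' : u ∈ NF {s'}) : s = s' := by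
  obtain ⟨n, hn⟩ := exists_NF_eq_iterKernel hs
  obtain ⟨n', hn'⟩ := exists_NF_eq_iterKernel hs'
  rw [hn _ (le_max_left n n')] at hu
  rw [hn' _ (le_max_right n n')] at hu'
  exact ((uniform_iterKernel _ M).inj hs hs' hu hu').1

/-- A normal element of `T(L^n M)` comes from some `s` by surjectivity of the iterate, and a normal
summand survives further reduction of the sum. -/
theorem exists_mem_NF {M : Term} {u : ResTerm} (hu : u ∈ M.taylorSupportBT) :
    ∃ s ∈ M.resSet, u ∈ NF {s} := by
  obtain ⟨n, hu, h⟩ := mem_taylorSupportBT.1 hu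
  obtain ⟨s, hs, t, ht, hu⟩ := (uniform_iterKernel n M).surj hu
  obtain rfl := monomials_empty.1 ht
  refine ⟨s, hs, ?_⟩
  rw [NF_eq_of_steps (steps_iterKernel n hs)]
  exact mem_NF_of_irreducible hu h

theorem NF_taylor_apply (M : Term) (u : ResTerm) :
    Vec.NF M.taylor u = if u ∈ M.taylorSupportBT then (mult u : ℚ≥0)⁻¹ else 0 := by
  have hM : ∀ s, M.taylor s = if s ∈ M.resSet then (mult s : ℚ≥0)⁻¹ else 0 :=
    M.toApprox.taylor_apply
  rw [Vec.NF]
  split_ifs with hu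
  · obtain ⟨s, hs, hus⟩ := exists_mem_NF hu
    have h₁ : (mult s : ℚ≥0) ≠ 0 := by exact_mod_cast (mult_pos s).ne'
    have h₂ : (mult u : ℚ≥0) ≠ 0 := by exact_mod_cast (mult_pos u).ne'
    rw [finsum_eq_single _ s]
    -- The single surviving term is `(1 / mult s) * (mult s / mult u)`.
    · rw [hM, if_pos hs, inv_mul_eq_iff_eq_mul₀ h₁, eq_mul_inv_iff_mul_eq₀ h₂]
      exact_mod_cast count_NF_mul_mult hs hus
    · intro s' hne
      by_cases hs' : s' ∈ M.resSet
      · rw [Multiset.count_eq_zero_of_notMem fun hus' => hne (eq_of_mem_NF hs' hs hus' hus),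
          Nat.cast_zero, mul_zero]
      · rw [hM, if_neg hs', zero_mul]
  · rw [← finsum_zero (α := ResTerm)]
    refine finsum_congr fun s => ?_
    by_cases hs : s ∈ M.resSet
    · rw [Multiset.count_eq_zero_of_notMem fun hus => hu (mem_taylorSupportBT_of_mem_NF hs hus),
        Nat.cast_zero, mul_zero]
    · rw [hM, if_neg hs, zero_mul]

end Term

end NDLambda

theorem mainTheorem1 :
    (∀ E : NDLambda.ResSum, ∃! F : NDLambda.ResSum, NDLambda.ResTerm.IsNormalFormOf F E) ∧
    ∀ M : NDLambda.Term,
      (∀ B ∈ M.BT, ∀ u ∈ B.taylorSupport, B.taylor u = (u.mult : ℚ≥0)⁻¹) ∧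
      M.taylorSupport.PairwiseDisjoint (fun s => {u | u ∈ NDLambda.ResTerm.NF {s}}) ∧
      M.taylorBT = NDLambda.Vec.NF M.taylor ∧
      Function.support (NDLambda.Vec.NF M.taylor) = M.taylorSupportBT ∧
      ∀ u ∈ M.taylorSupportBT, NDLambda.Vec.NF M.taylor u = (u.mult : ℚ≥0)⁻¹ := by
  refine ⟨NDLambda.ResTerm.existsUnique_isNormalFormOf, fun M => ⟨?_, ?_, ?_, ?_, ?_⟩⟩
  · intro B _ u hu
    rw [NDLambda.Approx.taylorSupport_eq] at hu
    rw [NDLambda.Approx.taylor_apply, if_pos hu]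
  · intro s hs s' hs' hne
    rw [NDLambda.Term.taylorSupport_eq] at hs hs'
    exact Set.disjoint_left.2 fun u hu hu' => hne (NDLambda.Term.eq_of_mem_NF hs hs' hu hu')
  · funext u
    rw [NDLambda.Term.NF_taylor_apply]
    rfl
  · ext u
    have : (u.mult : ℚ≥0) ≠ 0 := by exact_mod_cast (NDLambda.ResTerm.mult_pos u).ne'
    simp [NDLambda.Term.NF_taylor_apply, this]
  · intro u hu
    rw [NDLambda.Term.NF_taylor_apply, if_pos hu]
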